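/- Let $n\ge 2$ be an integer, let $h\colon\mathbb R\to\mathbb R$ be continuous, and let $B$ be the open unit ball of $\mathbb R^n$. For an open set $\Omega\subset\mathbb R^n$, a function $u\in W^{1,1}_{loc}(\Omega;\mathbb R^n)$ with weak Jacobian matrix $Du$ is called a weak solution of $$\operatorname{div}\bigl(h(\det Du)\operatorname{cof}Du\bigr)=0\quad\text{in }\Omega \qquad (*)$$ if $h(\det Du)\operatorname{cof}Du\in L^1_{loc}(\Omega)$ and $\int_\Omega h(\det Du)\operatorname{cof}Du:D\zeta\,dx=0$ for all $\zeta\in C^1_c(\Omega;\mathbb R^n)$. Here $\operatorname{cof}A$ is the cofactor matrix, $A^T\operatorname{cof}A=(\det A)I$, and $A:B=\sum_{i,j}A_{ij}B_{ij}$. Let $0<a\le b<1$ and let $\lambda_1\ne\lambda_2$ be real numbers; if $n$ is even, assume also that $\lambda_1\le 0\le\lambda_2$, so that the $n$-th roots below are real. Let $[t]^{1/n}$ denote the real $n$-th root of $t$ (the nonnegative one if $n$ is even), and let $u(x)=\phi(|x|)\,x$, where $$\phi(r)=\begin{cases}[\lambda_1(r^n-a^n)]^{1/n}/r & (0<r\le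 a),\\ 0 & (a<r\le b),\\ [\lambda_2(r^n-b^n)]^{1/n}/r & (b<r\le 1).\end{cases}$$ Then: 1. $u\in W^{1,p}(B;\mathbb R^n)$ for all $1\le p<\frac n{n-1}$; 2. $u$ is a weak solution of $(*)$ in $B$; 3. $u$ satisfies the Dirichlet boundary condition $u|_{\partial B}=[\lambda_2(1-b^n)]^{1/n}x$; that is, $u-[\lambda_2(1-b^n)]^{1/n}x\in W^{1,p}_0(B;\mathbb R^n)$ for all $1\le p<\frac n{n-1}$, and moreover $u$ is continuous up to $\partial B$ and takes these values on $\partial B$ pointwise; 4. $\det Du$ is not almost everywhere equal to a constant on $B$; 5. if $\lambda_2=0$, then $u\chi_B$ (equal to $u$ in $B$ and to $0$ outside) is a weak solution of $(*)$ on $\mathbb R^n$, and, for every $\zeta\in C^1(\mathbb R^n;\mathbb R^n)$ (not necessarily compactly supported), $h(\det Du)\operatorname{cof}Du:D\zeta$ is integrable on $B$ and $$\int_B h(\det Du)\operatorname{cof}Du:D\zeta\,dx=0.$$ -/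

import Mathlib

open MeasureTheory Filter Topology
open scoped ENNReal ContDiff

noncomputable section

namespace RadialDet

/-- The cofactor matrix, normalized by `Aᵀ * cof A = (det A) • 1`. -/
def cof {n : ℕ} (A : Matrix (Fin n) (Fin n) ℝ) : Matrix (Fin n) (Fin n) ℝ :=
  A.adjugate.transpose

/-- The inner product `A : B = ∑ i j, A i j * B i j` of matrices. -/
def frob {n : ℕ} (A B : Matrix (Fin n) (Fin n) ℝ) : ℝ :=
  ∑ i, ∑ j, A i j * B i j

/-- The Jacobian matrix `(Dζ)ᵢⱼ = ∂ζⁱ/∂xⱼ` of a (classically differentiable) map. -/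
def jacobian {n : ℕ} (ζ : EuclideanSpace ℝ (Fin n) → EuclideanSpace ℝ (Fin n))
    (x : EuclideanSpace ℝ (Fin n)) : Matrix (Fin n) (Fin n) ℝ :=
  Matrix.of fun i j => (fderiv ℝ ζ x (EuclideanSpace.single j 1)) i

/-- `ζ ∈ C_c^k(Ω; F)`: `ζ` is of class `C^k` and its support is a compact subset of `Ω`. -/
def IsTest {n : ℕ} {F : Type*} [NormedAddCommGroup F] [NormedSpace ℝ F] (k : ℕ∞)
    (Ω : Set (EuclideanSpace ℝ (Fin n))) (ζ : EuclideanSpace ℝ (Fin n) → F) : Prop :=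
  ContDiff ℝ k ζ ∧ HasCompactSupport ζ ∧ tsupport ζ ⊆ Ω

/-- `u ∈ W^{1,1}_loc(Ω; ℝⁿ)` with weak Jacobian matrix `G` (for `Ω` open). -/
def HasWeakJacobian {n : ℕ} (Ω : Set (EuclideanSpace ℝ (Fin n)))
    (u : EuclideanSpace ℝ (Fin n) → EuclideanSpace ℝ (Fin n))
    (G : EuclideanSpace ℝ (Fin n) → Matrix (Fin n) (Fin n) ℝ) : Prop :=
  LocallyIntegrableOn u Ω ∧
  (∀ i j, LocallyIntegrableOn (fun x => G x i j) Ω) ∧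
  ∀ η : EuclideanSpace ℝ (Fin n) → ℝ, IsTest ⊤ Ω η → ∀ i j,
    ∫ x in Ω, u x i * fderiv ℝ η x (EuclideanSpace.single j 1) = - ∫ x in Ω, G x i j * η x

/-- `u ∈ W^{1,p}(Ω; ℝⁿ)`. -/
def MemW1p {n : ℕ} (p : ℝ≥0∞) (Ω : Set (EuclideanSpace ℝ (Fin n)))
    (u : EuclideanSpace ℝ (Fin n) → EuclideanSpace ℝ (Fin n)) : Prop :=
  ∃ G, HasWeakJacobian Ω u G ∧ MemLp u p (volume.restrict Ω) ∧
    ∀ i j, MemLp (fun x => G x i j) p (volume.restrict Ω)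

/-- `u ∈ W^{1,p}_0(Ω; ℝⁿ)`: `u` lies in the closure of `C_c^∞(Ω; ℝⁿ)` in `W^{1,p}(Ω; ℝⁿ)`. -/
def MemW1pZero {n : ℕ} (p : ℝ≥0∞) (Ω : Set (EuclideanSpace ℝ (Fin n)))
    (u : EuclideanSpace ℝ (Fin n) → EuclideanSpace ℝ (Fin n)) : Prop :=
  ∃ G, HasWeakJacobian Ω u G ∧ MemLp u p (volume.restrict Ω) ∧
    (∀ i j, MemLp (fun x => G x i j) p (volume.restrict Ω)) ∧
    ∃ ζ : ℕ → EuclideanSpace ℝ (Fin n) → EuclideanSpace ℝ (Fin n),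
      (∀ k, IsTest ⊤ Ω (ζ k)) ∧
      Tendsto (fun k => eLpNorm (fun x => u x - ζ k x) p (volume.restrict Ω)) atTop (𝓝 0) ∧
      ∀ i j, Tendsto (fun k => eLpNorm (fun x => G x i j - jacobian (ζ k) x i j) p
        (volume.restrict Ω)) atTop (𝓝 0)

/-- `u` is a weak solution of `div (h(det Du) cof Du) = 0` in the open set `Ω`. -/
def IsWeakSolution {n : ℕ} (h : ℝ → ℝ) (Ω : Set (EuclideanSpace ℝ (Fin n)))
    (u : EuclideanSpace ℝ (Fin n) → EuclideanSpace ℝ (Fin n)) : Prop :=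
  ∃ G, HasWeakJacobian Ω u G ∧
    (∀ i j, LocallyIntegrableOn (fun x => h (G x).det * cof (G x) i j) Ω) ∧
    ∀ ζ : EuclideanSpace ℝ (Fin n) → EuclideanSpace ℝ (Fin n), IsTest 1 Ω ζ →
      ∫ x in Ω, h (G x).det * frob (cof (G x)) (jacobian ζ x) = 0

/-- The real `n`-th root: the nonnegative root of `t ≥ 0`, and for `t < 0` (used only when `n` is
odd) the negative real root. -/
def realRoot (n : ℕ) (t : ℝ) : ℝ :=
  if 0 ≤ t then t ^ (1 / (n : ℝ)) else -((-t) ^ (1 / (n : ℝ)))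

/-- The radial profile `φ`. -/
def profile (n : ℕ) (a b l₁ l₂ r : ℝ) : ℝ :=
  if r ≤ a then realRoot n (l₁ * (r ^ n - a ^ n)) / r
  else if r ≤ b then 0
  else realRoot n (l₂ * (r ^ n - b ^ n)) / r

/-- The radial map `u(x) = φ(|x|) x`. -/
def radialMap (n : ℕ) (a b l₁ l₂ : ℝ) (x : EuclideanSpace ℝ (Fin n)) :
    EuclideanSpace ℝ (Fin n) :=
  profile n a b l₁ l₂ ‖x‖ • x

end RadialDet

end

noncomputable section

namespace RadialDet

set_option linter.unusedSectionVars false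

open Set Metric

/-! ### Integrability of radial weights -/

/-! Off the origin and the spheres `|x| = a`, `|x| = b` the map is smooth and radial. With `s =
|x|²` and `f(s) = φ(√s)`, its Jacobian is `f I + 2 f' x ⊗ x`, whose determinant `f^(n-1) (f + 2 s
f')` is the derivative of `(r φ)^n` with respect to `r^n`. Since `(r φ)^n = l (r^n - c^n)` in each
region, the determinant is locally constant, with values `l₁`, `0`, `l₂` (`sqProfile_identity`).
Hence `h(det Du)` is locally constant too, and continuity of `h` suffices. The stress `h(det Du) cof
Du` has the form `(M + s K) I - K x ⊗ x` with `2 M' = (n-1) K`, so it is divergence free in each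
region (`sum_fderiv_radialMat_eq_zero`).

It remains to show that the singular set contributes nothing. This is done with cutoffs `θ((k+1)
g)`, where `g` is a polynomial in `|x|²` vanishing exactly on the singular set; their gradients are
bounded by `C |∇g| / |g|` uniformly in `k` and tend to zero pointwise off the singular set, so
dominated convergence applies (`integral_mul_fderiv_of_contDiffAt`,
`integral_sum_mul_fderiv_eq_zero`).

At the spheres `|u| ≤ C |r - c|^(1/n)`, which turns the simple pole of `|∇g| / |g|` into the
integrable `|r - c|^(1/n - 1)`. This gives weak differentiability. For the stress, only the flux
`stress · x = M x` meets `∇g`, and `M` contains a power of `φ` but no derivative.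

At the origin `M` may be of size `r^(-(n-1))`, so the flux through small spheres need not be small.
A test field with `ζ(0) = 0` gains the missing factor `r` (`integral_frob_stress_of_apply_zero`).
The remaining part `η ζ(0)`, with an even bump `η`, is handled by parity: the stress is even and the
derivative of an even field is odd (`integral_frob_stress_of_even`).

The gradient is dominated by `1/r + 1 + |r - a|^(1/n - 1) + |r - b|^(1/n - 1)`, which is in `L^p`
for `p < n/(n-1)`. For the boundary condition, `u - c x` is `O(1 - |x|²)` near the unit sphere, so a
further cutoff there yields test functions converging in `W^{1,p}`. The weak formulation is proved
on all of `ℝⁿ` and then restricted; this also yields the claim for `u χ_B` when `l₂ = 0`. -/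

lemma integrableOn_abs_sub_rpow (c : ℝ) {β : ℝ} (hβ : -1 < β) (R : ℝ) :
    IntegrableOn (fun r : ℝ => |r - c| ^ β) (Ioo 0 R) := by
  have h1 : ∀ S : ℝ, IntervalIntegrable (fun r : ℝ => |r| ^ β) volume 0 S := by
    have h0 : ∀ S : ℝ, 0 ≤ S → IntervalIntegrable (fun r : ℝ => |r| ^ β) volume 0 S := by
      intro S hS
      refine (intervalIntegral.intervalIntegrable_rpow' hβ (a := 0) (b := S)).congr ?_
      intro r hr
      rw [uIoc_of_le hS] at hr
      simp only [abs_of_pos hr.1]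
    intro S
    rcases le_total 0 S with hS | hS
    · exact h0 S hS
    · have := (IntervalIntegrable.iff_comp_neg (f := fun r : ℝ => |r| ^ β) (a := 0) (b := -S)).1
        (h0 (-S) (by linarith))
      simpa using this
  have h2 : ∀ S T : ℝ, IntervalIntegrable (fun r : ℝ => |r| ^ β) volume S T := fun S T =>
    (h1 S).symm.trans (h1 T)
  rcases le_total 0 R with hR | hR
  · have := (h2 (0 - c) (R - c)).comp_sub_right c
    simp only [sub_add_cancel] at this
    rw [intervalIntegrable_iff_integrableOn_Ioo_of_le hR] at this
    exact this
  · simp [Ioo_eq_empty (not_lt.2 hR)]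

/-- The radial weight dominating the radial derivatives of the map. -/
def weight (n : ℕ) (a b r : ℝ) : ℝ :=
  1 + |r - a| ^ (1 / (n : ℝ) - 1) + |r - b| ^ (1 / (n : ℝ) - 1)

lemma one_le_weight (n : ℕ) (a b r : ℝ) : 1 ≤ weight n a b r := by
  have h1 : 0 ≤ |r - a| ^ (1 / (n : ℝ) - 1) := by positivity
  have h2 : 0 ≤ |r - b| ^ (1 / (n : ℝ) - 1) := by positivity
  unfold weight
  linarith

lemma neg_one_lt_root_exponent {n : ℕ} (hn : 2 ≤ n) : -1 < 1 / (n : ℝ) - 1 := by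
  have : 0 < 1 / (n : ℝ) := by positivity
  linarith

lemma integrableOn_weight {n : ℕ} (hn : 2 ≤ n) (a b R : ℝ) :
    IntegrableOn (weight n a b) (Ioo 0 R) := by
  have h0 : IntegrableOn (fun _ : ℝ => (1 : ℝ)) (Ioo 0 R) := by
    simp [integrableOn_const_iff]
  exact (h0.add (integrableOn_abs_sub_rpow a (neg_one_lt_root_exponent hn) R)).add
    (integrableOn_abs_sub_rpow b (neg_one_lt_root_exponent hn) R)

lemma nontrivial_euclidean {n : ℕ} (hn : 2 ≤ n) : Nontrivial (EuclideanSpace ℝ (Fin n)) := by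
  apply Module.nontrivial_of_finrank_pos (R := ℝ)
  rw [finrank_euclideanSpace_fin]
  omega

lemma locallyIntegrable_of_integrableOn_ball {n : ℕ} {F : Type*} [NormedAddCommGroup F]
    {f : EuclideanSpace ℝ (Fin n) → F} (h : ∀ R, IntegrableOn f (ball 0 R)) :
    LocallyIntegrable f := by
  rw [locallyIntegrable_iff]
  intro K hK
  obtain ⟨R, -, hR⟩ := hK.isBounded.exists_pos_norm_lt
  exact (h R).mono_set fun x hx => mem_ball_zero_iff.mpr (hR x hx)

/-- In polar coordinates the factor `r^(n-1)` cancels the pole at the origin. This function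
dominates both the stress and its flux. -/
lemma integrableOn_weight_div {n : ℕ} (hn : 2 ≤ n) (a b R : ℝ) :
    IntegrableOn (fun x : EuclideanSpace ℝ (Fin n) => (‖x‖ ^ (n - 1))⁻¹ * weight n a b ‖x‖)
      (ball 0 R) := by
  have := nontrivial_euclidean hn
  rw [integrableOn_fun_norm_addHaar volume
    (f := fun r : ℝ => (r ^ (n - 1))⁻¹ * weight n a b r)]
  refine (integrableOn_weight hn a b R).congr_fun ?_ measurableSet_Ioo
  intro y hy
  have : y ^ (n - 1) ≠ 0 := pow_ne_zero _ hy.1.ne'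
  simp only [finrank_euclideanSpace_fin, smul_eq_mul]
  rw [mul_inv_cancel_left₀ this]

lemma memLp_of_integrableOn_radial {n : ℕ} (hn : 2 ≤ n) {p : ℝ} (hp : 1 ≤ p) {f : ℝ → ℝ}
    (hf : Measurable f) {R : ℝ}
    (h : IntegrableOn (fun y => y ^ (n - 1) * |f y| ^ p) (Ioo 0 R)) :
    MemLp (fun x : EuclideanSpace ℝ (Fin n) => f ‖x‖) (ENNReal.ofReal p)
      (volume.restrict (ball 0 R)) := by
  have := nontrivial_euclidean hn
  have hp0 : 0 < p := by linarith
  have hm : AEStronglyMeasurable (fun x : EuclideanSpace ℝ (Fin n) => f ‖x‖)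
      (volume.restrict (ball 0 R)) := (hf.comp measurable_norm).aestronglyMeasurable
  rw [← integrable_norm_rpow_iff hm
    (by simpa using hp0) ENNReal.ofReal_ne_top, ENNReal.toReal_ofReal hp0.le]
  have := (integrableOn_fun_norm_addHaar (E := EuclideanSpace ℝ (Fin n)) volume
    (f := fun r : ℝ => |f r| ^ p) (r := R)).2 (by simpa [finrank_euclideanSpace_fin] using h)
  exact this

lemma memLp_abs_norm_sub_rpow {n : ℕ} (hn : 2 ≤ n) {p : ℝ} (hp : 1 ≤ p)
    {β : ℝ} (hβ : -1 < β * p) (c R : ℝ) :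
    MemLp (fun x : EuclideanSpace ℝ (Fin n) => |‖x‖ - c| ^ β) (ENNReal.ofReal p)
      (volume.restrict (ball 0 R)) := by
  refine memLp_of_integrableOn_radial hn hp (f := fun r => |r - c| ^ β) (by fun_prop) ?_
  refine Integrable.bdd_mul (c := |R| ^ (n - 1)) (f := fun y : ℝ => y ^ (n - 1)) ?_
    (by fun_prop) ?_
  · refine (integrableOn_abs_sub_rpow c hβ R).congr_fun ?_ measurableSet_Ioo
    intro y _
    simp only
    rw [abs_of_nonneg (Real.rpow_nonneg (abs_nonneg _) _), ← Real.rpow_mul (abs_nonneg _)]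
  · filter_upwards [ae_restrict_mem measurableSet_Ioo] with y hy
    rw [norm_pow, Real.norm_eq_abs]
    refine pow_le_pow_left₀ (abs_nonneg _) ?_ _
    rw [abs_of_pos hy.1]
    exact hy.2.le.trans (le_abs_self R)

lemma memLp_inv_norm {n : ℕ} (hn : 2 ≤ n) {p : ℝ} (hp : 1 ≤ p) (hpn : p < n) (R : ℝ) :
    MemLp (fun x : EuclideanSpace ℝ (Fin n) => ‖x‖⁻¹) (ENNReal.ofReal p)
      (volume.restrict (ball 0 R)) := by
  refine memLp_of_integrableOn_radial hn hp (f := fun r => r⁻¹) (by fun_prop) ?_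
  have : IntegrableOn (fun y : ℝ => y ^ ((n : ℝ) - 1 - p)) (Ioo 0 R) := by
    by_cases hR : 0 < R
    · rw [intervalIntegral.integrableOn_Ioo_rpow_iff hR]
      linarith
    · simp [hR]
  refine this.congr_fun ?_ measurableSet_Ioo
  intro y hy
  have hy0 : 0 < y := hy.1
  simp only
  rw [abs_of_pos (inv_pos.2 hy0), Real.inv_rpow hy0.le, Real.rpow_sub hy0, div_eq_mul_inv,
    ← Real.rpow_natCast y (n - 1)]
  congr 2
  push_cast [Nat.cast_sub (by omega : 1 ≤ n)]
  ring

/-- The second inequality is a rewriting of `p < n/(n-1)`: it is the integrability of `|r - c|^((1/n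
- 1) p)` across a sphere, and it fixes the Sobolev range. The first, needed for `1/|x|`, is weaker
because `n/(n-1) ≤ n`. -/
lemma sobolev_exponent_lt {n : ℕ} (hn : 2 ≤ n) {p : ℝ} (hpn : p < (n : ℝ) / ((n : ℝ) - 1)) :
    p < n ∧ -1 < (1 / (n : ℝ) - 1) * p := by
  have h2 : (2 : ℝ) ≤ n := by exact_mod_cast hn
  have h3 : p * ((n : ℝ) - 1) < n := (lt_div_iff₀ (by linarith)).1 hpn
  constructor
  · refine hpn.trans_le ?_
    rw [div_le_iff₀ (by linarith)]
    nlinarith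
  · have : (1 / (n : ℝ) - 1) * p = -(p * ((n : ℝ) - 1) / n) := by
      field_simp
      ring
    rw [this, neg_lt_neg_iff, div_lt_one (by linarith)]
    exact h3

lemma memLp_weight {n : ℕ} (hn : 2 ≤ n) {p : ℝ} (hp : 1 ≤ p)
    (hpn : p < (n : ℝ) / ((n : ℝ) - 1)) (a b R : ℝ) :
    MemLp (fun x : EuclideanSpace ℝ (Fin n) => ‖x‖⁻¹ + weight n a b ‖x‖) (ENNReal.ofReal p)
      (volume.restrict (ball 0 R)) := by
  obtain ⟨h1, h2⟩ := sobolev_exponent_lt hn hpn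
  have : IsFiniteMeasure (volume.restrict (ball (0 : EuclideanSpace ℝ (Fin n)) R)) :=
    ⟨by simpa using measure_ball_lt_top⟩
  exact (memLp_inv_norm hn hp h1 R).add (((memLp_const (1 : ℝ)).add
    (memLp_abs_norm_sub_rpow hn hp h2 a R)).add (memLp_abs_norm_sub_rpow hn hp h2 b R))

/-! ### Dominated convergence in `L^p` -/

lemma tendsto_eLpNorm_zero_of_dominated {α F : Type*} [MeasurableSpace α] [NormedAddCommGroup F]
    {μ : Measure α} {p : ℝ} (hp : 1 ≤ p) {f : ℕ → α → F} {g : α → ℝ}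
    (hg : MemLp g (ENNReal.ofReal p) μ) (hf : ∀ k, AEStronglyMeasurable (f k) μ)
    (hfg : ∀ k, ∀ᵐ x ∂μ, ‖f k x‖ ≤ g x) (hlim : ∀ᵐ x ∂μ, Tendsto (fun k => f k x) atTop (𝓝 0)) :
    Tendsto (fun k => eLpNorm (f k) (ENNReal.ofReal p) μ) atTop (𝓝 0) := by
  have hp0 : 0 < p := by linarith
  have hne : ENNReal.ofReal p ≠ 0 := by simpa using hp0
  have h1 : Tendsto (fun k => ∫⁻ x, ‖f k x‖ₑ ^ p ∂μ) atTop (𝓝 (∫⁻ _, 0 ∂μ)) := by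
    refine tendsto_lintegral_of_dominated_convergence' (fun x => ‖g x‖ₑ ^ p) ?_ ?_ ?_ ?_
    · intro k
      exact (hf k).enorm.pow_const p
    · intro k
      filter_upwards [hfg k] with x hx
      refine ENNReal.rpow_le_rpow ?_ hp0.le
      rw [← ofReal_norm, ← ofReal_norm]
      exact ENNReal.ofReal_le_ofReal (hx.trans (le_abs_self _))
    · have := lintegral_rpow_enorm_lt_top_of_eLpNorm_lt_top hne ENNReal.ofReal_ne_top hg.2
      rw [ENNReal.toReal_ofReal hp0.le] at this
      exact this.ne
    · filter_upwards [hlim] with x hx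
      have h2 : Tendsto (fun k => ‖f k x‖ₑ) atTop (𝓝 0) := by
        have := (continuous_enorm.tendsto (0 : F)).comp hx
        simpa [Function.comp_def] using this
      have := (ENNReal.continuous_rpow_const (y := p)).tendsto 0 |>.comp h2
      simpa [Function.comp_def, ENNReal.zero_rpow_of_pos hp0] using this
  simp only [lintegral_zero] at h1
  have h3 := (ENNReal.continuous_rpow_const (y := 1 / p)).tendsto 0 |>.comp h1
  rw [ENNReal.zero_rpow_of_pos (by positivity)] at h3
  refine h3.congr fun k => ?_
  rw [eLpNorm_eq_lintegral_rpow_enorm_toReal hne ENNReal.ofReal_ne_top,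
    ENNReal.toReal_ofReal hp0.le]
  rfl

/-! ### Cutoff functions -/

/-- A smooth function equal to `0` on `(-∞, 1]` and to `1` on `[2, ∞)`. -/
def cutoff (t : ℝ) : ℝ := Real.smoothTransition (t - 1)

lemma contDiff_cutoff {m : ℕ∞} : ContDiff ℝ m cutoff :=
  Real.smoothTransition.contDiff.comp (contDiff_id.sub contDiff_const)

lemma cutoff_nonneg (t : ℝ) : 0 ≤ cutoff t := Real.smoothTransition.nonneg _

lemma cutoff_le_one (t : ℝ) : cutoff t ≤ 1 := Real.smoothTransition.le_one _

lemma cutoff_eq_zero {t : ℝ} (ht : t ≤ 1) : cutoff t = 0 :=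
  Real.smoothTransition.zero_of_nonpos (by linarith)

lemma cutoff_eq_one {t : ℝ} (ht : 2 ≤ t) : cutoff t = 1 :=
  Real.smoothTransition.one_of_one_le (by linarith)

/-- The derivative lives on `[1, 2]`. The product with `t` is invariant under rescaling of the
argument, hence suited to bounds uniform in `k`. -/
lemma exists_abs_mul_deriv_cutoff_le : ∃ C, 0 ≤ C ∧ ∀ t, |t * deriv cutoff t| ≤ C := by
  have hc : Continuous (fun t => t * deriv cutoff t) :=
    continuous_id.mul ((contDiff_cutoff (m := 1)).continuous_deriv le_rfl)
  obtain ⟨C, hC⟩ := isCompact_Icc.exists_bound_of_continuousOn (s := Icc (1 : ℝ) 2)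
    hc.continuousOn
  have hC0 : 0 ≤ C := (norm_nonneg _).trans (hC 1 (by norm_num))
  refine ⟨C, hC0, fun t => ?_⟩
  by_cases h1 : t < 1
  · have : cutoff =ᶠ[𝓝 t] fun _ => 0 := by
      filter_upwards [Iio_mem_nhds h1] with y hy
      exact cutoff_eq_zero (le_of_lt hy)
    rw [this.deriv_eq]
    simpa using hC0
  by_cases h2 : 2 < t
  · have : cutoff =ᶠ[𝓝 t] fun _ => 1 := by
      filter_upwards [Ioi_mem_nhds h2] with y hy
      exact cutoff_eq_one (le_of_lt hy)
    rw [this.deriv_eq]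
    simpa using hC0
  · exact hC t ⟨not_lt.1 h1, not_lt.1 h2⟩

/-! ### Cutoffs adapted to the zero set of a function -/

section CutoffAlong

variable {E : Type*} [NormedAddCommGroup E] [NormedSpace ℝ E]

/-- Cutoff functions vanishing near `{g ≤ 0}` and converging to `1` on `{g > 0}`. -/
def cutoffAlong (g : E → ℝ) (k : ℕ) (x : E) : ℝ := cutoff (((k : ℝ) + 1) * g x)

variable {g : E → ℝ} {k : ℕ} {x : E}

lemma contDiff_cutoffAlong {m : ℕ∞} (hg : ContDiff ℝ m g) (k : ℕ) :
    ContDiff ℝ m (cutoffAlong g k) :=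
  contDiff_cutoff.comp (contDiff_const.mul hg)

lemma cutoffAlong_nonneg : 0 ≤ cutoffAlong g k x := cutoff_nonneg _

lemma cutoffAlong_le_one : cutoffAlong g k x ≤ 1 := cutoff_le_one _

lemma abs_cutoffAlong_le_one : |cutoffAlong g k x| ≤ 1 := by
  rw [abs_of_nonneg cutoffAlong_nonneg]
  exact cutoffAlong_le_one

/-- Valid for every `k`, since `k + 1 ≥ 1`; this keeps the cutoff inactive near the boundary of the
ball once `g` is scaled up. -/
lemma cutoffAlong_eq_one (hx : 2 ≤ g x) : cutoffAlong g k x = 1 := by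
  refine cutoff_eq_one ?_
  have : (0 : ℝ) ≤ k := k.cast_nonneg
  nlinarith

lemma tsupport_cutoffAlong_subset (hg : Continuous g) :
    tsupport (cutoffAlong g k) ⊆ {x | 1 ≤ ((k : ℝ) + 1) * g x} := by
  refine closure_minimal ?_ (isClosed_le continuous_const (continuous_const.mul hg))
  intro x hx
  by_contra h
  exact hx (cutoff_eq_zero (le_of_lt (not_le.1 h)))

lemma tsupport_cutoffAlong_subset_pos (hg : Continuous g) :
    tsupport (cutoffAlong g k) ⊆ {x | 0 < g x} := by
  refine (tsupport_cutoffAlong_subset hg).trans fun x hx => ?_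
  have h1 : (1 : ℝ) ≤ ((k : ℝ) + 1) * g x := hx
  have h2 : (0 : ℝ) < (k : ℝ) + 1 := by positivity
  exact (mul_pos_iff_of_pos_left h2).1 (by linarith)

lemma eventually_cutoffAlong_eventuallyEq (hg : Continuous g) (hx : 0 < g x) :
    ∀ᶠ k in atTop, cutoffAlong g k =ᶠ[𝓝 x] fun _ => 1 := by
  -- For such `k` the argument of the cutoff exceeds `2` on the whole neighbourhood `{g > g x / 2}`.
  have h1 : ∀ᶠ k : ℕ in atTop, 2 / (g x / 2) ≤ (k : ℝ) :=
    tendsto_natCast_atTop_atTop.eventually_ge_atTop _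
  filter_upwards [h1] with k hk
  filter_upwards [hg.continuousAt.eventually_mem (Ioi_mem_nhds (half_lt_self hx))] with y hy
  refine cutoff_eq_one ?_
  rw [div_le_iff₀ (by positivity)] at hk
  have hy' : g x / 2 < g y := hy
  have : (0 : ℝ) ≤ k := k.cast_nonneg
  nlinarith

lemma tendsto_cutoffAlong (hg : Continuous g) (hx : 0 < g x) :
    Tendsto (fun k => cutoffAlong g k x) atTop (𝓝 1) := by
  refine tendsto_const_nhds.congr' ?_
  filter_upwards [eventually_cutoffAlong_eventuallyEq hg hx] with k hk
  exact hk.eq_of_nhds.symm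

lemma tendsto_fderiv_cutoffAlong (hg : Continuous g) (hx : 0 < g x) (v : E) :
    Tendsto (fun k => fderiv ℝ (cutoffAlong g k) x v) atTop (𝓝 0) := by
  refine tendsto_const_nhds.congr' ?_
  filter_upwards [eventually_cutoffAlong_eventuallyEq hg hx] with k hk
  rw [hk.fderiv_eq]
  simp

lemma fderiv_cutoffAlong (hg : ContDiff ℝ 1 g) :
    fderiv ℝ (cutoffAlong g k) x
      = (deriv cutoff (((k : ℝ) + 1) * g x) * ((k : ℝ) + 1)) • fderiv ℝ g x := by
  have h1 : HasDerivAt cutoff (deriv cutoff (((k : ℝ) + 1) * g x)) (((k : ℝ) + 1) * g x) :=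
    ((contDiff_cutoff (m := 1)).differentiable (by norm_num) _).hasDerivAt
  have h2 : HasFDerivAt (fun y => ((k : ℝ) + 1) * g y) (((k : ℝ) + 1) • fderiv ℝ g x) x :=
    ((hg.differentiable (by norm_num) x).hasFDerivAt).const_mul _
  have := (h1.comp_hasFDerivAt x h2).fderiv
  rw [mul_smul, ← this]
  rfl

/-- The chain rule factor `k + 1` is absorbed by writing `(k+1) θ'(t) = t θ'(t) / g` with `t = (k+1)
g`. What is left is the logarithmic derivative of `g`, independent of `k`. -/
lemma abs_fderiv_cutoffAlong_le {C : ℝ} (hC : ∀ t, |t * deriv cutoff t| ≤ C)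
    (hg : ContDiff ℝ 1 g) (hx : g x ≠ 0) (v : E) :
    |fderiv ℝ (cutoffAlong g k) x v| ≤ C * (|fderiv ℝ g x v| / |g x|) := by
  rw [fderiv_cutoffAlong hg, smul_apply, smul_eq_mul]
  have : deriv cutoff (((k : ℝ) + 1) * g x) * ((k : ℝ) + 1) * fderiv ℝ g x v
      = ((((k : ℝ) + 1) * g x) * deriv cutoff (((k : ℝ) + 1) * g x)) * (fderiv ℝ g x v / g x) := by
    field_simp
  rw [this, abs_mul, abs_div]
  exact mul_le_mul_of_nonneg_right (hC _) (by positivity)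

end CutoffAlong

/-! ### Integration by parts off a null set -/

section IntegrationByParts

variable {E : Type*} [NormedAddCommGroup E] [NormedSpace ℝ E] [FiniteDimensional ℝ E]
  [MeasurableSpace E] [BorelSpace E] {μ : Measure E} [μ.IsAddHaarMeasure]
  {f g η : E → ℝ} {k : ℕ}

/-- The support of the cutoff lies in `{g > 0}`, where `f` is smooth; off that support the product
is locally zero, however singular `f` may be. -/
lemma contDiff_cutoffAlong_smul {m : ℕ∞} {F : Type*} [NormedAddCommGroup F] [NormedSpace ℝ F]
    {f : E → F} (hg : ContDiff ℝ m g) (hf : ∀ x, 0 < g x → ContDiffAt ℝ m f x) (k : ℕ) :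
    ContDiff ℝ m (fun x => cutoffAlong g k x • f x) := by
  rw [contDiff_iff_contDiffAt]
  intro x
  by_cases hx : x ∈ tsupport (cutoffAlong g k)
  · exact (contDiff_cutoffAlong hg k).contDiffAt.smul
      (hf x (tsupport_cutoffAlong_subset_pos hg.continuous hx))
  · have : (fun y => cutoffAlong g k y • f y) =ᶠ[𝓝 x] fun _ => 0 := by
      filter_upwards [notMem_tsupport_iff_eventuallyEq.1 hx] with y hy
      rw [hy]
      simp
    exact contDiffAt_const.congr_of_eventuallyEq this

lemma fderiv_cutoffAlong_smul {F : Type*} [NormedAddCommGroup F] [NormedSpace ℝ F]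
    {f : E → F} (hg : ContDiff ℝ 1 g) (hf : ∀ x, 0 < g x → ContDiffAt ℝ 1 f x) (k : ℕ) (x v : E) :
    fderiv ℝ (fun x => cutoffAlong g k x • f x) x v
      = cutoffAlong g k x • fderiv ℝ f x v + fderiv ℝ (cutoffAlong g k) x v • f x := by
  by_cases hx : x ∈ tsupport (cutoffAlong g k)
  · have h1 : DifferentiableAt ℝ (cutoffAlong g k) x :=
      (contDiff_cutoffAlong (m := 1) hg k).differentiable (by norm_num) x
    have h2 : DifferentiableAt ℝ f x :=
      (hf x (tsupport_cutoffAlong_subset_pos hg.continuous hx)).differentiableAt (by norm_num)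
    rw [fderiv_fun_smul h1 h2]
    simp
  · have h0 := notMem_tsupport_iff_eventuallyEq.1 hx
    have : (fun y => cutoffAlong g k y • f y) =ᶠ[𝓝 x] fun _ => 0 := by
      filter_upwards [h0] with y hy
      rw [hy]
      simp
    rw [this.fderiv_eq, h0.fderiv_eq, h0.eq_of_nhds]
    simp

lemma integrable_cutoffAlong_mul_fderiv (hg : ContDiff ℝ 1 g)
    (hf : ∀ x, 0 < g x → ContDiffAt ℝ 1 f x) (hη : ContDiff ℝ 1 η) (hηc : HasCompactSupport η)
    (k : ℕ) (v : E) :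
    Integrable (fun x => cutoffAlong g k x * f x * fderiv ℝ η x v) μ ∧
    Integrable (fun x => (cutoffAlong g k x * fderiv ℝ f x v
      + fderiv ℝ (cutoffAlong g k) x v * f x) * η x) μ := by
  have hP : ContDiff ℝ 1 (fun x => cutoffAlong g k x * f x) :=
    contDiff_cutoffAlong_smul (m := 1) hg hf k
  have hD := fderiv_cutoffAlong_smul hg hf k
  simp only [smul_eq_mul] at hD
  constructor
  · exact (hP.continuous.mul (hη.continuous_fderiv_apply (by norm_num) |>.comp
      (continuous_id.prodMk continuous_const))).integrable_of_hasCompactSupport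
      ((hηc.fderiv_apply (𝕜 := ℝ) v).mul_left)
  · simp only [← hD]
    exact ((hP.continuous_fderiv_apply (by norm_num) |>.comp
      (continuous_id.prodMk continuous_const)).mul hη.continuous).integrable_of_hasCompactSupport
      hηc.mul_left

lemma integral_cutoffAlong_mul_fderiv (hg : ContDiff ℝ 1 g)
    (hf : ∀ x, 0 < g x → ContDiffAt ℝ 1 f x) (hη : ContDiff ℝ 1 η) (hηc : HasCompactSupport η)
    (k : ℕ) (v : E) :
    ∫ x, cutoffAlong g k x * f x * fderiv ℝ η x v ∂μ
      = -∫ x, (cutoffAlong g k x * fderiv ℝ f x v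
          + fderiv ℝ (cutoffAlong g k) x v * f x) * η x ∂μ := by
  have hP : ContDiff ℝ 1 (fun x => cutoffAlong g k x * f x) :=
    contDiff_cutoffAlong_smul (m := 1) hg hf k
  have hD := fderiv_cutoffAlong_smul hg hf k
  obtain ⟨h1, h2⟩ := integrable_cutoffAlong_mul_fderiv (μ := μ) hg hf hη hηc k v
  simp only [smul_eq_mul] at hD
  simp only [← hD] at h2 ⊢
  exact integral_mul_fderiv_eq_neg_fderiv_mul_of_integrable h2 h1
    ((hP.continuous.mul hη.continuous).integrable_of_hasCompactSupport hηc.mul_left)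
    (fun x _ => hP.differentiable (by norm_num) x) (fun x _ => hη.differentiable (by norm_num) x)

lemma integrable_mul_of_locallyIntegrable (hf : LocallyIntegrable f μ) (hη : Continuous η)
    (hηc : HasCompactSupport η) : Integrable (fun x => f x * η x) μ :=
  hf.integrable_smul_right_of_hasCompactSupport hη hηc

/-- A function of class `C¹` off the null set `{g ≤ 0}` is weakly differentiable, if its
derivative is locally integrable and it is small enough near the null set. -/
theorem integral_mul_fderiv_of_contDiffAt {f' W : E → ℝ} {v : E} (hg : ContDiff ℝ 1 g)
    (hgpos : ∀ᵐ x ∂μ, 0 < g x) (hf : ∀ x, 0 < g x → ContDiffAt ℝ 1 f x)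
    (hf' : ∀ x, 0 < g x → fderiv ℝ f x v = f' x) (hfi : LocallyIntegrable f μ)
    (hfi' : LocallyIntegrable f' μ) (hW : LocallyIntegrable W μ)
    (hfW : ∀ᵐ x ∂μ, |f x| * (|fderiv ℝ g x v| / |g x|) ≤ W x)
    (hη : ContDiff ℝ 1 η) (hηc : HasCompactSupport η) :
    ∫ x, f x * fderiv ℝ η x v ∂μ = -∫ x, f' x * η x ∂μ := by
  obtain ⟨C, hC0, hC⟩ := exists_abs_mul_deriv_cutoff_le
  have hθc : ∀ k, Continuous (cutoffAlong g k) := fun k =>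
    (contDiff_cutoffAlong (m := 1) hg k).continuous
  have hθc' : ∀ k, Continuous (fun x => fderiv ℝ (cutoffAlong g k) x v) := fun k =>
    ((contDiff_cutoffAlong (m := 1) hg k).continuous_fderiv_apply (by norm_num)).comp
      (continuous_id.prodMk continuous_const)
  have hη' : Continuous (fun x => fderiv ℝ η x v) :=
    (hη.continuous_fderiv_apply (by norm_num)).comp (continuous_id.prodMk continuous_const)
  have hi : Integrable (fun x => f x * fderiv ℝ η x v) μ :=
    integrable_mul_of_locallyIntegrable hfi hη' (hηc.fderiv_apply (𝕜 := ℝ) v)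
  have hi' : Integrable (fun x => f' x * η x) μ :=
    integrable_mul_of_locallyIntegrable hfi' hη.continuous hηc
  have hiW : Integrable (fun x => W x * η x) μ :=
    integrable_mul_of_locallyIntegrable hW hη.continuous hηc
  have hL : Tendsto (fun k => ∫ x, cutoffAlong g k x * f x * fderiv ℝ η x v ∂μ) atTop
      (𝓝 (∫ x, f x * fderiv ℝ η x v ∂μ)) := by
    refine tendsto_integral_of_dominated_convergence (fun x => |f x * fderiv ℝ η x v|) ?_ hi.abs
      ?_ ?_
    · intro k
      simp only [mul_assoc]
      exact (hθc k).aestronglyMeasurable.mul hi.aestronglyMeasurable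
    · intro k
      refine Eventually.of_forall fun x => ?_
      rw [mul_assoc, Real.norm_eq_abs, abs_mul]
      exact mul_le_of_le_one_left (abs_nonneg _) abs_cutoffAlong_le_one
    · filter_upwards [hgpos] with x hx
      have := ((tendsto_cutoffAlong hg.continuous hx).mul_const (f x)).mul_const (fderiv ℝ η x v)
      simpa using this
  have hR : Tendsto (fun k => ∫ x, (cutoffAlong g k x * fderiv ℝ f x v
      + fderiv ℝ (cutoffAlong g k) x v * f x) * η x ∂μ) atTop (𝓝 (∫ x, f' x * η x ∂μ)) := by
    have hcongr : ∀ k, (fun x => (cutoffAlong g k x * fderiv ℝ f x v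
        + fderiv ℝ (cutoffAlong g k) x v * f x) * η x) =ᵐ[μ]
        fun x => (cutoffAlong g k x * f' x + fderiv ℝ (cutoffAlong g k) x v * f x) * η x := by
      intro k
      filter_upwards [hgpos] with x hx
      rw [hf' x hx]
    simp only [fun k => integral_congr_ae (hcongr k)]
    refine tendsto_integral_of_dominated_convergence
      (fun x => |f' x * η x| + C * |W x * η x|) ?_ (hi'.abs.add (hiW.abs.const_mul C)) ?_ ?_
    · intro k
      exact (((hθc k).aestronglyMeasurable.mul hfi'.aestronglyMeasurable).add
        ((hθc' k).aestronglyMeasurable.mul hfi.aestronglyMeasurable)).mul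
        hη.continuous.aestronglyMeasurable
    · intro k
      filter_upwards [hgpos, hfW] with x hx hxW
      have h1 := abs_fderiv_cutoffAlong_le (k := k) hC hg hx.ne' v
      have h2 : |fderiv ℝ (cutoffAlong g k) x v * f x| ≤ C * |W x| := by
        rw [abs_mul]
        calc _ ≤ C * (|fderiv ℝ g x v| / |g x|) * |f x| :=
              mul_le_mul_of_nonneg_right h1 (abs_nonneg _)
          _ = C * (|f x| * (|fderiv ℝ g x v| / |g x|)) := by ring
          _ ≤ _ := mul_le_mul_of_nonneg_left (hxW.trans (le_abs_self _)) hC0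
      have h3 : |cutoffAlong g k x * f' x| ≤ |f' x| := by
        rw [abs_mul]
        exact mul_le_of_le_one_left (abs_nonneg _) abs_cutoffAlong_le_one
      rw [Real.norm_eq_abs, abs_mul, abs_mul (f' x), abs_mul (W x)]
      calc _ ≤ (|f' x| + C * |W x|) * |η x| :=
            mul_le_mul_of_nonneg_right ((abs_add_le _ _).trans (add_le_add h3 h2)) (abs_nonneg _)
        _ = _ := by ring
    · filter_upwards [hgpos] with x hx
      have := (((tendsto_cutoffAlong hg.continuous hx).mul_const (f' x)).add
        ((tendsto_fderiv_cutoffAlong hg.continuous hx v).mul_const (f x))).mul_const (η x)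
      simpa using this
  -- Both sides of the classical identity for the truncated function pass to the limit; the term
  -- with the gradient of the cutoff disappears.
  refine tendsto_nhds_unique hL ?_
  simp only [integral_cutoffAlong_mul_fderiv hg hf hη hηc]
  exact hR.neg

/-- A field of class `C¹` and divergence free off the null set `{g ≤ 0}` is weakly divergence
free, if its flux across the null set vanishes. -/
theorem integral_sum_mul_fderiv_eq_zero {ι : Type*} [Fintype ι] {F : ι → E → ℝ} {v : ι → E}
    {ζ : ι → E → ℝ} {W : E → ℝ} (hg : ContDiff ℝ 1 g) (hgpos : ∀ᵐ x ∂μ, 0 < g x)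
    (hF : ∀ i x, 0 < g x → ContDiffAt ℝ 1 (F i) x)
    (hFi : ∀ i, LocallyIntegrable (F i) μ)
    (hζ : ∀ i, ContDiff ℝ 1 (ζ i)) (hζc : ∀ i, HasCompactSupport (ζ i))
    (hdiv : ∀ x, 0 < g x → ∑ i, fderiv ℝ (F i) x (v i) * ζ i x = 0)
    (hW : Integrable W μ)
    (hFW : ∀ᵐ x ∂μ, |∑ i, fderiv ℝ g x (v i) * F i x * ζ i x| / |g x| ≤ W x) :
    ∫ x, ∑ i, F i x * fderiv ℝ (ζ i) x (v i) ∂μ = 0 := by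
  obtain ⟨C, hC0, hC⟩ := exists_abs_mul_deriv_cutoff_le
  have hθc : ∀ k, Continuous (cutoffAlong g k) := fun k =>
    (contDiff_cutoffAlong (m := 1) hg k).continuous
  have hθc' : ∀ k w, Continuous (fun x => fderiv ℝ (cutoffAlong g k) x w) := fun k w =>
    ((contDiff_cutoffAlong (m := 1) hg k).continuous_fderiv_apply (by norm_num)).comp
      (continuous_id.prodMk continuous_const)
  have hζ' : ∀ i, Continuous (fun x => fderiv ℝ (ζ i) x (v i)) := fun i =>
    ((hζ i).continuous_fderiv_apply (by norm_num)).comp (continuous_id.prodMk continuous_const)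
  have hi : Integrable (fun x => ∑ i, F i x * fderiv ℝ (ζ i) x (v i)) μ :=
    integrable_finsetSum _ fun i _ =>
      integrable_mul_of_locallyIntegrable (hFi i) (hζ' i) ((hζc i).fderiv_apply (𝕜 := ℝ) (v i))
  have hL : Tendsto (fun k => ∫ x, cutoffAlong g k x * ∑ i, F i x * fderiv ℝ (ζ i) x (v i) ∂μ)
      atTop (𝓝 (∫ x, ∑ i, F i x * fderiv ℝ (ζ i) x (v i) ∂μ)) := by
    refine tendsto_integral_of_dominated_convergence
      (fun x => |∑ i, F i x * fderiv ℝ (ζ i) x (v i)|) ?_ hi.abs ?_ ?_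
    · intro k
      exact (hθc k).aestronglyMeasurable.mul hi.aestronglyMeasurable
    · intro k
      refine Eventually.of_forall fun x => ?_
      rw [Real.norm_eq_abs, abs_mul]
      exact mul_le_of_le_one_left (abs_nonneg _) abs_cutoffAlong_le_one
    · filter_upwards [hgpos] with x hx
      have := (tendsto_cutoffAlong hg.continuous hx).mul_const
        (∑ i, F i x * fderiv ℝ (ζ i) x (v i))
      simpa using this
  have hk : ∀ k, ∫ x, cutoffAlong g k x * ∑ i, F i x * fderiv ℝ (ζ i) x (v i) ∂μ
      = -∫ x, ∑ i, fderiv ℝ (cutoffAlong g k) x (v i) * F i x * ζ i x ∂μ := by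
    intro k
    have hI := fun i => integrable_cutoffAlong_mul_fderiv (μ := μ) hg (hF i) (hζ i) (hζc i) k (v i)
    calc _ = ∫ x, ∑ i, cutoffAlong g k x * F i x * fderiv ℝ (ζ i) x (v i) ∂μ := by
          simp only [Finset.mul_sum, mul_assoc]
      _ = ∑ i, ∫ x, cutoffAlong g k x * F i x * fderiv ℝ (ζ i) x (v i) ∂μ :=
          integral_finsetSum _ fun i _ => (hI i).1
      _ = -∑ i, ∫ x, (cutoffAlong g k x * fderiv ℝ (F i) x (v i)
          + fderiv ℝ (cutoffAlong g k) x (v i) * F i x) * ζ i x ∂μ := by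
          rw [← Finset.sum_neg_distrib]
          exact Finset.sum_congr rfl fun i _ =>
            integral_cutoffAlong_mul_fderiv hg (hF i) (hζ i) (hζc i) k (v i)
      _ = -∫ x, ∑ i, (cutoffAlong g k x * fderiv ℝ (F i) x (v i)
          + fderiv ℝ (cutoffAlong g k) x (v i) * F i x) * ζ i x ∂μ := by
          rw [integral_finsetSum _ fun i _ => (hI i).2]
      _ = _ := by
          congr 1
          refine integral_congr_ae ?_
          filter_upwards [hgpos] with x hx
          have := hdiv x hx
          simp only [add_mul, Finset.sum_add_distrib, mul_assoc, ← Finset.mul_sum, this, mul_zero,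
            zero_add]
  have hR : Tendsto (fun k => ∫ x, ∑ i, fderiv ℝ (cutoffAlong g k) x (v i) * F i x * ζ i x ∂μ)
      atTop (𝓝 (∫ _, (0 : ℝ) ∂μ)) := by
    refine tendsto_integral_of_dominated_convergence (fun x => C * W x) ?_ (hW.const_mul C) ?_ ?_
    · intro k
      refine Finset.aestronglyMeasurable_fun_sum _ fun i _ => ?_
      exact ((hθc' k (v i)).aestronglyMeasurable.mul (hFi i).aestronglyMeasurable).mul
        (hζ i).continuous.aestronglyMeasurable
    · intro k
      filter_upwards [hgpos, hFW] with x hx hxW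
      set c := ((k : ℝ) + 1) * g x with hc
      -- The factor from the cutoff is common to all terms, so only the total flux of the field
      -- along `∇g` has to be dominated. Single terms may fail to be integrable, and the
      -- cancellation within the sum is essential in the application.
      have h1 : ∑ i, fderiv ℝ (cutoffAlong g k) x (v i) * F i x * ζ i x
          = (c * deriv cutoff c) * ((∑ i, fderiv ℝ g x (v i) * F i x * ζ i x) / g x) := by
        simp only [fderiv_cutoffAlong hg, smul_apply, smul_eq_mul, Finset.sum_div, Finset.mul_sum]
        refine Finset.sum_congr rfl fun i _ => ?_
        rw [hc]
        field_simp
      rw [h1, Real.norm_eq_abs, abs_mul, abs_div]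
      exact mul_le_mul (hC c) hxW (by positivity) hC0
    · filter_upwards [hgpos] with x hx
      have : Tendsto (fun k => ∑ i, fderiv ℝ (cutoffAlong g k) x (v i) * F i x * ζ i x) atTop
          (𝓝 (∑ i, 0 * F i x * ζ i x)) :=
        tendsto_finsetSum _ fun i _ =>
          ((tendsto_fderiv_cutoffAlong hg.continuous hx (v i)).mul_const _).mul_const _
      simpa using this
  refine tendsto_nhds_unique hL ?_
  simp only [hk]
  simpa using hR.neg

end IntegrationByParts

/-! ### Radial matrix fields -/

section RadialMatrix

variable {n : ℕ}

/-- The matrix `α I + β x ⊗ x`. -/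
def radialMat (α β : ℝ) (x : EuclideanSpace ℝ (Fin n)) : Matrix (Fin n) (Fin n) ℝ :=
  Matrix.of fun i j => α * (1 : Matrix (Fin n) (Fin n) ℝ) i j + β * (x i * x j)

lemma radialMat_apply (α β : ℝ) (x : EuclideanSpace ℝ (Fin n)) (i j : Fin n) :
    radialMat α β x i j = α * (1 : Matrix (Fin n) (Fin n) ℝ) i j + β * (x i * x j) := rfl

lemma radialMat_eq (α β : ℝ) (x : EuclideanSpace ℝ (Fin n)) :
    radialMat α β x = α • (1 : Matrix (Fin n) (Fin n) ℝ)
      + β • Matrix.vecMulVec (fun i => x i) (fun i => x i) := by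
  ext i j
  simp [radialMat_apply, Matrix.vecMulVec_apply]

lemma dotProduct_self_eq_norm_sq (x : EuclideanSpace ℝ (Fin n)) :
    (fun i => x i) ⬝ᵥ (fun i => x i) = ‖x‖ ^ 2 := by
  rw [EuclideanSpace.real_norm_sq_eq]
  simp [dotProduct, sq]

/-- For `α ≠ 0`, factor out `α` and apply the determinant formula for a rank one perturbation of the
identity. For `α = 0` the matrix has rank at most one and size at least two, so both sides vanish.
-/
lemma det_radialMat (hn : 2 ≤ n) (α β : ℝ) (x : EuclideanSpace ℝ (Fin n)) :
    (radialMat α β x).det = α ^ (n - 1) * (α + β * ‖x‖ ^ 2) := by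
  have : Nontrivial (Fin n) := Fin.nontrivial_iff_two_le.2 hn
  rw [radialMat_eq]
  by_cases hα : α = 0
  · subst hα
    have h1 : n - 1 ≠ 0 := by omega
    simp [Matrix.det_vecMulVec, h1]
  · have h1 : α • (1 : Matrix (Fin n) (Fin n) ℝ)
        + β • Matrix.vecMulVec (fun i => x i) (fun i => x i)
        = α • (1 + Matrix.replicateCol Unit (fun i => (β / α) * x i)
            * Matrix.replicateRow Unit (fun i => x i)) := by
      ext i j
      simp [Matrix.vecMulVec_apply, Matrix.mul_apply]
      field_simp
    have h2 : (fun i => x i) ⬝ᵥ (fun i => (β / α) * x i) = β / α * ‖x‖ ^ 2 := by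
      rw [← dotProduct_self_eq_norm_sq]
      simp only [dotProduct, Finset.mul_sum]
      exact Finset.sum_congr rfl fun i _ => by ring
    rw [h1, Matrix.det_smul, Matrix.det_one_add_replicateCol_mul_replicateRow, h2,
      Fintype.card_fin]
    obtain ⟨m, rfl⟩ : ∃ m, n = m + 1 := ⟨n - 1, by omega⟩
    simp only [Nat.add_sub_cancel, pow_succ]
    field_simp

lemma radialMat_mul_radialMat (α β α' β' : ℝ) (x : EuclideanSpace ℝ (Fin n)) :
    radialMat α β x * radialMat α' β' x
      = radialMat (α * α') (α * β' + β * α' + β * β' * ‖x‖ ^ 2) x := by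
  simp only [radialMat_eq, mul_add, add_mul, Matrix.smul_mul, Matrix.mul_smul, one_mul, mul_one,
    Matrix.vecMulVec_mul_vecMulVec, dotProduct_self_eq_norm_sq, smul_smul]
  ext i j
  simp [Matrix.vecMulVec_apply]
  ring

lemma transpose_radialMat (α β : ℝ) (x : EuclideanSpace ℝ (Fin n)) :
    (radialMat α β x).transpose = radialMat α β x := by
  ext i j
  simp [radialMat_apply, Matrix.one_apply, eq_comm, mul_comm]

/-- The product of the two radial matrices is `det • 1`, and multiplying by the adjugate allows
`det` to be cancelled. The two alternatives cover every case met here: a region with nonzero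
determinant, or one where the map vanishes. -/
lemma cof_radialMat (hn : 2 ≤ n) (α β : ℝ) (x : EuclideanSpace ℝ (Fin n))
    (h : (radialMat α β x).det ≠ 0 ∨ (α = 0 ∧ β = 0)) :
    cof (radialMat α β x)
      = radialMat (α ^ (n - 1) + ‖x‖ ^ 2 * (α ^ (n - 2) * β)) (-(α ^ (n - 2) * β)) x := by
  have : Nontrivial (Fin n) := Fin.nontrivial_iff_two_le.2 hn
  rcases h with h | ⟨rfl, rfl⟩
  · have h1 : radialMat α β x
        * radialMat (α ^ (n - 1) + ‖x‖ ^ 2 * (α ^ (n - 2) * β)) (-(α ^ (n - 2) * β)) x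
        = (radialMat α β x).det • (1 : Matrix (Fin n) (Fin n) ℝ) := by
      rw [radialMat_mul_radialMat, det_radialMat hn, radialMat_eq]
      obtain ⟨m, rfl⟩ : ∃ m, n = m + 2 := ⟨n - 2, by omega⟩
      simp only [show m + 2 - 1 = m + 1 by omega, Nat.add_sub_cancel, pow_succ]
      have : α * -(α ^ m * β) + β * (α ^ m * α + ‖x‖ ^ 2 * (α ^ m * β))
          + β * -(α ^ m * β) * ‖x‖ ^ 2 = 0 := by ring
      simp only [pow_succ] at this
      rw [this, zero_smul, add_zero]
      congr 1
      ring
    have h2 : (radialMat α β x).adjugate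
        = radialMat (α ^ (n - 1) + ‖x‖ ^ 2 * (α ^ (n - 2) * β)) (-(α ^ (n - 2) * β)) x := by
      have h3 : (radialMat α β x).adjugate * (radialMat α β x
          * radialMat (α ^ (n - 1) + ‖x‖ ^ 2 * (α ^ (n - 2) * β)) (-(α ^ (n - 2) * β)) x)
          = (radialMat α β x).det • (radialMat α β x).adjugate := by
        rw [h1, Matrix.mul_smul, mul_one]
      rw [← mul_assoc, Matrix.adjugate_mul, Matrix.smul_mul, one_mul] at h3
      exact (smul_right_injective _ h h3).symm
    rw [cof, h2, transpose_radialMat]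
  · have h1 : n - 1 ≠ 0 := by omega
    simp [cof, radialMat_eq, h1, Matrix.adjugate_zero]

lemma sum_radialMat_mul (α β : ℝ) (x : EuclideanSpace ℝ (Fin n)) (i : Fin n) :
    ∑ j, radialMat α β x i j * x j = (α + β * ‖x‖ ^ 2) * x i := by
  simp only [radialMat_apply, add_mul, Finset.sum_add_distrib, mul_assoc, ← Finset.mul_sum,
    Matrix.one_apply, ite_mul, one_mul, zero_mul, Finset.sum_ite_eq, Finset.mem_univ, if_true]
  rw [EuclideanSpace.real_norm_sq_eq]
  simp only [← sq]
  ring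

lemma abs_apply_le_norm (x : EuclideanSpace ℝ (Fin n)) (i : Fin n) : |x i| ≤ ‖x‖ :=
  PiLp.norm_apply_le x i

lemma abs_radialMat_le (α β : ℝ) (x : EuclideanSpace ℝ (Fin n)) (i j : Fin n) :
    |radialMat α β x i j| ≤ |α| + ‖x‖ ^ 2 * |β| := by
  rw [radialMat_apply]
  refine (abs_add_le _ _).trans (add_le_add ?_ ?_)
  · rw [abs_mul]
    refine mul_le_of_le_one_right (abs_nonneg _) ?_
    rw [Matrix.one_apply]
    split_ifs <;> simp
  · rw [abs_mul, abs_mul, mul_comm, sq]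
    exact mul_le_mul_of_nonneg_right (mul_le_mul (abs_apply_le_norm x i) (abs_apply_le_norm x j)
      (abs_nonneg _) (norm_nonneg _)) (abs_nonneg _)

end RadialMatrix

/-! ### Derivatives of radial fields -/

section RadialDerivative

variable {n : ℕ} {x : EuclideanSpace ℝ (Fin n)} {f : ℝ → ℝ} {f' : ℝ}

lemma hasFDerivAt_comp_norm_sq (hf : HasDerivAt f f' (‖x‖ ^ 2)) :
    HasFDerivAt (fun y : EuclideanSpace ℝ (Fin n) => f (‖y‖ ^ 2))
      (f' • ((2 : ℝ) • innerSL ℝ x)) x := by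
  have h : HasFDerivAt (fun y : EuclideanSpace ℝ (Fin n) => ‖y‖ ^ 2)
      ((2 : ℝ) • innerSL ℝ x) x := by
    have h2 := (hasStrictFDerivAt_norm_sq x).hasFDerivAt
    rw [← Nat.cast_smul_eq_nsmul ℝ] at h2
    exact_mod_cast h2
  exact hf.comp_hasFDerivAt x h

lemma hasFDerivAt_apply (i : Fin n) :
    HasFDerivAt (fun y : EuclideanSpace ℝ (Fin n) => y i)
      (EuclideanSpace.proj i : EuclideanSpace ℝ (Fin n) →L[ℝ] ℝ) x :=
  (EuclideanSpace.proj i : EuclideanSpace ℝ (Fin n) →L[ℝ] ℝ).hasFDerivAt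

lemma fderiv_comp_norm_sq_single (hf : HasDerivAt f f' (‖x‖ ^ 2)) (j : Fin n) :
    fderiv ℝ (fun y : EuclideanSpace ℝ (Fin n) => f (‖y‖ ^ 2)) x (EuclideanSpace.single j 1)
      = 2 * f' * x j := by
  rw [(hasFDerivAt_comp_norm_sq hf).fderiv]
  simp [EuclideanSpace.inner_single_right]
  ring

lemma fderiv_radial_single (hf : HasDerivAt f f' (‖x‖ ^ 2)) (i j : Fin n) :
    fderiv ℝ (fun y : EuclideanSpace ℝ (Fin n) => f (‖y‖ ^ 2) * y i) x
      (EuclideanSpace.single j 1) = radialMat (f (‖x‖ ^ 2)) (2 * f') x i j := by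
  refine (congrArg (fun L => L (EuclideanSpace.single j 1))
    ((hasFDerivAt_comp_norm_sq hf).mul (hasFDerivAt_apply i)).fderiv).trans ?_
  simp only [add_apply, smul_apply, smul_eq_mul, innerSL_apply_apply,
    EuclideanSpace.inner_single_right, radialMat_apply]
  by_cases hij : i = j
  · subst hij
    simp
    ring
  · simp [hij]
    ring

/-- A radial matrix field `(M + sK) I - K x ⊗ x`, where `s = |x|²` and `2 M' = (n-1) K`, is
divergence free. -/
lemma sum_fderiv_radialMat_eq_zero {M K : ℝ → ℝ} {K' : ℝ}
    (hM : HasDerivAt M (((n : ℝ) - 1) / 2 * K (‖x‖ ^ 2)) (‖x‖ ^ 2))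
    (hK : HasDerivAt K K' (‖x‖ ^ 2)) (i : Fin n) :
    ∑ j, fderiv ℝ (fun y : EuclideanSpace ℝ (Fin n) =>
      radialMat (M (‖y‖ ^ 2) + ‖y‖ ^ 2 * K (‖y‖ ^ 2)) (-K (‖y‖ ^ 2)) y i j) x
      (EuclideanSpace.single j 1) = 0 := by
  have h1 : HasDerivAt (fun s => M s + s * K s)
      (((n : ℝ) - 1) / 2 * K (‖x‖ ^ 2) + (1 * K (‖x‖ ^ 2) + ‖x‖ ^ 2 * K')) (‖x‖ ^ 2) :=
    hM.add ((hasDerivAt_id _).mul hK)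
  have h2 : ∀ j, fderiv ℝ (fun y : EuclideanSpace ℝ (Fin n) =>
      radialMat (M (‖y‖ ^ 2) + ‖y‖ ^ 2 * K (‖y‖ ^ 2)) (-K (‖y‖ ^ 2)) y i j) x
      (EuclideanSpace.single j 1)
      = 2 * (((n : ℝ) - 1) / 2 * K (‖x‖ ^ 2) + (K (‖x‖ ^ 2) + ‖x‖ ^ 2 * K')) * (x j *
          (1 : Matrix (Fin n) (Fin n) ℝ) i j)
        - 2 * K' * x i * (x j * x j) - K (‖x‖ ^ 2) * (x j * (1 : Matrix (Fin n) (Fin n) ℝ) i j)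
        - K (‖x‖ ^ 2) * x i := by
    intro j
    have h3 := ((hasFDerivAt_comp_norm_sq h1).mul_const
      ((1 : Matrix (Fin n) (Fin n) ℝ) i j)).add ((hasFDerivAt_comp_norm_sq hK.neg).mul
        ((hasFDerivAt_apply (x := x) i).mul (hasFDerivAt_apply (x := x) j)))
    have h4 := h3.fderiv
    simp only [Pi.neg_apply] at h4
    refine (congrArg (fun L => L (EuclideanSpace.single j 1)) h4).trans ?_
    simp only [add_apply, smul_apply, smul_eq_mul, innerSL_apply_apply,
      EuclideanSpace.inner_single_right]
    by_cases hij : i = j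
    · subst hij
      simp
      ring
    · simp [hij]
      ring
  -- Summation over `j` turns the last term into `n K xᵢ`. The derivatives `K'` cancel because `∑
  -- xⱼ² = |x|²`, and the relation between `M'` and `K` cancels the rest.
  simp only [h2, Finset.sum_sub_distrib, ← Finset.mul_sum, Matrix.one_apply, mul_ite, mul_one,
    mul_zero, Finset.sum_ite_eq, Finset.mem_univ, if_true, Finset.sum_const, Finset.card_univ,
    Fintype.card_fin, nsmul_eq_mul]
  have h5 : ∑ j, x j * x j = ‖x‖ ^ 2 := by
    rw [EuclideanSpace.real_norm_sq_eq]
    simp [sq]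
  rw [h5]
  ring

end RadialDerivative

/-! ### The real root -/

lemma realRoot_zero {n : ℕ} (hn : n ≠ 0) : realRoot n 0 = 0 := by
  have : (1 : ℝ) / n ≠ 0 := by positivity
  simp only [realRoot, le_refl, if_true]
  exact Real.zero_rpow this

lemma abs_realRoot (n : ℕ) (t : ℝ) : |realRoot n t| = |t| ^ (1 / (n : ℝ)) := by
  unfold realRoot
  split_ifs with h
  · rw [abs_of_nonneg (Real.rpow_nonneg h _), abs_of_nonneg h]
  · have h' : 0 ≤ -t := by linarith
    rw [abs_neg, abs_of_nonneg (Real.rpow_nonneg h' _), abs_of_neg (not_le.1 h)]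

lemma realRoot_pow {n : ℕ} (hn : n ≠ 0) {t : ℝ} (ht : Even n → 0 ≤ t) : realRoot n t ^ n = t := by
  unfold realRoot
  split_ifs with h
  · rw [one_div, Real.rpow_inv_natCast_pow h hn]
  · have hodd : Odd n := Nat.not_even_iff_odd.1 fun he => h (ht he)
    rw [hodd.neg_pow, one_div, Real.rpow_inv_natCast_pow (by linarith) hn, neg_neg]

lemma contDiffAt_realRoot {n : ℕ} {t : ℝ} (ht : t ≠ 0) : ContDiffAt ℝ ∞ (realRoot n) t := by
  rcases lt_or_gt_of_ne ht with h | h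
  · have h1 : realRoot n =ᶠ[𝓝 t] fun y => -((-y) ^ (1 / (n : ℝ))) := by
      filter_upwards [Iio_mem_nhds h] with y hy
      simp only [realRoot, if_neg (not_le.2 (mem_Iio.1 hy))]
    refine ContDiffAt.congr_of_eventuallyEq ?_ h1
    exact (contDiffAt_id.neg.rpow_const_of_ne (neg_ne_zero.2 ht)).neg
  · have h1 : realRoot n =ᶠ[𝓝 t] fun y => y ^ (1 / (n : ℝ)) := by
      filter_upwards [Ioi_mem_nhds h] with y hy
      simp only [realRoot, if_pos (le_of_lt (mem_Ioi.1 hy))]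
    exact (contDiffAt_id.rpow_const_of_ne ht).congr_of_eventuallyEq h1

lemma measurable_realRoot (n : ℕ) : Measurable (realRoot n) := by
  unfold realRoot
  exact Measurable.ite measurableSet_Ici (by fun_prop) (by fun_prop)

/-! ### The profile as a function of `s = |x|²` -/

/-- One branch of the profile. -/
def branch (n : ℕ) (l c r : ℝ) : ℝ := realRoot n (l * (r ^ n - c ^ n)) / r

lemma pow_sub_pow_ne_zero {n : ℕ} (hn : n ≠ 0) {r c : ℝ} (hr : 0 ≤ r) (hc : 0 ≤ c) (h : r ≠ c) :
    r ^ n - c ^ n ≠ 0 := fun h0 => h ((pow_left_inj₀ hr hc hn).1 (sub_eq_zero.1 h0))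

lemma contDiffAt_branch {n : ℕ} (hn : n ≠ 0) {l c r : ℝ} (hc : 0 ≤ c) (hr : 0 < r) (hrc : r ≠ c) :
    ContDiffAt ℝ ∞ (branch n l c) r := by
  by_cases hl : l = 0
  · have : branch n l c = fun _ => 0 := by
      ext y
      simp [branch, hl, realRoot_zero hn]
    rw [this]
    exact contDiffAt_const
  · have h1 : l * (r ^ n - c ^ n) ≠ 0 := mul_ne_zero hl (pow_sub_pow_ne_zero hn hr.le hc hrc)
    have h2 : ContDiffAt ℝ ∞ (fun r => l * (r ^ n - c ^ n)) r := by fun_prop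
    exact ((contDiffAt_realRoot (n := n) h1).comp r h2).div contDiffAt_id hr.ne'

lemma branch_pow_mul_pow {n : ℕ} (hn : n ≠ 0) {l c r : ℝ} (hr : 0 < r)
    (h : Even n → 0 ≤ l * (r ^ n - c ^ n)) : branch n l c r ^ n * r ^ n = l * (r ^ n - c ^ n) := by
  rw [branch, div_pow, realRoot_pow hn h, div_mul_cancel₀ _ (pow_ne_zero _ hr.ne')]

lemma mul_abs_branch (n : ℕ) (l c : ℝ) {r : ℝ} (hr : 0 < r) :
    r * |branch n l c r| = |l * (r ^ n - c ^ n)| ^ (1 / (n : ℝ)) := by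
  rw [branch, abs_div, abs_of_pos hr, abs_realRoot]
  field_simp

/-- The parameters are admissible: the `n`-th roots in the profile are real. -/
structure Admissible (n : ℕ) (a b l₁ l₂ : ℝ) : Prop where
  two_le : 2 ≤ n
  pos : 0 < a
  le : a ≤ b
  even : Even n → l₁ ≤ 0 ∧ 0 ≤ l₂

/-- The profile as a function of `s = r²`. -/
def sqProfile (n : ℕ) (a b l₁ l₂ s : ℝ) : ℝ := profile n a b l₁ l₂ (√s)

/-- The Jacobian determinant as a function of `s = r²`. -/
def level (a b l₁ l₂ s : ℝ) : ℝ := if s < a ^ 2 then l₁ else if s < b ^ 2 then 0 else l₂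

/-- The regular values of `s = r²`. -/
def Regular (a b s : ℝ) : Prop := 0 < s ∧ s ≠ a ^ 2 ∧ s ≠ b ^ 2

variable {n : ℕ} {a b l₁ l₂ s : ℝ}

lemma Admissible.ne_zero (H : Admissible n a b l₁ l₂) : n ≠ 0 := by
  have := H.two_le
  omega

lemma Admissible.pos' (H : Admissible n a b l₁ l₂) : 0 < b := H.pos.trans_le H.le

lemma Admissible.sq_le (H : Admissible n a b l₁ l₂) : a ^ 2 ≤ b ^ 2 :=
  pow_le_pow_left₀ H.pos.le H.le 2

lemma radialMap_eq (x : EuclideanSpace ℝ (Fin n)) :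
    radialMap n a b l₁ l₂ x = sqProfile n a b l₁ l₂ (‖x‖ ^ 2) • x := by
  rw [radialMap, sqProfile, Real.sqrt_sq (norm_nonneg x)]

lemma measurable_sqProfile : Measurable (sqProfile n a b l₁ l₂) := by
  have : Measurable (profile n a b l₁ l₂) := by
    unfold profile
    refine Measurable.ite measurableSet_Iic ?_ (Measurable.ite measurableSet_Iic
      measurable_const ?_)
    · exact ((measurable_realRoot n).comp (by fun_prop)).div measurable_id
    · exact ((measurable_realRoot n).comp (by fun_prop)).div measurable_id
  exact this.comp Real.continuous_sqrt.measurable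

lemma measurable_level : Measurable (level a b l₁ l₂) := by
  unfold level
  exact Measurable.ite measurableSet_Iio measurable_const
    (Measurable.ite measurableSet_Iio measurable_const measurable_const)

/-- Near a regular value the profile coincides with one of its branches. -/
lemma exists_branch (H : Admissible n a b l₁ l₂) (hs : Regular a b s) :
    ∃ l c, 0 < c ∧ √s ≠ c ∧ ((l = l₁ ∧ c = a) ∨ (l = l₂ ∧ c = b) ∨ l = 0) ∧
      level a b l₁ l₂ =ᶠ[𝓝 s] (fun _ => l) ∧
      (sqProfile n a b l₁ l₂ =ᶠ[𝓝 s] fun t => branch n l c (√t)) ∧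
      ∀ᶠ t in 𝓝 s, 0 < t ∧ (Even n → 0 ≤ l * (√t ^ n - c ^ n)) := by
  obtain ⟨h0, h1, h2⟩ := hs
  have ha := H.pos
  have hb := H.pos'
  have hab := H.sq_le
  have hpos : ∀ᶠ t in 𝓝 s, 0 < t := Ioi_mem_nhds h0
  have hsq : ∀ c : ℝ, 0 < c → s ≠ c ^ 2 → √s ≠ c := by
    intro c hc h h'
    apply h
    rw [← h', Real.sq_sqrt h0.le]
  rcases lt_or_gt_of_ne h1 with h1 | h1
  · have hev : ∀ᶠ t in 𝓝 s, t < a ^ 2 := Iio_mem_nhds h1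
    refine ⟨l₁, a, ha, hsq a ha h1.ne, Or.inl ⟨rfl, rfl⟩, ?_, ?_, ?_⟩
    · filter_upwards [hev] with t ht
      simp [level, ht]
    · filter_upwards [hev] with t ht
      have : √t ≤ a := Real.sqrt_le_left ha.le |>.2 ht.le
      simp only [sqProfile, profile, this, if_true, branch]
    · filter_upwards [hev, hpos] with t ht ht0
      refine ⟨ht0, fun he => ?_⟩
      have : √t ≤ a := Real.sqrt_le_left ha.le |>.2 ht.le
      have := pow_le_pow_left₀ (Real.sqrt_nonneg t) this n
      nlinarith [(H.even he).1]
  rcases lt_or_gt_of_ne h2 with h2 | h2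
  · have hev : ∀ᶠ t in 𝓝 s, a ^ 2 < t ∧ t < b ^ 2 := Ioo_mem_nhds h1 h2
    -- In the middle shell `l = 0`, so the branch vanishes whatever its centre is; `a` is merely an
    -- admissible choice.
    refine ⟨0, a, ha, hsq a ha h1.ne', Or.inr (Or.inr rfl), ?_, ?_, ?_⟩
    · filter_upwards [hev] with t ht
      simp [level, ht.2, not_lt.2 ht.1.le]
    · filter_upwards [hev] with t ht
      have h3 : ¬ √t ≤ a := by
        rw [not_le]
        exact Real.lt_sqrt ha.le |>.2 ht.1
      have h4 : √t ≤ b := Real.sqrt_le_left hb.le |>.2 ht.2.le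
      simp only [sqProfile, profile, h3, h4, if_true, if_false, branch, zero_mul,
        realRoot_zero H.ne_zero, zero_div]
    · filter_upwards [hpos] with t ht0
      exact ⟨ht0, by simp⟩
  · have hev : ∀ᶠ t in 𝓝 s, b ^ 2 < t := Ioi_mem_nhds h2
    refine ⟨l₂, b, hb, hsq b hb h2.ne', Or.inr (Or.inl ⟨rfl, rfl⟩), ?_, ?_, ?_⟩
    · filter_upwards [hev] with t ht
      simp [level, not_lt.2 ht.le, not_lt.2 (hab.trans ht.le)]
    · filter_upwards [hev] with t ht
      have h3 : ¬ √t ≤ a := by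
        rw [not_le]
        exact Real.lt_sqrt ha.le |>.2 (hab.trans_lt ht)
      have h4 : ¬ √t ≤ b := by
        rw [not_le]
        exact Real.lt_sqrt hb.le |>.2 ht
      simp only [sqProfile, profile, h3, h4, if_false, branch]
    · filter_upwards [hev, hpos] with t ht ht0
      refine ⟨ht0, fun he => ?_⟩
      have : b ≤ √t := (Real.lt_sqrt hb.le |>.2 ht).le
      have := pow_le_pow_left₀ hb.le this n
      nlinarith [(H.even he).2]

lemma level_eventuallyEq (H : Admissible n a b l₁ l₂) (hs : Regular a b s) :
    level a b l₁ l₂ =ᶠ[𝓝 s] fun _ => level a b l₁ l₂ s := by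
  obtain ⟨l, c, -, -, -, h, -, -⟩ := exists_branch H hs
  rw [h.eq_of_nhds]
  exact h

lemma contDiffAt_sqProfile (H : Admissible n a b l₁ l₂) (hs : Regular a b s) :
    ContDiffAt ℝ ∞ (sqProfile n a b l₁ l₂) s := by
  obtain ⟨l, c, hc, hsc, -, -, h, -⟩ := exists_branch H hs
  refine ContDiffAt.congr_of_eventuallyEq ?_ h
  exact (contDiffAt_branch H.ne_zero hc.le (Real.sqrt_pos.2 hs.1) hsc).comp s
    (Real.contDiffAt_sqrt hs.1.ne')

lemma hasDerivAt_sqProfile (H : Admissible n a b l₁ l₂) (hs : Regular a b s) :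
    HasDerivAt (sqProfile n a b l₁ l₂) (deriv (sqProfile n a b l₁ l₂) s) s :=
  ((contDiffAt_sqProfile H hs).differentiableAt (by simp)).hasDerivAt

lemma contDiffAt_deriv_sqProfile (H : Admissible n a b l₁ l₂) (hs : Regular a b s) :
    ContDiffAt ℝ ∞ (deriv (sqProfile n a b l₁ l₂)) s := by
  have h1 : ContDiffAt ℝ ∞ (fun t => fderiv ℝ (sqProfile n a b l₁ l₂) t 1) s :=
    ((contDiffAt_sqProfile H hs).fderiv_right (m := ∞) (by simp)).clm_apply contDiffAt_const
  exact h1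

/-- The Jacobian determinant of the map is constant in each region. -/
lemma sqProfile_identity (H : Admissible n a b l₁ l₂) (hs : Regular a b s) :
    sqProfile n a b l₁ l₂ s ^ (n - 1)
      * (sqProfile n a b l₁ l₂ s + 2 * deriv (sqProfile n a b l₁ l₂) s * s)
      = level a b l₁ l₂ s := by
  obtain ⟨l, c, hc, hsc, -, hl, h, hev⟩ := exists_branch H hs
  have hs0 := hs.1
  have hr : 0 < √s := Real.sqrt_pos.2 hs0
  -- This root-free form is differentiated in `s` on both sides. The sign convention and the parity
  -- of `n` no longer matter, and cancelling common factors leaves the determinant.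
  have hid : (fun t => sqProfile n a b l₁ l₂ t ^ n * √t ^ n)
      =ᶠ[𝓝 s] fun t => l * (√t ^ n - c ^ n) := by
    filter_upwards [h, hev] with t ht ht'
    rw [ht, branch_pow_mul_pow H.ne_zero (Real.sqrt_pos.2 ht'.1) ht'.2]
  have hsq := (Real.hasDerivAt_sqrt hs0.ne').pow n
  have hL := ((hasDerivAt_sqProfile H hs).pow n).mul hsq
  have hR := (hsq.sub_const (c ^ n)).const_mul l
  have key := (hL.congr_of_eventuallyEq hid.symm).unique hR
  rw [hl.eq_of_nhds]
  simp only [Pi.pow_apply] at key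
  set f := sqProfile n a b l₁ l₂ s
  set f' := deriv (sqProfile n a b l₁ l₂) s
  obtain ⟨m, rfl⟩ : ∃ m, n = m + 1 := ⟨n - 1, by have := H.two_le; omega⟩
  simp only [Nat.add_sub_cancel] at key ⊢
  have hss : s = √s * √s := (Real.mul_self_sqrt hs0.le).symm
  set r := √s
  have hrm : r ^ m ≠ 0 := pow_ne_zero _ hr.ne'
  have key2 : r ^ m * (f ^ m * (f + 2 * f' * s)) = r ^ m * l := by
    have : 2 * r * (((m + 1 : ℕ) : ℝ) * f ^ m * f' * r ^ (m + 1)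
        + f ^ (m + 1) * (((m + 1 : ℕ) : ℝ) * r ^ m * (1 / (2 * r))))
        = 2 * r * (l * (((m + 1 : ℕ) : ℝ) * r ^ m * (1 / (2 * r)))) := by rw [key]
    rw [hss]
    field_simp at this
    linear_combination this
  exact mul_left_cancel₀ hrm key2

/-- The level vanishes in the middle shell and also where `l₁ = 0` or `l₂ = 0`. In all these cases
the profile is zero on a whole neighbourhood. This is the case in which `sqProfile_identity` cannot
be divided by `f^(n-1)`. -/
lemma sqProfile_eq_zero (H : Admissible n a b l₁ l₂) (hs : Regular a b s)
    (h0 : level a b l₁ l₂ s = 0) :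
    sqProfile n a b l₁ l₂ s = 0 ∧ deriv (sqProfile n a b l₁ l₂) s = 0 := by
  obtain ⟨l, c, hc, hsc, -, hl, h, hev⟩ := exists_branch H hs
  rw [hl.eq_of_nhds] at h0
  have h1 : sqProfile n a b l₁ l₂ =ᶠ[𝓝 s] fun _ => 0 := by
    filter_upwards [h] with t ht
    rw [ht, h0]
    simp [branch, realRoot_zero H.ne_zero]
  exact ⟨h1.eq_of_nhds, by rw [h1.deriv_eq]; simp⟩

/-! ### Bounds -/

lemma abs_pow_sub_pow_le_mul {R c : ℝ} (hc : 0 ≤ c) {r : ℝ} (hr : 0 ≤ r) (hrR : r ≤ R) :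
    |r ^ n - c ^ n| ≤ n * (R + c) ^ (n - 1) * |r - c| := by
  have h := abs_pow_sub_pow_le r c n
  rw [abs_of_nonneg hr, abs_of_nonneg hc] at h
  refine h.trans ?_
  have : max r c ^ (n - 1) ≤ (R + c) ^ (n - 1) :=
    pow_le_pow_left₀ (hr.trans (le_max_left _ _)) (max_le (by linarith) (by linarith)) _
  calc |r - c| * n * max r c ^ (n - 1) ≤ |r - c| * n * (R + c) ^ (n - 1) := by gcongr
    _ = _ := by ring

lemma mul_abs_sub_le_abs_pow_sub_pow (hn : n ≠ 0) {c r : ℝ} (hc : 0 ≤ c) (hr : 0 ≤ r) :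
    c ^ (n - 1) * |r - c| ≤ |r ^ n - c ^ n| := by
  obtain ⟨m, rfl⟩ : ∃ m, n = m + 1 := ⟨n - 1, by omega⟩
  simp only [Nat.add_sub_cancel]
  rcases le_total c r with h | h
  · have h1 : c ^ m ≤ r ^ m := pow_le_pow_left₀ hc h m
    have h2 : c ^ (m + 1) ≤ r ^ (m + 1) := pow_le_pow_left₀ hc h _
    rw [abs_of_nonneg (by linarith), abs_of_nonneg (by linarith), pow_succ, pow_succ]
    nlinarith
  · have h1 : r ^ m ≤ c ^ m := pow_le_pow_left₀ hr h m
    have h2 : r ^ (m + 1) ≤ c ^ (m + 1) := pow_le_pow_left₀ hr h _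
    rw [abs_of_nonpos (by linarith), abs_of_nonpos (by linarith), pow_succ, pow_succ]
    nlinarith

/-- Here `(r |φ|)^n = |l| |r^n - c^n|`, and `r^n` is Lipschitz on bounded intervals. Using `r |φ| =
|u|` instead of `|φ|` avoids the pole at the origin. -/
lemma exists_mul_abs_branch_le (n : ℕ) (l : ℝ) {c : ℝ} (hc : 0 ≤ c) (R : ℝ) :
    ∃ C, 0 ≤ C ∧ ∀ r, 0 < r → r ≤ R → r * |branch n l c r| ≤ C * |r - c| ^ (1 / (n : ℝ)) := by
  by_cases hR : 0 ≤ R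
  · refine ⟨(|l| * (n * (R + c) ^ (n - 1))) ^ (1 / (n : ℝ)), by positivity, fun r hr hrR => ?_⟩
    rw [mul_abs_branch n l c hr, ← Real.mul_rpow (by positivity) (abs_nonneg _), abs_mul]
    refine Real.rpow_le_rpow (by positivity) ?_ (by positivity)
    rw [mul_assoc]
    exact mul_le_mul_of_nonneg_left (abs_pow_sub_pow_le_mul hc hr.le hrR) (abs_nonneg _)
  · exact ⟨0, le_rfl, fun r hr hrR => absurd (hr.le.trans hrR) hR⟩

/-- Where the profile is nonzero, the sphere on which its branch vanishes is the nearer of the two,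
so the bound by the other distance follows. -/
lemma exists_mul_abs_profile_le (H : Admissible n a b l₁ l₂) (R : ℝ) :
    ∃ C, 0 ≤ C ∧ ∀ r, 0 < r → r ≤ R →
      r * |profile n a b l₁ l₂ r| ≤ C * |r - a| ^ (1 / (n : ℝ)) ∧
      r * |profile n a b l₁ l₂ r| ≤ C * |r - b| ^ (1 / (n : ℝ)) := by
  obtain ⟨C₁, h10, h1⟩ := exists_mul_abs_branch_le n l₁ H.pos.le R
  obtain ⟨C₂, h20, h2⟩ := exists_mul_abs_branch_le n l₂ H.pos'.le R
  have hab := H.le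
  refine ⟨C₁ + C₂, by positivity, fun r hr hrR => ?_⟩
  have ha : 0 ≤ |r - a| ^ (1 / (n : ℝ)) := by positivity
  have hb : 0 ≤ |r - b| ^ (1 / (n : ℝ)) := by positivity
  by_cases hra : r ≤ a
  · have h3 : profile n a b l₁ l₂ r = branch n l₁ a r := by simp [profile, branch, hra]
    have h4 : |r - a| ^ (1 / (n : ℝ)) ≤ |r - b| ^ (1 / (n : ℝ)) := by
      refine Real.rpow_le_rpow (abs_nonneg _) ?_ (by positivity)
      rw [abs_of_nonpos (by linarith), abs_of_nonpos (by linarith)]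
      linarith
    have h5 := h1 r hr hrR
    rw [h3]
    constructor <;> nlinarith
  by_cases hrb : r ≤ b
  · have h3 : profile n a b l₁ l₂ r = 0 := by simp [profile, hra, hrb]
    rw [h3, abs_zero, mul_zero]
    constructor <;> positivity
  · have h3 : profile n a b l₁ l₂ r = branch n l₂ b r := by simp [profile, branch, hra, hrb]
    have h4 : |r - b| ^ (1 / (n : ℝ)) ≤ |r - a| ^ (1 / (n : ℝ)) := by
      refine Real.rpow_le_rpow (abs_nonneg _) ?_ (by positivity)
      rw [abs_of_nonneg (by linarith), abs_of_nonneg (by linarith)]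
      linarith
    have h5 := h2 r hr hrR
    rw [h3]
    constructor <;> nlinarith

/-- From below, `(r |φ|)^n ≥ |l| c^(n-1) |r - c|`; the power `n - 1` in the denominator yields the
exponent `-(n-1)/n = 1/n - 1`. The numerator `|l|` makes the degenerate case `l = 0` trivial. -/
lemma exists_div_abs_branch_pow_le (hn : 2 ≤ n) (l : ℝ) {c : ℝ} (hc : 0 < c) (R : ℝ) :
    ∃ C, 0 ≤ C ∧ ∀ r, 0 < r → r ≤ R → r ≠ c →
      |l| / |branch n l c r| ^ (n - 1) ≤ C * |r - c| ^ (1 / (n : ℝ) - 1) := by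
  by_cases hl : l = 0
  · exact ⟨0, le_rfl, fun r _ _ _ => by simp [hl]⟩
  by_cases hR : 0 ≤ R
  swap
  · exact ⟨0, le_rfl, fun r hr hrR => absurd (hr.le.trans hrR) hR⟩
  have hl0 : 0 < |l| := abs_pos.2 hl
  set κ := (|l| * c ^ (n - 1)) ^ (1 / (n : ℝ)) with hκ
  have hκ0 : 0 < κ := by positivity
  refine ⟨|l| * R ^ (n - 1) / κ ^ (n - 1), by positivity, fun r hr hrR hrc => ?_⟩
  have hrc0 : 0 < |r - c| := abs_pos.2 (sub_ne_zero.2 hrc)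
  have h1 : κ * |r - c| ^ (1 / (n : ℝ)) ≤ r * |branch n l c r| := by
    rw [mul_abs_branch n l c hr, hκ, ← Real.mul_rpow (by positivity) (abs_nonneg _), abs_mul,
      mul_assoc]
    refine Real.rpow_le_rpow (by positivity) ?_ (by positivity)
    exact mul_le_mul_of_nonneg_left
      (mul_abs_sub_le_abs_pow_sub_pow (by omega) hc.le hr.le) (abs_nonneg _)
  have h2 : 0 < κ * |r - c| ^ (1 / (n : ℝ)) := by positivity
  have h3 : 0 < |branch n l c r| := by
    have : 0 < r * |branch n l c r| := h2.trans_le h1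
    exact (mul_pos_iff_of_pos_left hr).1 this
  have h4 : |r - c| ^ (1 / (n : ℝ) - 1) = ((|r - c| ^ (1 / (n : ℝ))) ^ (n - 1))⁻¹ := by
    rw [← Real.rpow_natCast, ← Real.rpow_mul hrc0.le, ← Real.rpow_neg hrc0.le]
    congr 1
    have : (n : ℝ) ≠ 0 := by positivity
    rw [Nat.cast_sub (by omega)]
    field_simp
    push_cast
    ring
  have h5 : |l| / |branch n l c r| ^ (n - 1)
      = |l| * r ^ (n - 1) / (r * |branch n l c r|) ^ (n - 1) := by
    rw [mul_pow]
    field_simp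
  rw [h5, h4, ← div_eq_mul_inv, div_div, ← mul_pow]
  gcongr

/-- The bound for the radial derivative. -/
lemma exists_mul_abs_deriv_sqProfile_le (H : Admissible n a b l₁ l₂) (R : ℝ) :
    ∃ C, 0 ≤ C ∧ ∀ r, 0 < r → r ≤ R → Regular a b (r ^ 2) →
      r ^ 2 * |2 * deriv (sqProfile n a b l₁ l₂) (r ^ 2)|
        ≤ C * weight n a b r + |sqProfile n a b l₁ l₂ (r ^ 2)| := by
  obtain ⟨C₁, h10, h1⟩ := exists_div_abs_branch_pow_le H.two_le l₁ H.pos R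
  obtain ⟨C₂, h20, h2⟩ := exists_div_abs_branch_pow_le H.two_le l₂ H.pos' R
  have hwn := one_le_weight n a b
  refine ⟨C₁ + C₂, by positivity, fun r hr hrR hreg => ?_⟩
  have hw := hwn r
  by_cases hl0 : level a b l₁ l₂ (r ^ 2) = 0
  · obtain ⟨h3, h4⟩ := sqProfile_eq_zero H hreg hl0
    rw [h3, h4]
    simp only [mul_zero, abs_zero, add_zero]
    positivity
  have hid := sqProfile_identity H hreg
  obtain ⟨l, c, hc, hsc, hlc, hl, h, hev⟩ := exists_branch H hreg
  have hb := h.eq_of_nhds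
  rw [hl.eq_of_nhds] at hl0 hid
  rw [Real.sqrt_sq hr.le] at hsc hb
  set f := sqProfile n a b l₁ l₂ (r ^ 2)
  set f' := deriv (sqProfile n a b l₁ l₂) (r ^ 2)
  have hf0 : f ≠ 0 := by
    intro hf
    rw [hf, zero_pow (by have := H.two_le; omega), zero_mul] at hid
    exact hl0 hid.symm
  have hfa : 0 < |f| ^ (n - 1) := pow_pos (abs_pos.2 hf0) _
  -- The determinant identity is solved for the derivative: `2 s f' = l / f^(n-1) - f`.
  have h5 : r ^ 2 * |2 * f'| ≤ |l| / |f| ^ (n - 1) + |f| := by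
    have e1 : f + 2 * f' * r ^ 2 = l / f ^ (n - 1) := by
      rw [eq_div_iff (pow_ne_zero _ hf0), mul_comm]
      exact hid
    have e2 : r ^ 2 * |2 * f'| = |l / f ^ (n - 1) - f| := by
      rw [← e1, add_sub_cancel_left, abs_mul _ (r ^ 2), abs_of_nonneg (sq_nonneg r), mul_comm]
    rw [e2, ← abs_pow, ← abs_div]
    exact abs_sub _ _
  have h6 : |l| / |f| ^ (n - 1) ≤ (C₁ + C₂) * weight n a b r := by
    have ha : 0 ≤ |r - a| ^ (1 / (n : ℝ) - 1) := by positivity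
    have hb' : 0 ≤ |r - b| ^ (1 / (n : ℝ) - 1) := by positivity
    rcases hlc with ⟨rfl, rfl⟩ | ⟨rfl, rfl⟩ | h7
    · have := h1 r hr hrR hsc
      rw [← hb] at this
      refine this.trans (mul_le_mul (by linarith) ?_ ha (by positivity))
      unfold weight
      linarith
    · have := h2 r hr hrR hsc
      rw [← hb] at this
      refine this.trans (mul_le_mul (by linarith) ?_ hb' (by positivity))
      unfold weight
      linarith
    · exact absurd h7 hl0
  linarith

/-! ### Bounds for the radial map and its derivatives -/

/-- The logarithmic derivative of the function that cuts out the singular set. -/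
def singularWeight (a b r : ℝ) : ℝ := 1 / r + 1 / |r - a| + 1 / |r - b|

lemma singularWeight_nonneg {r : ℝ} (hr : 0 ≤ r) : 0 ≤ singularWeight a b r := by
  unfold singularWeight
  positivity

lemma Regular.ne_left {r : ℝ} (h : Regular a b (r ^ 2)) : r ≠ a := fun h' => h.2.1 (by rw [h'])

lemma Regular.ne_right {r : ℝ} (h : Regular a b (r ^ 2)) : r ≠ b := fun h' => h.2.2 (by rw [h'])

lemma Regular.norm_pos {x : EuclideanSpace ℝ (Fin n)} (h : Regular a b (‖x‖ ^ 2)) : 0 < ‖x‖ := by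
  refine (norm_nonneg x).lt_of_ne' fun h0 => h.1.ne' ?_
  rw [h0]
  norm_num

lemma mul_inv_mul_eq_div (c p w : ℝ) : c * (p⁻¹ * w) = c * w / p := by
  rw [div_eq_mul_inv]
  ring

lemma weight_nonneg (r : ℝ) : 0 ≤ weight n a b r := zero_le_one.trans (one_le_weight n a b r)

/-- At a sphere the zero of order `1/n` meets a simple pole and leaves `|r - c|^(1/n - 1)`; at the
origin the map is only bounded, which leaves `1/r`. The second bound drives the integration by parts
for `u`. -/
lemma exists_mul_abs_sqProfile_le (H : Admissible n a b l₁ l₂) (R : ℝ) :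
    ∃ C, 0 ≤ C ∧ ∀ r, 0 < r → r ≤ R → Regular a b (r ^ 2) →
      r * |sqProfile n a b l₁ l₂ (r ^ 2)| ≤ C ∧
      r * |sqProfile n a b l₁ l₂ (r ^ 2)| * singularWeight a b r ≤ C * (r⁻¹ + weight n a b r) := by
  obtain ⟨C, hC0, hC⟩ := exists_mul_abs_profile_le H R
  have hR : 0 ≤ |R| + a := by
    have := H.pos
    positivity
  set B := C * (|R| + a) ^ (1 / (n : ℝ)) with hB
  have hB0 : 0 ≤ B := by positivity
  refine ⟨B + C, by positivity, fun r hr hrR hreg => ?_⟩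
  obtain ⟨h1, h2⟩ := hC r hr hrR
  simp only [sqProfile, Real.sqrt_sq hr.le]
  set ρ := r * |profile n a b l₁ l₂ r|
  have hρ : 0 ≤ ρ := by positivity
  have h3 : ρ ≤ B := by
    refine h1.trans (mul_le_mul_of_nonneg_left ?_ hC0)
    refine Real.rpow_le_rpow (abs_nonneg _) ?_ (by positivity)
    rw [abs_le]
    have := le_abs_self R
    have := H.pos
    have := abs_nonneg R
    constructor <;> linarith
  have key : ∀ c, r ≠ c → ρ ≤ C * |r - c| ^ (1 / (n : ℝ)) →
      ρ * (1 / |r - c|) ≤ C * |r - c| ^ (1 / (n : ℝ) - 1) := by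
    intro c hrc h
    have h0 : 0 < |r - c| := abs_pos.2 (sub_ne_zero.2 hrc)
    rw [Real.rpow_sub_one h0.ne', mul_one_div, ← mul_div_assoc]
    gcongr
  have h4 := key a hreg.ne_left h1
  have h5 := key b hreg.ne_right h2
  refine ⟨by linarith, ?_⟩
  have h6 : ρ * (1 / r) ≤ B * r⁻¹ := by
    rw [one_div]
    exact mul_le_mul_of_nonneg_right h3 (by positivity)
  have h7 : 0 ≤ C * r⁻¹ := by positivity
  have h8 : 0 ≤ B * weight n a b r := mul_nonneg hB0 (weight_nonneg r)
  have h9 : C * weight n a b r = C + C * |r - a| ^ (1 / (n : ℝ) - 1)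
      + C * |r - b| ^ (1 / (n : ℝ) - 1) := by
    unfold weight
    ring
  have h10 : ρ * singularWeight a b r = ρ * (1 / r) + ρ * (1 / |r - a|) + ρ * (1 / |r - b|) := by
    unfold singularWeight
    ring
  rw [h10, add_mul, mul_add, mul_add, h9]
  linarith

lemma exists_abs_gradient_le (H : Admissible n a b l₁ l₂) (R : ℝ) :
    ∃ C, 0 ≤ C ∧ ∀ r, 0 < r → r ≤ R → Regular a b (r ^ 2) →
      |sqProfile n a b l₁ l₂ (r ^ 2)| + r ^ 2 * |2 * deriv (sqProfile n a b l₁ l₂) (r ^ 2)|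
        ≤ C * (r⁻¹ + weight n a b r) := by
  obtain ⟨C₁, h10, h1⟩ := exists_mul_abs_sqProfile_le H R
  obtain ⟨C₂, h20, h2⟩ := exists_mul_abs_deriv_sqProfile_le H R
  refine ⟨2 * C₁ + C₂, by positivity, fun r hr hrR hreg => ?_⟩
  have h3 := (h1 r hr hrR hreg).1
  have h4 := h2 r hr hrR hreg
  have h5 : |sqProfile n a b l₁ l₂ (r ^ 2)| ≤ C₁ * r⁻¹ := by
    rw [← div_eq_mul_inv, le_div_iff₀ hr, mul_comm]
    exact h3
  have hw := weight_nonneg (n := n) (a := a) (b := b) r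
  have h6 : 0 ≤ C₁ * weight n a b r := by positivity
  have h7 : 0 ≤ C₂ * r⁻¹ := by positivity
  nlinarith

/-- The cofactors are linear in the radial derivative. After multiplication by `r^(n-1)`, the
factors `r f` are bounded, and the single derivative costs one power of the weight. -/
lemma exists_abs_cofactor_le (H : Admissible n a b l₁ l₂) (R : ℝ) :
    ∃ C, 0 ≤ C ∧ ∀ r, 0 < r → r ≤ R → Regular a b (r ^ 2) →
      |sqProfile n a b l₁ l₂ (r ^ 2)| ^ (n - 1)
        + 2 * (r ^ 2 * (|sqProfile n a b l₁ l₂ (r ^ 2)| ^ (n - 2)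
          * |2 * deriv (sqProfile n a b l₁ l₂) (r ^ 2)|))
        ≤ C * ((r ^ (n - 1))⁻¹ * weight n a b r) := by
  obtain ⟨C₁, h10, h1⟩ := exists_mul_abs_sqProfile_le H R
  obtain ⟨C₂, h20, h2⟩ := exists_abs_gradient_le H R
  refine ⟨C₁ ^ (n - 2) * C₁ + 2 * (C₁ ^ (n - 2) * (C₂ * (1 + |R|))), by positivity,
    fun r hr hrR hreg => ?_⟩
  have h3 := (h1 r hr hrR hreg).1
  have h4 := h2 r hr hrR hreg
  set f := |sqProfile n a b l₁ l₂ (r ^ 2)|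
  set g := |2 * deriv (sqProfile n a b l₁ l₂) (r ^ 2)|
  have hf : 0 ≤ f := abs_nonneg _
  have hg : 0 ≤ g := abs_nonneg _
  have hw := one_le_weight n a b r
  set w := weight n a b r
  obtain ⟨m, rfl⟩ : ∃ m, n = m + 2 := ⟨n - 2, by have := H.two_le; omega⟩
  simp only [show m + 2 - 1 = m + 1 by omega, Nat.add_sub_cancel]
  have hrm : 0 < r ^ (m + 1) := by positivity
  have hrR' : r ≤ |R| := hrR.trans (le_abs_self R)
  have h5 : (r * f) ^ m ≤ C₁ ^ m := pow_le_pow_left₀ (by positivity) h3 m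
  have h6 : (r * f) ^ (m + 1) ≤ C₁ ^ m * C₁ * w := by
    rw [pow_succ]
    calc (r * f) ^ m * (r * f) ≤ C₁ ^ m * C₁ := mul_le_mul h5 h3 (by positivity) (by positivity)
      _ ≤ _ := le_mul_of_one_le_right (by positivity) hw
  have h7 : r * (r ^ 2 * g) ≤ C₂ * (1 + |R|) * w := by
    have : r ^ 2 * g ≤ C₂ * (r⁻¹ + w) := by linarith
    calc r * (r ^ 2 * g) ≤ r * (C₂ * (r⁻¹ + w)) := mul_le_mul_of_nonneg_left this hr.le
      _ = C₂ * (1 + r * w) := by field_simp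
      _ ≤ C₂ * (w + |R| * w) := by gcongr
      _ = _ := by ring
  have h8 : (r * f) ^ m * (r * (r ^ 2 * g)) ≤ C₁ ^ m * (C₂ * (1 + |R|) * w) :=
    mul_le_mul h5 h7 (by positivity) (by positivity)
  rw [mul_inv_mul_eq_div, le_div_iff₀ hrm]
  have e : (f ^ (m + 1) + 2 * (r ^ 2 * (f ^ m * g))) * r ^ (m + 1)
      = (r * f) ^ (m + 1) + 2 * ((r * f) ^ m * (r * (r ^ 2 * g))) := by
    simp only [mul_pow, pow_succ]
    ring
  rw [e]
  linarith

/-- The flux contains `f^(n-1)` and no derivative. As `n - 1 ≥ 1`, one factor `r f` absorbs the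
singular weight while the others stay bounded. The extra `r` on the left is supplied by a test field
vanishing at the origin. -/
lemma exists_abs_flux_le (H : Admissible n a b l₁ l₂) (R : ℝ) :
    ∃ C, 0 ≤ C ∧ ∀ r, 0 < r → r ≤ R → Regular a b (r ^ 2) →
      singularWeight a b r * r * |sqProfile n a b l₁ l₂ (r ^ 2)| ^ (n - 1)
        ≤ C * ((r ^ (n - 1))⁻¹ * weight n a b r) := by
  obtain ⟨C₁, h10, h1⟩ := exists_mul_abs_sqProfile_le H R
  refine ⟨C₁ ^ (n - 2) * (C₁ * (1 + |R|)), by positivity, fun r hr hrR hreg => ?_⟩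
  obtain ⟨h3, h4⟩ := h1 r hr hrR hreg
  set f := |sqProfile n a b l₁ l₂ (r ^ 2)|
  have hf : 0 ≤ f := abs_nonneg _
  have hw := one_le_weight n a b r
  set w := weight n a b r
  have hσ := singularWeight_nonneg (a := a) (b := b) hr.le
  set σ := singularWeight a b r
  obtain ⟨m, rfl⟩ : ∃ m, n = m + 2 := ⟨n - 2, by have := H.two_le; omega⟩
  simp only [show m + 2 - 1 = m + 1 by omega, Nat.add_sub_cancel]
  have hrm : 0 < r ^ (m + 1) := by positivity
  have hrR' : r ≤ |R| := hrR.trans (le_abs_self R)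
  have h5 : (r * f) ^ m ≤ C₁ ^ m := pow_le_pow_left₀ (by positivity) h3 m
  have h7 : r * (r * f * σ) ≤ C₁ * (1 + |R|) * w := by
    calc r * (r * f * σ) ≤ r * (C₁ * (r⁻¹ + w)) := mul_le_mul_of_nonneg_left h4 hr.le
      _ = C₁ * (1 + r * w) := by field_simp
      _ ≤ C₁ * (w + |R| * w) := by gcongr
      _ = _ := by ring
  have h8 : (r * f) ^ m * (r * (r * f * σ)) ≤ C₁ ^ m * (C₁ * (1 + |R|) * w) :=
    mul_le_mul h5 h7 (by positivity) (by positivity)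
  rw [mul_inv_mul_eq_div, le_div_iff₀ hrm]
  have e : σ * r * f ^ (m + 1) * r ^ (m + 1) = (r * f) ^ m * (r * (r * f * σ)) := by
    simp only [mul_pow, pow_succ]
    ring
  rw [e]
  linarith

/-! ### The singular set -/

/-- A nonnegative polynomial that vanishes exactly on the singular set of the radial map. -/
def singFun (N a b : ℝ) (x : EuclideanSpace ℝ (Fin n)) : ℝ :=
  N * (‖x‖ ^ 2 * (‖x‖ ^ 2 - a ^ 2) * (‖x‖ ^ 2 - b ^ 2)) ^ 2

lemma contDiff_singFun (N a b : ℝ) {m : ℕ∞} :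
    ContDiff ℝ m (singFun (n := n) N a b) := by
  have h : ContDiff ℝ m (fun x : EuclideanSpace ℝ (Fin n) => ‖x‖ ^ 2) := contDiff_norm_sq ℝ
  unfold singFun
  fun_prop

lemma singFun_pos_iff {N : ℝ} (hN : 0 < N) {x : EuclideanSpace ℝ (Fin n)} :
    0 < singFun N a b x ↔ Regular a b (‖x‖ ^ 2) := by
  rw [singFun, mul_pos_iff_of_pos_left hN, sq_pos_iff]
  simp only [mul_ne_zero_iff, sub_ne_zero, Regular, and_assoc]
  have : ‖x‖ ^ 2 ≠ 0 ↔ 0 < ‖x‖ ^ 2 := ((sq_nonneg ‖x‖).lt_iff_ne').symm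
  rw [this]

lemma ae_regular (hn : 2 ≤ n) (ha : 0 ≤ a) (hb : 0 ≤ b) :
    ∀ᵐ x : EuclideanSpace ℝ (Fin n), Regular a b (‖x‖ ^ 2) := by
  have := nontrivial_euclidean hn
  have h : ∀ c : ℝ, ∀ᵐ x : EuclideanSpace ℝ (Fin n), ‖x‖ ≠ c := by
    intro c
    rw [ae_iff]
    have : {x : EuclideanSpace ℝ (Fin n) | ¬‖x‖ ≠ c} = sphere 0 c := by
      ext x
      simp
    rw [this]
    exact Measure.addHaar_sphere volume 0 c
  filter_upwards [h 0, h a, h b] with x h0 h1 h2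
  refine ⟨by positivity, ?_, ?_⟩
  · rwa [ne_eq, pow_left_inj₀ (norm_nonneg x) ha two_ne_zero]
  · rwa [ne_eq, pow_left_inj₀ (norm_nonneg x) hb two_ne_zero]

/-- The logarithmic derivative of `singFun`, divided by `4 x`. -/
def logDerivCoeff (a b s : ℝ) : ℝ := 1 / s + 1 / (s - a ^ 2) + 1 / (s - b ^ 2)

lemma fderiv_singFun_single (N : ℝ) {x : EuclideanSpace ℝ (Fin n)} (hx : Regular a b (‖x‖ ^ 2))
    (j : Fin n) : fderiv ℝ (singFun N a b) x (EuclideanSpace.single j 1)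
      = singFun N a b x * (4 * logDerivCoeff a b (‖x‖ ^ 2) * x j) := by
  have h1 : HasDerivAt (fun s : ℝ => N * (s * (s - a ^ 2) * (s - b ^ 2)) ^ 2)
      (N * (2 * (‖x‖ ^ 2 * (‖x‖ ^ 2 - a ^ 2) * (‖x‖ ^ 2 - b ^ 2))
        * ((1 * (‖x‖ ^ 2 - a ^ 2) + ‖x‖ ^ 2 * 1) * (‖x‖ ^ 2 - b ^ 2)
          + ‖x‖ ^ 2 * (‖x‖ ^ 2 - a ^ 2) * 1))) (‖x‖ ^ 2) := by
    have h2 := (((hasDerivAt_id (‖x‖ ^ 2)).mul ((hasDerivAt_id (‖x‖ ^ 2)).sub_const (a ^ 2))).mul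
      ((hasDerivAt_id (‖x‖ ^ 2)).sub_const (b ^ 2))).pow 2
    have h3 := h2.const_mul N
    simpa using h3
  refine (fderiv_comp_norm_sq_single h1 j).trans ?_
  have h2 : ‖x‖ ^ 2 ≠ 0 := hx.1.ne'
  have h3 : ‖x‖ ^ 2 - a ^ 2 ≠ 0 := sub_ne_zero.2 hx.2.1
  have h4 : ‖x‖ ^ 2 - b ^ 2 ≠ 0 := sub_ne_zero.2 hx.2.2
  unfold singFun logDerivCoeff
  set s := ‖x‖ ^ 2
  field_simp
  ring

/-- Each pole satisfies `r / |r² - c²| = r / ((r + c) |r - c|) ≤ 1 / |r - c|`. -/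
lemma mul_abs_logDerivCoeff_le (ha : 0 ≤ a) (hb : 0 ≤ b) {r : ℝ} (hr : 0 < r)
    (h : Regular a b (r ^ 2)) : r * |logDerivCoeff a b (r ^ 2)| ≤ singularWeight a b r := by
  have key : ∀ c, 0 ≤ c → r ≠ c → r * |1 / (r ^ 2 - c ^ 2)| ≤ 1 / |r - c| := by
    intro c hc hrc
    have h0 : 0 < |r - c| := abs_pos.2 (sub_ne_zero.2 hrc)
    rw [show r ^ 2 - c ^ 2 = (r - c) * (r + c) by ring, abs_div, abs_one, abs_mul,
      abs_of_pos (by linarith : 0 < r + c), mul_one_div, div_le_div_iff₀ (by positivity) h0]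
    nlinarith
  have h1 := key a ha h.ne_left
  have h2 := key b hb h.ne_right
  have h3 : r * |1 / r ^ 2| = 1 / r := by
    rw [abs_of_pos (by positivity)]
    field_simp
  unfold logDerivCoeff singularWeight
  calc _ ≤ r * (|1 / r ^ 2| + |1 / (r ^ 2 - a ^ 2)| + |1 / (r ^ 2 - b ^ 2)|) :=
        mul_le_mul_of_nonneg_left (abs_add_three _ _ _) hr.le
    _ ≤ _ := by
        rw [mul_add, mul_add, h3]
        linarith

lemma abs_fderiv_singFun_div_le {N : ℝ} (hN : 0 < N) (ha : 0 ≤ a) (hb : 0 ≤ b)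
    {x : EuclideanSpace ℝ (Fin n)} (hx : Regular a b (‖x‖ ^ 2)) (j : Fin n) :
    |fderiv ℝ (singFun N a b) x (EuclideanSpace.single j 1)| / |singFun N a b x|
      ≤ 4 * singularWeight a b ‖x‖ := by
  have hpos : 0 < |singFun N a b x| := abs_pos.2 ((singFun_pos_iff hN).2 hx).ne'
  rw [fderiv_singFun_single N hx, abs_mul, mul_div_cancel_left₀ _ hpos.ne', abs_mul, abs_mul,
    abs_of_pos (by norm_num : (0 : ℝ) < 4), mul_assoc]
  refine mul_le_mul_of_nonneg_left ?_ (by norm_num)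
  refine le_trans ?_ (mul_abs_logDerivCoeff_le ha hb hx.norm_pos hx)
  rw [mul_comm]
  exact mul_le_mul_of_nonneg_right (abs_apply_le_norm x j) (abs_nonneg _)

lemma Admissible.ae_regular (H : Admissible n a b l₁ l₂) :
    ∀ᵐ x : EuclideanSpace ℝ (Fin n), Regular a b (‖x‖ ^ 2) :=
  RadialDet.ae_regular H.two_le H.pos.le H.pos'.le

/-! ### The weak Jacobian of the radial map -/

/-- The pointwise Jacobian of the radial map. -/
def gradField (n : ℕ) (a b l₁ l₂ : ℝ) (x : EuclideanSpace ℝ (Fin n)) :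
    Matrix (Fin n) (Fin n) ℝ :=
  radialMat (sqProfile n a b l₁ l₂ (‖x‖ ^ 2)) (2 * deriv (sqProfile n a b l₁ l₂) (‖x‖ ^ 2)) x

lemma measurable_radialMat {f g : ℝ → ℝ} (hf : Measurable f) (hg : Measurable g) (i j : Fin n) :
    Measurable fun x : EuclideanSpace ℝ (Fin n) =>
      radialMat (f (‖x‖ ^ 2)) (g (‖x‖ ^ 2)) x i j := by
  simp only [radialMat_apply]
  fun_prop

lemma measurable_gradField (i j : Fin n) :
    Measurable fun x => gradField n a b l₁ l₂ x i j :=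
  measurable_radialMat measurable_sqProfile ((measurable_deriv _).const_mul 2) i j

lemma measurable_radialMap : Measurable (radialMap n a b l₁ l₂) := by
  have : radialMap n a b l₁ l₂ = fun x => sqProfile n a b l₁ l₂ (‖x‖ ^ 2) • x :=
    funext radialMap_eq
  rw [this]
  exact (measurable_sqProfile.comp (by fun_prop)).smul measurable_id

lemma norm_radialMap (x : EuclideanSpace ℝ (Fin n)) :
    ‖radialMap n a b l₁ l₂ x‖ = ‖x‖ * |sqProfile n a b l₁ l₂ (‖x‖ ^ 2)| := by
  rw [radialMap_eq, norm_smul, Real.norm_eq_abs, mul_comm]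

lemma exists_norm_radialMap_le (H : Admissible n a b l₁ l₂) (R : ℝ) :
    ∃ C, 0 ≤ C ∧ ∀ᵐ x ∂(volume.restrict (ball (0 : EuclideanSpace ℝ (Fin n)) R)),
      ‖radialMap n a b l₁ l₂ x‖ ≤ C := by
  obtain ⟨C, hC0, hC⟩ := exists_mul_abs_sqProfile_le H R
  refine ⟨C, hC0, ?_⟩
  filter_upwards [ae_restrict_of_ae H.ae_regular, ae_restrict_mem measurableSet_ball] with x hx hxR
  rw [norm_radialMap]
  exact (hC ‖x‖ hx.norm_pos (mem_ball_zero_iff.1 hxR).le hx).1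

lemma exists_abs_gradField_le (H : Admissible n a b l₁ l₂) (R : ℝ) :
    ∃ C, 0 ≤ C ∧ ∀ᵐ x ∂(volume.restrict (ball (0 : EuclideanSpace ℝ (Fin n)) R)), ∀ i j,
      ‖gradField n a b l₁ l₂ x i j‖ ≤ C * (‖x‖⁻¹ + weight n a b ‖x‖) := by
  obtain ⟨C, hC0, hC⟩ := exists_abs_gradient_le H R
  refine ⟨C, hC0, ?_⟩
  filter_upwards [ae_restrict_of_ae H.ae_regular, ae_restrict_mem measurableSet_ball]
    with x hx hxR i j
  exact (abs_radialMat_le _ _ x i j).trans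
    (hC ‖x‖ hx.norm_pos (mem_ball_zero_iff.1 hxR).le hx)

lemma exists_abs_radialMap_mul_singularWeight_le (H : Admissible n a b l₁ l₂) (R : ℝ) :
    ∃ C, 0 ≤ C ∧ ∀ᵐ x ∂(volume.restrict (ball (0 : EuclideanSpace ℝ (Fin n)) R)),
      ‖radialMap n a b l₁ l₂ x‖ * singularWeight a b ‖x‖ ≤ C * (‖x‖⁻¹ + weight n a b ‖x‖) := by
  obtain ⟨C, hC0, hC⟩ := exists_mul_abs_sqProfile_le H R
  refine ⟨C, hC0, ?_⟩
  filter_upwards [ae_restrict_of_ae H.ae_regular, ae_restrict_mem measurableSet_ball] with x hx hxR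
  rw [norm_radialMap]
  exact (hC ‖x‖ hx.norm_pos (mem_ball_zero_iff.1 hxR).le hx).2

lemma memLp_radialMap (H : Admissible n a b l₁ l₂) (p : ℝ≥0∞) (R : ℝ) :
    MemLp (radialMap n a b l₁ l₂) p (volume.restrict (ball 0 R)) := by
  have : IsFiniteMeasure (volume.restrict (ball (0 : EuclideanSpace ℝ (Fin n)) R)) :=
    ⟨by simpa using measure_ball_lt_top⟩
  obtain ⟨C, -, hC⟩ := exists_norm_radialMap_le H R
  exact MemLp.of_bound measurable_radialMap.aestronglyMeasurable C hC

lemma memLp_gradField (H : Admissible n a b l₁ l₂) {p : ℝ} (hp : 1 ≤ p)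
    (hpn : p < (n : ℝ) / ((n : ℝ) - 1)) (R : ℝ) (i j : Fin n) :
    MemLp (fun x => gradField n a b l₁ l₂ x i j) (ENNReal.ofReal p)
      (volume.restrict (ball 0 R)) := by
  obtain ⟨C, -, hC⟩ := exists_abs_gradField_le H R
  refine ((memLp_weight H.two_le hp hpn a b R).const_mul C).mono'
    (measurable_gradField i j).aestronglyMeasurable ?_
  filter_upwards [hC] with x hx
  exact hx i j

lemma one_lt_sobolev_exponent (hn : 2 ≤ n) : (1 : ℝ) < (n : ℝ) / ((n : ℝ) - 1) := by
  have : (2 : ℝ) ≤ n := by exact_mod_cast hn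
  rw [lt_div_iff₀ (by linarith)]
  linarith

lemma integrableOn_inv_add_weight (hn : 2 ≤ n) (a b R : ℝ) :
    IntegrableOn (fun x : EuclideanSpace ℝ (Fin n) => ‖x‖⁻¹ + weight n a b ‖x‖) (ball 0 R) := by
  have := memLp_weight hn le_rfl (one_lt_sobolev_exponent hn) a b R
  rw [ENNReal.ofReal_one] at this
  exact memLp_one_iff_integrable.1 this

lemma locallyIntegrable_radialMap (H : Admissible n a b l₁ l₂) :
    LocallyIntegrable (radialMap n a b l₁ l₂) :=
  locallyIntegrable_of_integrableOn_ball fun R =>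
    memLp_one_iff_integrable.1 (memLp_radialMap H 1 R)

lemma locallyIntegrable_gradField (H : Admissible n a b l₁ l₂) (i j : Fin n) :
    LocallyIntegrable (fun x => gradField n a b l₁ l₂ x i j) :=
  locallyIntegrable_of_integrableOn_ball fun R => by
    have := memLp_gradField H le_rfl (one_lt_sobolev_exponent H.two_le) R i j
    rw [ENNReal.ofReal_one] at this
    exact memLp_one_iff_integrable.1 this

lemma locallyIntegrable_radialMap_apply (H : Admissible n a b l₁ l₂) (i : Fin n) :
    LocallyIntegrable (fun x => radialMap n a b l₁ l₂ x i) :=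
  (locallyIntegrable_radialMap H).mono
    ((EuclideanSpace.proj (𝕜 := ℝ) i).continuous.measurable.comp
      measurable_radialMap).aestronglyMeasurable
    (Eventually.of_forall fun _ => abs_apply_le_norm _ i)

lemma contDiffAt_norm_sq_comp {f : ℝ → ℝ} {m : ℕ∞} {x : EuclideanSpace ℝ (Fin n)}
    (hf : ContDiffAt ℝ m f (‖x‖ ^ 2)) :
    ContDiffAt ℝ m (fun y : EuclideanSpace ℝ (Fin n) => f (‖y‖ ^ 2)) x :=
  hf.comp x (contDiff_norm_sq ℝ).contDiffAt

lemma contDiffAt_radialMap (H : Admissible n a b l₁ l₂) {x : EuclideanSpace ℝ (Fin n)}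
    (hx : Regular a b (‖x‖ ^ 2)) : ContDiffAt ℝ ∞ (radialMap n a b l₁ l₂) x := by
  have : radialMap n a b l₁ l₂ = fun x => sqProfile n a b l₁ l₂ (‖x‖ ^ 2) • x :=
    funext radialMap_eq
  rw [this]
  exact (contDiffAt_norm_sq_comp (contDiffAt_sqProfile H hx)).smul contDiffAt_id

lemma radialMap_apply (x : EuclideanSpace ℝ (Fin n)) (i : Fin n) :
    radialMap n a b l₁ l₂ x i = sqProfile n a b l₁ l₂ (‖x‖ ^ 2) * x i := by
  rw [radialMap_eq]
  rfl

lemma contDiffAt_radialMap_apply (H : Admissible n a b l₁ l₂) {x : EuclideanSpace ℝ (Fin n)}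
    (hx : Regular a b (‖x‖ ^ 2)) (i : Fin n) :
    ContDiffAt ℝ ∞ (fun y => radialMap n a b l₁ l₂ y i) x :=
  (EuclideanSpace.proj (𝕜 := ℝ) i).contDiff.contDiffAt.comp x (contDiffAt_radialMap H hx)

lemma fderiv_radialMap_apply (H : Admissible n a b l₁ l₂) {x : EuclideanSpace ℝ (Fin n)}
    (hx : Regular a b (‖x‖ ^ 2)) (i j : Fin n) :
    fderiv ℝ (fun y => radialMap n a b l₁ l₂ y i) x (EuclideanSpace.single j 1)
      = gradField n a b l₁ l₂ x i j := by
  simp only [radialMap_apply]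
  exact fderiv_radial_single (hasDerivAt_sqProfile H hx) i j

lemma measurable_singFun (N a b : ℝ) : Measurable (singFun (n := n) N a b) := by
  unfold singFun
  fun_prop

/-- The pointwise derivative off the singular set is the weak one, because `|u| |∇g| / |g|` is at
most `4 |u|` times the singular weight, which is locally integrable. -/
theorem hasWeakJacobian_radialMap (H : Admissible n a b l₁ l₂) :
    HasWeakJacobian univ (radialMap n a b l₁ l₂) (gradField n a b l₁ l₂) := by
  refine ⟨(locallyIntegrable_radialMap H).locallyIntegrableOn _,
    fun i j => (locallyIntegrable_gradField H i j).locallyIntegrableOn _, ?_⟩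
  intro η hη i j
  simp only [Measure.restrict_univ]
  have hpos := fun x => singFun_pos_iff (n := n) (a := a) (b := b) one_pos (x := x)
  refine integral_mul_fderiv_of_contDiffAt (g := singFun 1 a b)
    (W := fun x => |radialMap n a b l₁ l₂ x i|
      * (|fderiv ℝ (singFun 1 a b) x (EuclideanSpace.single j 1)| / |singFun 1 a b x|))
    (contDiff_singFun (m := 1) 1 a b) ?_ ?_ ?_ (locallyIntegrable_radialMap_apply H i)
    (locallyIntegrable_gradField H i j) ?_ (Eventually.of_forall fun x => le_rfl)
    (hη.1.of_le (by simp)) hη.2.1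
  · filter_upwards [H.ae_regular] with x hx
    exact (hpos x).2 hx
  · intro x hx
    exact (contDiffAt_radialMap_apply H ((hpos x).1 hx) i).of_le (by simp)
  · intro x hx
    exact fderiv_radialMap_apply H ((hpos x).1 hx) i j
  · refine locallyIntegrable_of_integrableOn_ball fun R => ?_
    obtain ⟨C, hC0, hC⟩ := exists_abs_radialMap_mul_singularWeight_le H R
    refine ((integrableOn_inv_add_weight H.two_le a b R).const_mul (4 * C)).mono' ?_ ?_
    · have h1 : Measurable (fun x => radialMap n a b l₁ l₂ x i) :=
        (EuclideanSpace.proj (𝕜 := ℝ) i).continuous.measurable.comp measurable_radialMap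
      have h2 : Measurable fun x =>
          fderiv ℝ (singFun (n := n) 1 a b) x (EuclideanSpace.single j 1) :=
        measurable_fderiv_apply_const ℝ _ _
      have h3 := measurable_singFun (n := n) 1 a b
      have habs : Measurable (fun t : ℝ => |t|) := continuous_abs.measurable
      exact ((habs.comp h1).mul ((habs.comp h2).div (habs.comp h3))).aestronglyMeasurable
    · filter_upwards [hC, ae_restrict_of_ae H.ae_regular] with x hx hreg
      rw [Real.norm_eq_abs, abs_of_nonneg (by positivity)]
      have h1 := abs_fderiv_singFun_div_le one_pos H.pos.le H.pos'.le hreg j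
      calc _ ≤ ‖radialMap n a b l₁ l₂ x‖ * (4 * singularWeight a b ‖x‖) :=
            mul_le_mul (abs_apply_le_norm _ i) h1 (by positivity) (norm_nonneg _)
        _ = 4 * (‖radialMap n a b l₁ l₂ x‖ * singularWeight a b ‖x‖) := by ring
        _ ≤ 4 * (C * (‖x‖⁻¹ + weight n a b ‖x‖)) := by linarith
        _ = _ := by ring

/-! ### Restriction and uniqueness of weak Jacobians -/

section WeakJacobian

variable {Ω : Set (EuclideanSpace ℝ (Fin n))}
  {u : EuclideanSpace ℝ (Fin n) → EuclideanSpace ℝ (Fin n)}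
  {G G' : EuclideanSpace ℝ (Fin n) → Matrix (Fin n) (Fin n) ℝ}

lemma setIntegral_mul_eq_of_tsupport_subset {f η : EuclideanSpace ℝ (Fin n) → ℝ}
    (h : tsupport η ⊆ Ω) : ∫ x in Ω, f x * η x = ∫ x, f x * η x := by
  refine setIntegral_eq_integral_of_forall_compl_eq_zero fun x hx => ?_
  rw [image_eq_zero_of_notMem_tsupport fun h' => hx (h h'), mul_zero]

lemma tsupport_fderiv_apply_subset' {F : Type*} [NormedAddCommGroup F] [NormedSpace ℝ F]
    (η : EuclideanSpace ℝ (Fin n) → F) (v : EuclideanSpace ℝ (Fin n)) :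
    tsupport (fun x => fderiv ℝ η x v) ⊆ tsupport η :=
  tsupport_fderiv_apply_subset ℝ v

lemma HasWeakJacobian.restrict (h : HasWeakJacobian univ u G) : HasWeakJacobian Ω u G := by
  obtain ⟨h1, h2, h3⟩ := h
  refine ⟨h1.mono_set (subset_univ _), fun i j => (h2 i j).mono_set (subset_univ _), ?_⟩
  intro η hη i j
  have := h3 η ⟨hη.1, hη.2.1, subset_univ _⟩ i j
  rw [setIntegral_mul_eq_of_tsupport_subset
      ((tsupport_fderiv_apply_subset' η _).trans hη.2.2),
    setIntegral_mul_eq_of_tsupport_subset hη.2.2]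
  simpa using this

/-- Weak Jacobians are unique almost everywhere. This transfers the computations for `gradField` to
the arbitrary `G` in the claims on the determinant and on noncompact test fields. -/
lemma HasWeakJacobian.ae_eq (hΩ : IsOpen Ω) (h : HasWeakJacobian Ω u G)
    (h' : HasWeakJacobian Ω u G') : ∀ᵐ x ∂(volume.restrict Ω), G x = G' x := by
  have key : ∀ i j, ∀ᵐ x ∂(volume.restrict Ω), G x i j = G' x i j := by
    intro i j
    rw [ae_restrict_iff' hΩ.measurableSet]
    have := hΩ.ae_eq_zero_of_integral_contDiff_smul_eq_zero
      (f := fun x => G x i j - G' x i j) (μ := volume) ((h.2.1 i j).sub (h'.2.1 i j)) ?_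
    · filter_upwards [this] with x hx hxΩ
      exact sub_eq_zero.1 (hx hxΩ)
    intro η hη hηc hηΩ
    have e := (h.2.2 η ⟨hη, hηc, hηΩ⟩ i j).symm.trans (h'.2.2 η ⟨hη, hηc, hηΩ⟩ i j)
    rw [setIntegral_mul_eq_of_tsupport_subset hηΩ, setIntegral_mul_eq_of_tsupport_subset hηΩ,
      neg_inj] at e
    have hint : ∀ {f : EuclideanSpace ℝ (Fin n) → ℝ}, LocallyIntegrableOn f Ω →
        Integrable (fun x => f x * η x) := by
      intro f hf
      have h1 : IntegrableOn f (tsupport η) := hf.integrableOn_compact_subset hηΩ hηc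
      have h2 : IntegrableOn (fun x => f x * η x) (tsupport η) :=
        h1.mul_continuousOn hη.continuous.continuousOn hηc
      refine (integrableOn_iff_integrable_of_support_subset ?_).1 h2
      intro x hx
      by_contra hx'
      exact hx (by simp only [image_eq_zero_of_notMem_tsupport hx', mul_zero])
    simp only [smul_eq_mul, mul_comm (η _), sub_mul]
    rw [integral_sub (hint (h.2.1 i j)) (hint (h'.2.1 i j)), e, sub_self]
  have : ∀ᵐ x ∂(volume.restrict Ω), ∀ i j, G x i j = G' x i j :=
    ae_all_iff.2 fun i => ae_all_iff.2 fun j => key i j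
  filter_upwards [this] with x hx
  ext i j
  exact hx i j

end WeakJacobian

/-! ### The map is a weak solution -/

lemma det_gradField (H : Admissible n a b l₁ l₂) {x : EuclideanSpace ℝ (Fin n)}
    (hx : Regular a b (‖x‖ ^ 2)) : (gradField n a b l₁ l₂ x).det = level a b l₁ l₂ (‖x‖ ^ 2) := by
  rw [gradField, det_radialMat H.two_le, sqProfile_identity H hx]

lemma cof_gradField (H : Admissible n a b l₁ l₂) {x : EuclideanSpace ℝ (Fin n)}
    (hx : Regular a b (‖x‖ ^ 2)) : cof (gradField n a b l₁ l₂ x)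
      = radialMat (sqProfile n a b l₁ l₂ (‖x‖ ^ 2) ^ (n - 1)
        + ‖x‖ ^ 2 * (sqProfile n a b l₁ l₂ (‖x‖ ^ 2) ^ (n - 2)
          * (2 * deriv (sqProfile n a b l₁ l₂) (‖x‖ ^ 2))))
        (-(sqProfile n a b l₁ l₂ (‖x‖ ^ 2) ^ (n - 2)
          * (2 * deriv (sqProfile n a b l₁ l₂) (‖x‖ ^ 2)))) x := by
  refine cof_radialMat H.two_le _ _ x ?_
  by_cases h : level a b l₁ l₂ (‖x‖ ^ 2) = 0
  · obtain ⟨h1, h2⟩ := sqProfile_eq_zero H hx h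
    exact Or.inr ⟨h1, by rw [h2, mul_zero]⟩
  · refine Or.inl ?_
    have := det_gradField H hx
    rw [gradField] at this
    rwa [this]

/-- The radial coefficient of the stress. -/
def stressCoeff (h : ℝ → ℝ) (n : ℕ) (a b l₁ l₂ s : ℝ) : ℝ :=
  h (level a b l₁ l₂ s) * sqProfile n a b l₁ l₂ s ^ (n - 1)

/-- The derivative coefficient of the stress. -/
def stressCoeff' (h : ℝ → ℝ) (n : ℕ) (a b l₁ l₂ s : ℝ) : ℝ :=
  h (level a b l₁ l₂ s) * (sqProfile n a b l₁ l₂ s ^ (n - 2)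
    * (2 * deriv (sqProfile n a b l₁ l₂) s))

/-- The stress `h(det Du) cof Du`. -/
def stress (h : ℝ → ℝ) (n : ℕ) (a b l₁ l₂ : ℝ) (x : EuclideanSpace ℝ (Fin n)) :
    Matrix (Fin n) (Fin n) ℝ :=
  radialMat (stressCoeff h n a b l₁ l₂ (‖x‖ ^ 2)
    + ‖x‖ ^ 2 * stressCoeff' h n a b l₁ l₂ (‖x‖ ^ 2)) (-stressCoeff' h n a b l₁ l₂ (‖x‖ ^ 2)) x

variable {h : ℝ → ℝ}

lemma stress_eq (H : Admissible n a b l₁ l₂) {x : EuclideanSpace ℝ (Fin n)}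
    (hx : Regular a b (‖x‖ ^ 2)) (i j : Fin n) :
    h (gradField n a b l₁ l₂ x).det * cof (gradField n a b l₁ l₂ x) i j
      = stress h n a b l₁ l₂ x i j := by
  rw [det_gradField H hx, cof_gradField H hx]
  simp only [stress, radialMat_apply, stressCoeff, stressCoeff']
  ring

lemma measurable_stressCoeff (hh : Continuous h) : Measurable (stressCoeff h n a b l₁ l₂) :=
  (hh.measurable.comp measurable_level).mul (measurable_sqProfile.pow_const _)

lemma measurable_stressCoeff' (hh : Continuous h) : Measurable (stressCoeff' h n a b l₁ l₂) :=
  (hh.measurable.comp measurable_level).mul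
    ((measurable_sqProfile.pow_const _).mul ((measurable_deriv _).const_mul 2))

lemma measurable_stress (hh : Continuous h) (i j : Fin n) :
    Measurable fun x => stress h n a b l₁ l₂ x i j :=
  measurable_radialMat (f := fun s => stressCoeff h n a b l₁ l₂ s
      + s * stressCoeff' h n a b l₁ l₂ s) (g := fun s => -stressCoeff' h n a b l₁ l₂ s)
    ((measurable_stressCoeff hh).add (measurable_id.mul (measurable_stressCoeff' hh)))
    (measurable_stressCoeff' hh).neg i j

/-- An upper bound for `|h|` on the values of the Jacobian determinant. -/
def levelBound (h : ℝ → ℝ) (l₁ l₂ : ℝ) : ℝ := |h l₁| + |h l₂| + |h 0|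

lemma levelBound_nonneg : 0 ≤ levelBound h l₁ l₂ := by
  unfold levelBound
  positivity

lemma abs_comp_level_le (s : ℝ) : |h (level a b l₁ l₂ s)| ≤ levelBound h l₁ l₂ := by
  have h1 := abs_nonneg (h l₁)
  have h2 := abs_nonneg (h l₂)
  have h3 := abs_nonneg (h 0)
  unfold level levelBound
  split_ifs <;> linarith

lemma exists_abs_stress_le (H : Admissible n a b l₁ l₂) (R : ℝ) :
    ∃ C, 0 ≤ C ∧ ∀ᵐ x ∂(volume.restrict (ball (0 : EuclideanSpace ℝ (Fin n)) R)), ∀ i j,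
      ‖stress h n a b l₁ l₂ x i j‖ ≤ C * ((‖x‖ ^ (n - 1))⁻¹ * weight n a b ‖x‖) := by
  obtain ⟨C, hC0, hC⟩ := exists_abs_cofactor_le H R
  refine ⟨levelBound h l₁ l₂ * C, mul_nonneg levelBound_nonneg hC0, ?_⟩
  filter_upwards [ae_restrict_of_ae H.ae_regular, ae_restrict_mem measurableSet_ball]
    with x hx hxR i j
  have h1 := hC ‖x‖ hx.norm_pos (mem_ball_zero_iff.1 hxR).le hx
  refine (abs_radialMat_le _ _ x i j).trans ?_
  rw [abs_neg, mul_assoc]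
  set r := ‖x‖
  have hl := abs_comp_level_le (h := h) (a := a) (b := b) (l₁ := l₁) (l₂ := l₂) (r ^ 2)
  have h2 : |stressCoeff h n a b l₁ l₂ (r ^ 2)|
      = |h (level a b l₁ l₂ (r ^ 2))| * |sqProfile n a b l₁ l₂ (r ^ 2)| ^ (n - 1) := by
    rw [stressCoeff, abs_mul, abs_pow]
  have h3 : |stressCoeff' h n a b l₁ l₂ (r ^ 2)|
      = |h (level a b l₁ l₂ (r ^ 2))| * (|sqProfile n a b l₁ l₂ (r ^ 2)| ^ (n - 2)
        * |2 * deriv (sqProfile n a b l₁ l₂) (r ^ 2)|) := by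
    rw [stressCoeff', abs_mul, abs_mul, abs_pow]
  have h4 : |stressCoeff h n a b l₁ l₂ (r ^ 2) + r ^ 2 * stressCoeff' h n a b l₁ l₂ (r ^ 2)|
      ≤ |stressCoeff h n a b l₁ l₂ (r ^ 2)| + r ^ 2 * |stressCoeff' h n a b l₁ l₂ (r ^ 2)| := by
    refine (abs_add_le _ _).trans ?_
    rw [abs_mul, abs_of_nonneg (sq_nonneg r)]
  calc _ ≤ |stressCoeff h n a b l₁ l₂ (r ^ 2)|
        + 2 * (r ^ 2 * |stressCoeff' h n a b l₁ l₂ (r ^ 2)|) := by linarith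
    _ = |h (level a b l₁ l₂ (r ^ 2))| * (|sqProfile n a b l₁ l₂ (r ^ 2)| ^ (n - 1)
        + 2 * (r ^ 2 * (|sqProfile n a b l₁ l₂ (r ^ 2)| ^ (n - 2)
          * |2 * deriv (sqProfile n a b l₁ l₂) (r ^ 2)|))) := by
        rw [h2, h3]
        ring
    _ ≤ _ := mul_le_mul hl h1 (by positivity) levelBound_nonneg

lemma locallyIntegrable_stress (H : Admissible n a b l₁ l₂) (hh : Continuous h) (i j : Fin n) :
    LocallyIntegrable (fun x => stress h n a b l₁ l₂ x i j) :=
  locallyIntegrable_of_integrableOn_ball fun R => by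
    obtain ⟨C, -, hC⟩ := exists_abs_stress_le (h := h) H R
    refine ((integrableOn_weight_div H.two_le a b R).const_mul C).mono'
      (measurable_stress hh i j).aestronglyMeasurable ?_
    filter_upwards [hC] with x hx
    exact hx i j

/-- Near a regular value the level is constant, so `h` enters only as a constant factor and need not
be differentiable. The first claim is `(f^(n-1))' = (n-1) f^(n-2) f'`, the relation that makes the
stress divergence free. -/
lemma stressCoeff_derivs (H : Admissible n a b l₁ l₂) (hs : Regular a b s) :
    HasDerivAt (stressCoeff h n a b l₁ l₂)
      (((n : ℝ) - 1) / 2 * stressCoeff' h n a b l₁ l₂ s) s ∧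
    ContDiffAt ℝ ∞ (stressCoeff h n a b l₁ l₂) s ∧
    ContDiffAt ℝ ∞ (stressCoeff' h n a b l₁ l₂) s := by
  set c := h (level a b l₁ l₂ s) with hc
  have hl := level_eventuallyEq H hs
  have e1 : stressCoeff h n a b l₁ l₂ =ᶠ[𝓝 s]
      fun t => c * sqProfile n a b l₁ l₂ t ^ (n - 1) := by
    filter_upwards [hl] with t ht
    rw [stressCoeff, ht]
  have e2 : stressCoeff' h n a b l₁ l₂ =ᶠ[𝓝 s]
      fun t => c * (sqProfile n a b l₁ l₂ t ^ (n - 2)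
        * (2 * deriv (sqProfile n a b l₁ l₂) t)) := by
    filter_upwards [hl] with t ht
    rw [stressCoeff', ht]
  have d1 := contDiffAt_sqProfile H hs
  have d2 := contDiffAt_deriv_sqProfile H hs
  refine ⟨?_, ?_, ?_⟩
  · have h1 := (((hasDerivAt_sqProfile H hs).pow (n - 1)).const_mul c).congr_of_eventuallyEq e1
    refine h1.congr_deriv ?_
    rw [stressCoeff', ← hc]
    have hn := H.two_le
    rw [show n - 1 - 1 = n - 2 by omega, Nat.cast_sub (by omega)]
    push_cast
    ring
  · exact (contDiffAt_const.mul (d1.pow _)).congr_of_eventuallyEq e1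
  · exact (contDiffAt_const.mul ((d1.pow _).mul (contDiffAt_const.mul d2))).congr_of_eventuallyEq e2

lemma contDiffAt_stress (H : Admissible n a b l₁ l₂) {x : EuclideanSpace ℝ (Fin n)}
    (hx : Regular a b (‖x‖ ^ 2)) (i j : Fin n) :
    ContDiffAt ℝ ∞ (fun y => stress h n a b l₁ l₂ y i j) x := by
  obtain ⟨-, h1, h2⟩ := stressCoeff_derivs (h := h) H hx
  have h3 := contDiffAt_norm_sq_comp h1
  have h4 := contDiffAt_norm_sq_comp h2
  have h5 : ContDiffAt ℝ ∞ (fun y : EuclideanSpace ℝ (Fin n) => ‖y‖ ^ 2) x :=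
    (contDiff_norm_sq ℝ).contDiffAt
  have h6 : ∀ i, ContDiffAt ℝ ∞ (fun y : EuclideanSpace ℝ (Fin n) => y i) x := fun i =>
    (EuclideanSpace.proj (𝕜 := ℝ) i).contDiff.contDiffAt
  simp only [stress, radialMat_apply]
  exact ((h3.add (h5.mul h4)).mul contDiffAt_const).add (h4.neg.mul ((h6 i).mul (h6 j)))

lemma sum_fderiv_stress_eq_zero (H : Admissible n a b l₁ l₂) {x : EuclideanSpace ℝ (Fin n)}
    (hx : Regular a b (‖x‖ ^ 2)) (i : Fin n) :
    ∑ j, fderiv ℝ (fun y => stress h n a b l₁ l₂ y i j) x (EuclideanSpace.single j 1) = 0 := by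
  obtain ⟨h1, -, h2⟩ := stressCoeff_derivs (h := h) H hx
  exact sum_fderiv_radialMat_eq_zero h1 (h2.differentiableAt (by simp)).hasDerivAt i

/-- The derivative coefficient cancels because `x` is an eigenvector of the stress; the normal flux
is therefore less singular than the stress itself. -/
lemma sum_stress_mul (x : EuclideanSpace ℝ (Fin n)) (i : Fin n) :
    ∑ j, stress h n a b l₁ l₂ x i j * x j = stressCoeff h n a b l₁ l₂ (‖x‖ ^ 2) * x i := by
  rw [stress, sum_radialMat_mul]
  ring

/-! ### Pairing of the stress with derivatives of test fields -/

section Frob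

variable {ζ ξ : EuclideanSpace ℝ (Fin n) → EuclideanSpace ℝ (Fin n)}
  {x : EuclideanSpace ℝ (Fin n)}

lemma contDiff_apply {m : ℕ∞} (hζ : ContDiff ℝ m ζ) (i : Fin n) :
    ContDiff ℝ m (fun x => ζ x i) :=
  (EuclideanSpace.proj (𝕜 := ℝ) i).contDiff.comp hζ

lemma hasCompactSupport_apply (hζ : HasCompactSupport ζ) (i : Fin n) :
    HasCompactSupport (fun x => ζ x i) :=
  hζ.comp_left (g := fun y : EuclideanSpace ℝ (Fin n) => y i) rfl

lemma jacobian_apply (hζ : DifferentiableAt ℝ ζ x) (i j : Fin n) :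
    jacobian ζ x i j = fderiv ℝ (fun y => ζ y i) x (EuclideanSpace.single j 1) := by
  have h1 := ((EuclideanSpace.proj (𝕜 := ℝ) i : EuclideanSpace ℝ (Fin n) →L[ℝ] ℝ).hasFDerivAt.comp
    x hζ.hasFDerivAt).fderiv
  exact (congrArg (fun L => L (EuclideanSpace.single j 1)) h1).symm

lemma continuous_jacobian (hζ : ContDiff ℝ 1 ζ) (i j : Fin n) :
    Continuous (fun x => jacobian ζ x i j) := by
  have : (fun x => jacobian ζ x i j)
      = fun x => fderiv ℝ (fun y => ζ y i) x (EuclideanSpace.single j 1) :=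
    funext fun x => jacobian_apply (hζ.differentiable (by norm_num) x) i j
  rw [this]
  exact ((contDiff_apply (m := 1) hζ i).continuous_fderiv_apply (by norm_num)).comp
    (continuous_id.prodMk continuous_const)

lemma hasCompactSupport_jacobian (hζ : HasCompactSupport ζ) (i j : Fin n) :
    HasCompactSupport (fun x => jacobian ζ x i j) :=
  (hζ.fderiv_apply (𝕜 := ℝ) (EuclideanSpace.single j 1)).comp_left
    (g := fun y : EuclideanSpace ℝ (Fin n) => y i) rfl

lemma mul_frob (c : ℝ) (A B : Matrix (Fin n) (Fin n) ℝ) :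
    c * frob A B = ∑ i, ∑ j, c * A i j * B i j := by
  simp only [frob, Finset.mul_sum, mul_assoc]

lemma mul_frob_eq_stress (H : Admissible n a b l₁ l₂) (hx : Regular a b (‖x‖ ^ 2))
    (B : Matrix (Fin n) (Fin n) ℝ) :
    h (gradField n a b l₁ l₂ x).det * frob (cof (gradField n a b l₁ l₂ x)) B
      = frob (stress h n a b l₁ l₂ x) B := by
  rw [mul_frob]
  simp only [stress_eq H hx]
  rfl

lemma frob_add (A B C : Matrix (Fin n) (Fin n) ℝ) :
    frob A (B + C) = frob A B + frob A C := by
  simp only [frob, Matrix.add_apply, mul_add, Finset.sum_add_distrib]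

lemma frob_neg (A B : Matrix (Fin n) (Fin n) ℝ) : frob A (-B) = -frob A B := by
  simp only [frob, Matrix.neg_apply, mul_neg, Finset.sum_neg_distrib]

lemma jacobian_add (hζ : DifferentiableAt ℝ ζ x) (hξ : DifferentiableAt ℝ ξ x) :
    jacobian (fun y => ζ y + ξ y) x = jacobian ζ x + jacobian ξ x := by
  ext i j
  simp [jacobian, fderiv_fun_add hζ hξ]

lemma integrable_frob_stress (H : Admissible n a b l₁ l₂) (hh : Continuous h)
    (hζ : ContDiff ℝ 1 ζ) (hζc : HasCompactSupport ζ) :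
    Integrable (fun x => frob (stress h n a b l₁ l₂ x) (jacobian ζ x)) :=
  integrable_finsetSum _ fun i _ => integrable_finsetSum _ fun j _ =>
    integrable_mul_of_locallyIntegrable (locallyIntegrable_stress H hh i j)
      (continuous_jacobian hζ i j) (hasCompactSupport_jacobian hζc i j)

lemma sum_norm_apply_mul_le (x y : EuclideanSpace ℝ (Fin n)) :
    |∑ i, x i * y i| ≤ n * (‖x‖ * ‖y‖) := by
  refine (Finset.abs_sum_le_sum_abs _ _).trans ?_
  calc ∑ i, |x i * y i| ≤ ∑ _i : Fin n, ‖x‖ * ‖y‖ := by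
        refine Finset.sum_le_sum fun i _ => ?_
        rw [abs_mul]
        exact mul_le_mul (abs_apply_le_norm x i) (abs_apply_le_norm y i) (abs_nonneg _)
          (norm_nonneg _)
    _ = _ := by simp

/-- The gradient of `singFun` is parallel to `x`, so only the normal component of the stress
survives. -/
lemma sum_flux_eq (hx : Regular a b (‖x‖ ^ 2)) (y : EuclideanSpace ℝ (Fin n)) :
    ∑ p : Fin n × Fin n, fderiv ℝ (singFun 1 a b) x (EuclideanSpace.single p.2 1)
        * stress h n a b l₁ l₂ x p.1 p.2 * y p.1
      = singFun 1 a b x * (4 * logDerivCoeff a b (‖x‖ ^ 2)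
        * stressCoeff h n a b l₁ l₂ (‖x‖ ^ 2) * ∑ i, x i * y i) := by
  rw [Fintype.sum_prod_type]
  have h1 : ∀ i, ∑ j, fderiv ℝ (singFun 1 a b) x (EuclideanSpace.single j 1)
        * stress h n a b l₁ l₂ x i j * y i
      = singFun 1 a b x * (4 * logDerivCoeff a b (‖x‖ ^ 2)) * y i
        * ∑ j, stress h n a b l₁ l₂ x i j * x j := by
    intro i
    rw [Finset.mul_sum]
    refine Finset.sum_congr rfl fun j _ => ?_
    rw [fderiv_singFun_single 1 hx]
    ring
  simp only [h1, sum_stress_mul, Finset.mul_sum]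
  exact Finset.sum_congr rfl fun i _ => by ring

lemma integral_frob_stress_of_apply_zero (H : Admissible n a b l₁ l₂) (hh : Continuous h)
    (hζ : ContDiff ℝ 1 ζ) (hζc : HasCompactSupport ζ) (hζ0 : ζ 0 = 0) :
    ∫ x, frob (stress h n a b l₁ l₂ x) (jacobian ζ x) = 0 := by
  have hpos := fun x => singFun_pos_iff (n := n) (a := a) (b := b) one_pos (x := x)
  -- The Lipschitz bound at the origin, `|ζ x| ≤ L |x|`, is the factor that tames the flux there.
  obtain ⟨L, hL⟩ := ContDiff.lipschitzWith_of_hasCompactSupport hζc hζ (by norm_num)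
  have hLζ : ∀ x, ‖ζ x‖ ≤ L * ‖x‖ := by
    intro x
    have := hL.norm_sub_le x 0
    simpa [hζ0] using this
  obtain ⟨R, -, hR⟩ := hζc.isBounded.exists_pos_norm_lt
  have key := integral_sum_mul_fderiv_eq_zero (μ := volume) (g := singFun (n := n) 1 a b)
    (F := fun (p : Fin n × Fin n) x => stress h n a b l₁ l₂ x p.1 p.2)
    (v := fun p => EuclideanSpace.single p.2 (1 : ℝ)) (ζ := fun p x => ζ x p.1)
    (W := fun x => |∑ p : Fin n × Fin n,
      fderiv ℝ (singFun 1 a b) x (EuclideanSpace.single p.2 1)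
        * stress h n a b l₁ l₂ x p.1 p.2 * ζ x p.1| / |singFun 1 a b x|)
    (contDiff_singFun (m := 1) 1 a b) ?_ ?_ (fun p => locallyIntegrable_stress H hh p.1 p.2)
    (fun p => contDiff_apply (m := 1) hζ p.1) (fun p => hasCompactSupport_apply hζc p.1) ?_ ?_
    (Eventually.of_forall fun _ => le_rfl)
  · rw [← key]
    congr 1
    ext x
    rw [Fintype.sum_prod_type, frob]
    simp only [jacobian_apply (hζ.differentiable (by norm_num) x)]
  · filter_upwards [H.ae_regular] with x hx
    exact (hpos x).2 hx
  · intro p x hx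
    exact (contDiffAt_stress H ((hpos x).1 hx) p.1 p.2).of_le (by simp)
  · intro x hx
    rw [Fintype.sum_prod_type]
    simp only [← Finset.sum_mul, sum_fderiv_stress_eq_zero H ((hpos x).1 hx), zero_mul,
      Finset.sum_const_zero]
  · refine (integrableOn_iff_integrable_of_support_subset (s := ball 0 R) ?_).1 ?_
    · intro x hx
      by_contra hxR
      apply hx
      have : ζ x = 0 := by
        by_contra h0
        exact hxR (mem_ball_zero_iff.2 (hR x (subset_tsupport _ h0)))
      simp [this]
    · obtain ⟨C, hC0, hC⟩ := exists_abs_flux_le H R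
      refine ((integrableOn_weight_div H.two_le a b R).const_mul
        (4 * levelBound h l₁ l₂ * n * L * C)).mono' ?_ ?_
      · have h2 : ∀ v, Measurable fun x => fderiv ℝ (singFun (n := n) 1 a b) x v := fun v =>
          measurable_fderiv_apply_const ℝ _ _
        have h3 := measurable_singFun (n := n) 1 a b
        have h4 := fun i j => measurable_stress (n := n) (a := a) (b := b) (l₁ := l₁) (l₂ := l₂)
          hh i j
        have h5 : ∀ i, Measurable fun x => ζ x i := fun i =>
          (contDiff_apply (m := 1) hζ i).continuous.measurable
        have habs : Measurable (fun t : ℝ => |t|) := continuous_abs.measurable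
        exact ((habs.comp (Finset.measurable_fun_sum _ fun p _ =>
          ((h2 _).mul (h4 p.1 p.2)).mul (h5 p.1))).div (habs.comp h3)).aestronglyMeasurable
      · filter_upwards [ae_restrict_of_ae H.ae_regular, ae_restrict_mem measurableSet_ball]
          with x hx hxR
        have hxR' : ‖x‖ ≤ R := (mem_ball_zero_iff.1 hxR).le
        have h1 := hC ‖x‖ hx.norm_pos hxR' hx
        have h2 := mul_abs_logDerivCoeff_le H.pos.le H.pos'.le hx.norm_pos hx
        have hg : 0 < |singFun 1 a b x| := abs_pos.2 ((hpos x).2 hx).ne'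
        rw [sum_flux_eq hx, abs_mul, mul_div_cancel_left₀ _ hg.ne', Real.norm_eq_abs, abs_abs,
          abs_mul, abs_mul, abs_mul, abs_of_pos (by norm_num : (0 : ℝ) < 4), stressCoeff, abs_mul,
          abs_pow]
        have h3 := sum_norm_apply_mul_le x (ζ x)
        have h4 : n * (‖x‖ * ‖ζ x‖) ≤ n * (‖x‖ * (L * ‖x‖)) := by
          have := hLζ x
          gcongr
        have hl := abs_comp_level_le (h := h) (a := a) (b := b) (l₁ := l₁) (l₂ := l₂) (‖x‖ ^ 2)
        have hlb := levelBound_nonneg (h := h) (l₁ := l₁) (l₂ := l₂)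
        set r := ‖x‖
        have hr : 0 < r := hx.norm_pos
        set f := |sqProfile n a b l₁ l₂ (r ^ 2)| ^ (n - 1)
        have hf : 0 ≤ f := by positivity
        set κ := |logDerivCoeff a b (r ^ 2)|
        have hσ := singularWeight_nonneg (a := a) (b := b) hr.le
        calc 4 * κ * (|h (level a b l₁ l₂ (r ^ 2))| * f) * |∑ i, x i * ζ x i|
            ≤ 4 * κ * (levelBound h l₁ l₂ * f) * (n * (r * (L * r))) := by
              gcongr
              exact h3.trans h4
          _ = 4 * levelBound h l₁ l₂ * n * L * ((r * κ) * r * f) := by ring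
          _ ≤ 4 * levelBound h l₁ l₂ * n * L * (singularWeight a b r * r * f) := by gcongr
          _ ≤ 4 * levelBound h l₁ l₂ * n * L * (C * ((r ^ (n - 1))⁻¹ * weight n a b r)) := by
              gcongr
          _ = _ := by ring

/-- A radial matrix field is orthogonal to the derivative of an even field. -/
lemma integral_frob_stress_of_even (hζ : ∀ x, ζ (-x) = ζ x) :
    ∫ x, frob (stress h n a b l₁ l₂ x) (jacobian ζ x) = 0 := by
  have h1 : ∀ x, frob (stress h n a b l₁ l₂ (-x)) (jacobian ζ (-x))
      = -frob (stress h n a b l₁ l₂ x) (jacobian ζ x) := by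
    intro x
    have h2 : stress h n a b l₁ l₂ (-x) = stress h n a b l₁ l₂ x := by
      ext i j
      simp [stress, radialMat_apply]
    have h3 : jacobian ζ (-x) = -jacobian ζ x := by
      have h4 : (fun y => ζ (-y)) = ζ := funext hζ
      have h5 := fderiv_comp_smul (𝕜 := ℝ) (f := ζ) (x := x) (-1)
      simp only [neg_smul, one_smul, h4] at h5
      ext i j
      simp [jacobian, h5]
    rw [h2, h3, frob_neg]
  -- Reflection shows that the integral equals its own negative. No integrability is required, since
  -- the default value zero also satisfies the claim.
  have h2 := integral_neg_eq_self
    (fun x => frob (stress h n a b l₁ l₂ x) (jacobian ζ x)) volume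
  simp only [h1, integral_neg] at h2
  linarith

/-- Decompose `ζ = (ζ - η ζ(0)) + η ζ(0)` with a bump `η` equal to `1` at the origin. The first part
vanishes there; the second is even. -/
theorem integral_frob_stress (H : Admissible n a b l₁ l₂) (hh : Continuous h)
    (hζ : ContDiff ℝ 1 ζ) (hζc : HasCompactSupport ζ) :
    ∫ x, frob (stress h n a b l₁ l₂ x) (jacobian ζ x) = 0 := by
  let η : ContDiffBump (0 : EuclideanSpace ℝ (Fin n)) := ⟨1, 2, one_pos, one_lt_two⟩
  have hη : ContDiff ℝ 1 (fun x => η x • ζ 0) := η.contDiff.smul contDiff_const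
  have hηc : HasCompactSupport (fun x => η x • ζ 0) := η.hasCompactSupport.smul_right
  have hξ : ContDiff ℝ 1 (fun x => ζ x - η x • ζ 0) := hζ.sub hη
  have hξc : HasCompactSupport (fun x => ζ x - η x • ζ 0) := hζc.sub hηc
  have h0 : η 0 = 1 := η.one_of_mem_closedBall (by simp [η])
  have h1 := integral_frob_stress_of_apply_zero H hh hξ hξc (by simp [h0])
  have h2 : ∫ x, frob (stress h n a b l₁ l₂ x) (jacobian (fun x => η x • ζ 0) x) = 0 :=
    integral_frob_stress_of_even fun x => by rw [η.neg]
  have h3 : ∀ x, frob (stress h n a b l₁ l₂ x) (jacobian ζ x)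
      = frob (stress h n a b l₁ l₂ x) (jacobian (fun x => ζ x - η x • ζ 0) x)
        + frob (stress h n a b l₁ l₂ x) (jacobian (fun x => η x • ζ 0) x) := by
    intro x
    rw [← frob_add, ← jacobian_add (hξ.differentiable (by norm_num) x)
      (hη.differentiable (by norm_num) x)]
    simp
  simp only [h3]
  rw [integral_add (integrable_frob_stress H hh hξ hξc) (integrable_frob_stress H hh hη hηc),
    h1, h2, add_zero]

end Frob

lemma ae_mul_frob_eq (H : Admissible n a b l₁ l₂)
    (ζ : EuclideanSpace ℝ (Fin n) → EuclideanSpace ℝ (Fin n)) :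
    ∀ᵐ x, h (gradField n a b l₁ l₂ x).det * frob (cof (gradField n a b l₁ l₂ x)) (jacobian ζ x)
      = frob (stress h n a b l₁ l₂ x) (jacobian ζ x) := by
  filter_upwards [H.ae_regular] with x hx
  exact mul_frob_eq_stress H hx _

lemma frob_jacobian_eq_zero {ζ : EuclideanSpace ℝ (Fin n) → EuclideanSpace ℝ (Fin n)}
    {x : EuclideanSpace ℝ (Fin n)} (hx : x ∉ tsupport ζ) (A : Matrix (Fin n) (Fin n) ℝ) :
    frob A (jacobian ζ x) = 0 := by
  have : fderiv ℝ ζ x = 0 := by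
    rw [(notMem_tsupport_iff_eventuallyEq.1 hx).fderiv_eq]
    exact fderiv_const_apply 0
  simp [frob, jacobian, this]

/-- A test field supported in `Ω` is a test field on the whole space, where the identity is already
known. -/
theorem isWeakSolution_radialMap (H : Admissible n a b l₁ l₂) (hh : Continuous h)
    (Ω : Set (EuclideanSpace ℝ (Fin n))) : IsWeakSolution h Ω (radialMap n a b l₁ l₂) := by
  refine ⟨gradField n a b l₁ l₂, (hasWeakJacobian_radialMap H).restrict, fun i j => ?_,
    fun ζ hζ => ?_⟩
  · refine ((locallyIntegrable_stress (h := h) H hh i j).congr ?_).locallyIntegrableOn _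
    filter_upwards [H.ae_regular] with x hx
    exact (stress_eq H hx i j).symm
  · rw [setIntegral_eq_integral_of_forall_compl_eq_zero, integral_congr_ae (ae_mul_frob_eq H ζ)]
    · exact integral_frob_stress H hh hζ.1 hζ.2.1
    · intro x hx
      rw [frob_jacobian_eq_zero fun h' => hx (hζ.2.2 h'), mul_zero]

/-- If `l₂ = 0`, the stress vanishes for `|x| > b`, and the compact support of the test field
is not needed. -/
theorem integral_ball_frob (H : Admissible n a b l₁ 0) (hb : b < 1) (hh : Continuous h)
    {G : EuclideanSpace ℝ (Fin n) → Matrix (Fin n) (Fin n) ℝ}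
    (hG : HasWeakJacobian (ball 0 1) (radialMap n a b l₁ 0) G)
    {ζ : EuclideanSpace ℝ (Fin n) → EuclideanSpace ℝ (Fin n)} (hζ : ContDiff ℝ 1 ζ) :
    IntegrableOn (fun x => h (G x).det * frob (cof (G x)) (jacobian ζ x)) (ball 0 1) ∧
      ∫ x in ball 0 1, h (G x).det * frob (cof (G x)) (jacobian ζ x) = 0 := by
  have hb0 := H.pos'
  -- The inner radius lies strictly between `b` and `1`, so multiplication by `η` alters `ζ` only
  -- where the stress vanishes.
  let η : ContDiffBump (0 : EuclideanSpace ℝ (Fin n)) :=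
    ⟨(b + 1) / 2, 1, by linarith, by linarith⟩
  have hξ : ContDiff ℝ 1 (fun x => η x • ζ x) := η.contDiff.smul hζ
  have hξc : HasCompactSupport (fun x => η x • ζ x) := η.hasCompactSupport.smul_right
  have hzero : ∀ x : EuclideanSpace ℝ (Fin n), Regular a b (‖x‖ ^ 2) → (b + 1) / 2 ≤ ‖x‖ →
      stress h n a b l₁ 0 x = 0 := by
    intro x hx hxb
    have h1 : b ^ 2 < ‖x‖ ^ 2 := pow_lt_pow_left₀ (by linarith) hb0.le two_ne_zero
    have h2 : level a b l₁ 0 (‖x‖ ^ 2) = 0 := by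
      simp [level, not_lt.2 h1.le, not_lt.2 (H.sq_le.trans h1.le)]
    obtain ⟨h3, h4⟩ := sqProfile_eq_zero H hx h2
    have h5 : n - 1 ≠ 0 := by
      have := H.two_le
      omega
    ext i j
    simp [stress, stressCoeff, stressCoeff', h3, h4, h5, radialMat_apply]
  have hEq : ∀ x : EuclideanSpace ℝ (Fin n), Regular a b (‖x‖ ^ 2) →
      frob (stress h n a b l₁ 0 x) (jacobian (fun x => η x • ζ x) x)
        = frob (stress h n a b l₁ 0 x) (jacobian ζ x) := by
    intro x hx
    by_cases hxb : (b + 1) / 2 ≤ ‖x‖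
    · rw [hzero x hx hxb]
      simp [frob]
    · have h1 : (fun x => η x • ζ x) =ᶠ[𝓝 x] ζ := by
        have h2 : η =ᶠ[𝓝 x] 1 :=
          η.eventuallyEq_one_of_mem_ball (mem_ball_zero_iff.2 (not_le.1 hxb))
        filter_upwards [h2] with y hy
        simp [hy]
      have h3 : jacobian (fun x => η x • ζ x) x = jacobian ζ x := by
        ext i j
        simp only [jacobian, h1.fderiv_eq]
      rw [h3]
  have hcongr : (fun x => h (G x).det * frob (cof (G x)) (jacobian ζ x))
      =ᵐ[volume.restrict (ball 0 1)]
      fun x => frob (stress h n a b l₁ 0 x) (jacobian (fun x => η x • ζ x) x) := by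
    filter_upwards [hG.ae_eq isOpen_ball (hasWeakJacobian_radialMap H).restrict,
      ae_restrict_of_ae H.ae_regular] with x hx hreg
    rw [hx, mul_frob_eq_stress H hreg, hEq x hreg]
  refine ⟨((integrable_frob_stress H hh hξ hξc).integrableOn).congr hcongr.symm, ?_⟩
  rw [integral_congr_ae hcongr]
  refine Eq.trans ?_ (integral_frob_stress H hh hξ hξc)
  refine setIntegral_eq_integral_of_ae_compl_eq_zero ?_
  filter_upwards [H.ae_regular] with x hx hx1
  have : (b + 1) / 2 ≤ ‖x‖ := by
    have : 1 ≤ ‖x‖ := not_lt.1 fun h' => hx1 (mem_ball_zero_iff.2 h')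
    linarith
  rw [hzero x hx this]
  simp [frob]

/-! ### Sobolev regularity and the boundary condition -/

lemma memW1p_radialMap (H : Admissible n a b l₁ l₂) {p : ℝ} (hp : 1 ≤ p)
    (hpn : p < (n : ℝ) / ((n : ℝ) - 1)) :
    MemW1p (ENNReal.ofReal p) (ball 0 1) (radialMap n a b l₁ l₂) :=
  ⟨gradField n a b l₁ l₂, (hasWeakJacobian_radialMap H).restrict, memLp_radialMap H _ 1,
    memLp_gradField H hp hpn 1⟩

lemma hasWeakJacobian_smul (c : ℝ) :
    HasWeakJacobian univ (fun x : EuclideanSpace ℝ (Fin n) => c • x)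
      (fun _ => c • (1 : Matrix (Fin n) (Fin n) ℝ)) := by
  have hc : Continuous fun x : EuclideanSpace ℝ (Fin n) => c • x := continuous_const_smul c
  refine ⟨hc.locallyIntegrable.locallyIntegrableOn _,
    fun i j => (locallyIntegrable_const _).locallyIntegrableOn _, fun η hη i j => ?_⟩
  simp only [Measure.restrict_univ]
  -- With a constant `g` the singular set is empty, and the statement is classical integration by
  -- parts.
  refine integral_mul_fderiv_of_contDiffAt (g := fun _ => 1)
    (f := fun x : EuclideanSpace ℝ (Fin n) => (c • x) i) (W := fun _ => 0) contDiff_const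
    (Eventually.of_forall fun _ => one_pos) ?_ ?_ ?_ (locallyIntegrable_const _)
    (locallyIntegrable_const _) ?_ (hη.1.of_le (by simp)) hη.2.1
  · intro x _
    exact (contDiff_apply (m := 1) (contDiff_id.const_smul c) i).contDiffAt
  · intro x _
    have h1 : HasFDerivAt (fun y : EuclideanSpace ℝ (Fin n) => (c • y) i)
        (c • (EuclideanSpace.proj i : EuclideanSpace ℝ (Fin n) →L[ℝ] ℝ)) x :=
      (hasFDerivAt_apply i).const_smul c
    rw [h1.fderiv]
    by_cases hij : i = j
    · subst hij
      simp
    · simp [hij]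
  · exact (contDiff_apply (m := 0) (contDiff_id.const_smul c) i).continuous.locallyIntegrable
  · simp

lemma HasWeakJacobian.sub {u v : EuclideanSpace ℝ (Fin n) → EuclideanSpace ℝ (Fin n)}
    {G G' : EuclideanSpace ℝ (Fin n) → Matrix (Fin n) (Fin n) ℝ}
    (hu : HasWeakJacobian univ u G) (hv : HasWeakJacobian univ v G') :
    HasWeakJacobian univ (fun x => u x - v x) (fun x => G x - G' x) := by
  refine ⟨hu.1.sub hv.1, fun i j => (hu.2.1 i j).sub (hv.2.1 i j), fun η hη i j => ?_⟩
  have h1 := hu.2.2 η hη i j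
  have h2 := hv.2.2 η hη i j
  simp only [Measure.restrict_univ] at h1 h2 ⊢
  have hη' : Continuous (fun x => fderiv ℝ η x (EuclideanSpace.single j 1)) :=
    (hη.1.continuous_fderiv_apply (by simp)).comp (continuous_id.prodMk continuous_const)
  have hηc := hη.2.1.fderiv_apply (𝕜 := ℝ) (EuclideanSpace.single j 1)
  have happ : ∀ {w : EuclideanSpace ℝ (Fin n) → EuclideanSpace ℝ (Fin n)},
      LocallyIntegrableOn w univ → LocallyIntegrable (fun x => w x i) := by
    intro w hw
    have hw' := locallyIntegrableOn_univ.1 hw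
    exact hw'.mono ((EuclideanSpace.proj (𝕜 := ℝ) i).continuous.comp_aestronglyMeasurable
      hw'.aestronglyMeasurable) (Eventually.of_forall fun x => abs_apply_le_norm _ i)
  have i1 := integrable_mul_of_locallyIntegrable (happ hu.1) hη' hηc
  have i2 := integrable_mul_of_locallyIntegrable (happ hv.1) hη' hηc
  have i3 := integrable_mul_of_locallyIntegrable (locallyIntegrableOn_univ.1 (hu.2.1 i j))
    hη.1.continuous hη.2.1
  have i4 := integrable_mul_of_locallyIntegrable (locallyIntegrableOn_univ.1 (hv.2.1 i j))
    hη.1.continuous hη.2.1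
  simp only [PiLp.sub_apply, Matrix.sub_apply, sub_mul]
  rw [integral_sub i1 i2, integral_sub i3 i4, h1, h2]
  ring

/-- The value of the profile at the boundary. -/
lemma sqProfile_one (H : Admissible n a b l₁ l₂) (hb : b < 1) :
    sqProfile n a b l₁ l₂ 1 = realRoot n (l₂ * (1 - b ^ n)) := by
  have h1 : ¬ (1 : ℝ) ≤ a := not_le.2 (H.le.trans_lt hb)
  simp [sqProfile, profile, h1, not_le.2 hb]

lemma regular_of_lt (H : Admissible n a b l₁ l₂) (hs : b ^ 2 < s) : Regular a b s :=
  ⟨(sq_nonneg b).trans_lt hs, (H.sq_le.trans_lt hs).ne', hs.ne'⟩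

/-- The interval stays away from the singular value `b²`, so the profile is `C¹` up to `s = 1`. The
linear rate offsets the gradient of the boundary cutoff, of size `1 / (1 - |x|²)`. -/
lemma exists_abs_sqProfile_sub_le (H : Admissible n a b l₁ l₂) {s₀ : ℝ} (hs₀ : b ^ 2 < s₀) :
    ∃ K, 0 ≤ K ∧ ∀ s, s₀ ≤ s → s ≤ 1 →
      |sqProfile n a b l₁ l₂ s - sqProfile n a b l₁ l₂ 1| ≤ K * (1 - s) := by
  have h1 : ContDiffOn ℝ 1 (sqProfile n a b l₁ l₂) (Icc s₀ 1) := fun s hs =>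
    ((contDiffAt_sqProfile H (regular_of_lt H (hs₀.trans_le hs.1))).of_le
      (by simp)).contDiffWithinAt
  obtain ⟨K, hK⟩ := h1.exists_lipschitzOnWith one_ne_zero (convex_Icc s₀ 1) isCompact_Icc
  refine ⟨K, K.2, fun s hs hs1 => ?_⟩
  have := hK.dist_le_mul s ⟨hs, hs1⟩ 1 ⟨hs.trans hs1, le_rfl⟩
  rwa [Real.dist_eq, Real.dist_eq, abs_of_nonpos (sub_nonpos.2 hs1), neg_sub] at this

/-- The defining function of the ball. -/
def ballFun (x : EuclideanSpace ℝ (Fin n)) : ℝ := 1 - ‖x‖ ^ 2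

lemma contDiff_ballFun {m : ℕ∞} : ContDiff ℝ m (ballFun (n := n)) :=
  contDiff_const.sub (contDiff_norm_sq ℝ)

lemma fderiv_ballFun_single (x : EuclideanSpace ℝ (Fin n)) (j : Fin n) :
    fderiv ℝ ballFun x (EuclideanSpace.single j 1) = -(2 * x j) := by
  have h1 : HasDerivAt (fun s : ℝ => 1 - s) (-1) (‖x‖ ^ 2) := (hasDerivAt_id _).const_sub 1
  refine (fderiv_comp_norm_sq_single h1 j).trans ?_
  ring

lemma ballFun_pos {x : EuclideanSpace ℝ (Fin n)} (hx : x ∈ ball 0 1) : 0 < ballFun x := by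
  have h1 : ‖x‖ < 1 := mem_ball_zero_iff.1 hx
  have : ‖x‖ ^ 2 < 1 := by nlinarith [norm_nonneg x]
  unfold ballFun
  linarith

/-- Approximations of `u - c x` by test functions of the ball. -/
def ballApprox (n : ℕ) (N a b l₁ l₂ c : ℝ) (k : ℕ) (x : EuclideanSpace ℝ (Fin n)) :
    EuclideanSpace ℝ (Fin n) :=
  cutoffAlong ballFun k x •
    (cutoffAlong (singFun N a b) k x • radialMap n a b l₁ l₂ x - c • x)

/-! ### Approximation of `u - c x` by test functions of the ball -/

variable {N c : ℝ} {k : ℕ}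

lemma contDiff_cutoffAlong_singFun_smul (H : Admissible n a b l₁ l₂) (hN : 0 < N) (k : ℕ) :
    ContDiff ℝ ∞ (fun x => cutoffAlong (singFun N a b) k x • radialMap n a b l₁ l₂ x) :=
  contDiff_cutoffAlong_smul (contDiff_singFun (m := ⊤) N a b)
    (fun _ hx => contDiffAt_radialMap H ((singFun_pos_iff hN).1 hx)) k

lemma isTest_ballApprox (H : Admissible n a b l₁ l₂) (hN : 0 < N) (c : ℝ) (k : ℕ) :
    IsTest ⊤ (ball 0 1) (ballApprox n N a b l₁ l₂ c k) := by
  have hsub : tsupport (ballApprox n N a b l₁ l₂ c k) ⊆ ball 0 1 := by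
    refine (tsupport_smul_subset_left _ _).trans
      ((tsupport_cutoffAlong_subset_pos (contDiff_ballFun (m := 0)).continuous).trans ?_)
    intro x hx
    have h1 : 0 < 1 - ‖x‖ ^ 2 := hx
    rw [mem_ball_zero_iff]
    by_contra h2
    nlinarith [not_lt.1 h2]
  refine ⟨?_, ?_, hsub⟩
  · exact (contDiff_cutoffAlong (contDiff_ballFun (m := ⊤)) k).smul
      ((contDiff_cutoffAlong_singFun_smul H hN k).sub (contDiff_id.const_smul c))
  · exact (isCompact_closedBall (0 : EuclideanSpace ℝ (Fin n)) 1).of_isClosed_subset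
      (isClosed_tsupport _) (hsub.trans ball_subset_closedBall)

lemma jacobian_ballApprox (H : Admissible n a b l₁ l₂) (hN : 0 < N)
    {x : EuclideanSpace ℝ (Fin n)} (hx : Regular a b (‖x‖ ^ 2)) (i j : Fin n) :
    jacobian (ballApprox n N a b l₁ l₂ c k) x i j
      = cutoffAlong ballFun k x * (cutoffAlong (singFun N a b) k x * gradField n a b l₁ l₂ x i j
          + fderiv ℝ (cutoffAlong (singFun N a b) k) x (EuclideanSpace.single j 1)
            * radialMap n a b l₁ l₂ x i - (c • (1 : Matrix (Fin n) (Fin n) ℝ)) i j)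
        + fderiv ℝ (cutoffAlong ballFun k) x (EuclideanSpace.single j 1)
          * (cutoffAlong (singFun N a b) k x * radialMap n a b l₁ l₂ x i - c * x i) := by
  have hd : DifferentiableAt ℝ (ballApprox n N a b l₁ l₂ c k) x :=
    (isTest_ballApprox H hN c k).1.differentiable (by simp) x
  rw [jacobian_apply hd]
  have h1 : HasFDerivAt (cutoffAlong (ballFun (n := n)) k) (fderiv ℝ (cutoffAlong ballFun k) x) x :=
    ((contDiff_cutoffAlong (contDiff_ballFun (m := 1)) k).differentiable
      (by norm_num) x).hasFDerivAt
  have h2 : HasFDerivAt (cutoffAlong (singFun (n := n) N a b) k)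
      (fderiv ℝ (cutoffAlong (singFun N a b) k) x) x :=
    ((contDiff_cutoffAlong (contDiff_singFun (m := 1) N a b) k).differentiable
      (by norm_num) x).hasFDerivAt
  have h3 := ((contDiffAt_radialMap_apply H hx i).differentiableAt (by simp)).hasFDerivAt
  have h4 := (h1.mul ((h2.mul h3).sub ((hasFDerivAt_apply (x := x) i).const_mul c))).fderiv
  refine (congrArg (fun L => L (EuclideanSpace.single j 1)) h4).trans ?_
  simp only [add_apply, smul_apply, sub_apply, smul_eq_mul, fderiv_radialMap_apply H hx,
    Pi.mul_apply, Pi.sub_apply]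
  by_cases hij : i = j
  · subst hij
    simp
    ring
  · simp [hij]
    ring

/-- Scaling `singFun` makes the interior cutoff identically `1` near the unit sphere for every `k`.
There the approximated function is exactly `u - c x`, whose vanishing on the sphere is needed. -/
lemma exists_singFun_ge (H : Admissible n a b l₁ l₂) {s₀ : ℝ} (hs₀ : b ^ 2 < s₀) :
    ∃ N, 0 < N ∧ ∀ x : EuclideanSpace ℝ (Fin n), s₀ ≤ ‖x‖ ^ 2 → 2 ≤ singFun N a b x := by
  have h0 : 0 < s₀ := (sq_nonneg b).trans_lt hs₀
  have h1 : 0 < s₀ - a ^ 2 := sub_pos.2 (H.sq_le.trans_lt hs₀)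
  have h2 : 0 < s₀ - b ^ 2 := sub_pos.2 hs₀
  set d := s₀ * (s₀ - a ^ 2) * (s₀ - b ^ 2) with hd
  have hd0 : 0 < d := by positivity
  refine ⟨2 / d ^ 2, by positivity, fun x hx => ?_⟩
  have h3 : d ≤ ‖x‖ ^ 2 * (‖x‖ ^ 2 - a ^ 2) * (‖x‖ ^ 2 - b ^ 2) := by
    rw [hd]
    have h4 : 0 ≤ ‖x‖ ^ 2 - a ^ 2 := by linarith
    gcongr
  have h5 : d ^ 2 ≤ (‖x‖ ^ 2 * (‖x‖ ^ 2 - a ^ 2) * (‖x‖ ^ 2 - b ^ 2)) ^ 2 :=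
    pow_le_pow_left₀ hd0.le h3 2
  rw [singFun, div_mul_eq_mul_div, le_div_iff₀ (by positivity)]
  linarith

/-- The boundary layer terms of the approximations are bounded. -/
lemma exists_boundary_layer_le (H : Admissible n a b l₁ l₂) {s₀ : ℝ} (hs₀ : b ^ 2 < s₀)
    (hs₁ : s₀ < 1)
    (hN2 : ∀ x : EuclideanSpace ℝ (Fin n), s₀ ≤ ‖x‖ ^ 2 → 2 ≤ singFun N a b x)
    (hc : c = sqProfile n a b l₁ l₂ 1) :
    ∃ D, ∀ k, ∀ᵐ x ∂(volume.restrict (ball (0 : EuclideanSpace ℝ (Fin n)) 1)), ∀ i j,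
      |fderiv ℝ (cutoffAlong ballFun k) x (EuclideanSpace.single j 1)
          * (cutoffAlong (singFun N a b) k x * radialMap n a b l₁ l₂ x i - c * x i)| ≤ D := by
  obtain ⟨C, hC0, hC⟩ := exists_abs_mul_deriv_cutoff_le
  obtain ⟨K, hK0, hK⟩ := exists_abs_sqProfile_sub_le H hs₀
  obtain ⟨B, hB0, hB⟩ := exists_norm_radialMap_le H 1
  have hs₁' : 0 < 1 - s₀ := by linarith
  refine ⟨2 * C * (K + (B + |c|) / (1 - s₀)), fun k => ?_⟩
  filter_upwards [hB, ae_restrict_mem measurableSet_ball] with x hx hx1 i j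
  have hpos := ballFun_pos hx1
  have hx1' : ‖x‖ ≤ 1 := (mem_ball_zero_iff.1 hx1).le
  have hxi : ∀ i, |x i| ≤ 1 := fun i => (abs_apply_le_norm x i).trans hx1'
  have h1 : |fderiv ℝ (cutoffAlong ballFun k) x (EuclideanSpace.single j 1)|
      ≤ C * (2 / ballFun x) := by
    refine (abs_fderiv_cutoffAlong_le hC contDiff_ballFun hpos.ne' _).trans ?_
    rw [fderiv_ballFun_single, abs_neg, abs_mul, abs_of_pos (two_pos : (0 : ℝ) < 2),
      abs_of_pos hpos]
    have := hxi j
    gcongr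
    linarith
  have h2 : |cutoffAlong (singFun N a b) k x * radialMap n a b l₁ l₂ x i - c * x i|
      ≤ (K + (B + |c|) / (1 - s₀)) * ballFun x := by
    have e : 0 ≤ (B + |c|) / (1 - s₀) := by positivity
    -- Near the sphere the Lipschitz bound applies; further inside, `ballFun` is at least `1 - s₀`
    -- and boundedness of the map is enough.
    by_cases hs : s₀ ≤ ‖x‖ ^ 2
    · rw [cutoffAlong_eq_one (hN2 x hs), one_mul, radialMap_apply, ← sub_mul, abs_mul]
      have h3 := hK (‖x‖ ^ 2) hs (by unfold ballFun at hpos; linarith)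
      rw [← hc] at h3
      calc _ ≤ K * (1 - ‖x‖ ^ 2) * 1 :=
            mul_le_mul h3 (hxi i) (abs_nonneg _) ((abs_nonneg _).trans h3)
        _ = K * ballFun x := by rw [mul_one, ballFun]
        _ ≤ _ := by
            gcongr
            linarith
    · have h3 : |cutoffAlong (singFun N a b) k x * radialMap n a b l₁ l₂ x i - c * x i|
          ≤ B + |c| := by
        refine (abs_sub _ _).trans (add_le_add ?_ ?_)
        · rw [abs_mul]
          exact (mul_le_of_le_one_left (abs_nonneg _) abs_cutoffAlong_le_one).trans
            ((abs_apply_le_norm _ i).trans hx)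
        · rw [abs_mul]
          exact mul_le_of_le_one_right (abs_nonneg _) (hxi i)
      have h4 : 1 - s₀ ≤ ballFun x := by
        unfold ballFun
        linarith [not_le.1 hs]
      calc _ ≤ (B + |c|) / (1 - s₀) * (1 - s₀) := by rwa [div_mul_cancel₀ _ hs₁'.ne']
        _ ≤ (B + |c|) / (1 - s₀) * ballFun x := by gcongr
        _ ≤ _ := by
            gcongr
            linarith
  rw [abs_mul]
  calc _ ≤ C * (2 / ballFun x) * ((K + (B + |c|) / (1 - s₀)) * ballFun x) :=
        mul_le_mul h1 h2 (abs_nonneg _) (by positivity)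
    _ = _ := by
        field_simp

lemma tendsto_cutoffAlong_ballFun {x : EuclideanSpace ℝ (Fin n)} (hx : x ∈ ball 0 1) :
    Tendsto (fun k => cutoffAlong ballFun k x) atTop (𝓝 1) :=
  tendsto_cutoffAlong (contDiff_ballFun (m := 0)).continuous (ballFun_pos hx)

lemma tendsto_cutoffAlong_singFun (hN : 0 < N) {x : EuclideanSpace ℝ (Fin n)}
    (hx : Regular a b (‖x‖ ^ 2)) :
    Tendsto (fun k => cutoffAlong (singFun N a b) k x) atTop (𝓝 1) :=
  tendsto_cutoffAlong (contDiff_singFun (m := 0) N a b).continuous ((singFun_pos_iff hN).2 hx)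

lemma tendsto_eLpNorm_sub_ballApprox (H : Admissible n a b l₁ l₂) (hN : 0 < N) (c : ℝ) {p : ℝ}
    (hp : 1 ≤ p) :
    Tendsto (fun k => eLpNorm (fun x => (radialMap n a b l₁ l₂ x - c • x)
      - ballApprox n N a b l₁ l₂ c k x) (ENNReal.ofReal p) (volume.restrict (ball 0 1)))
      atTop (𝓝 0) := by
  have : IsFiniteMeasure (volume.restrict (ball (0 : EuclideanSpace ℝ (Fin n)) 1)) :=
    ⟨by simpa using measure_ball_lt_top⟩
  obtain ⟨B, hB0, hB⟩ := exists_norm_radialMap_le H 1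
  refine tendsto_eLpNorm_zero_of_dominated hp (g := fun _ => 2 * (B + |c|))
    (memLp_const _) ?_ ?_ ?_
  · intro k
    exact ((measurable_radialMap.sub (measurable_id.const_smul c)).sub
      (isTest_ballApprox H hN c k).1.continuous.measurable).aestronglyMeasurable
  · intro k
    filter_upwards [hB, ae_restrict_mem measurableSet_ball] with x hx hx1
    have h1 : ‖c • x‖ ≤ |c| := by
      rw [norm_smul, Real.norm_eq_abs]
      exact mul_le_of_le_one_right (abs_nonneg _) (mem_ball_zero_iff.1 hx1).le
    have h2 : ‖radialMap n a b l₁ l₂ x - c • x‖ ≤ B + |c| :=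
      (norm_sub_le _ _).trans (add_le_add hx h1)
    have h3 : ‖ballApprox n N a b l₁ l₂ c k x‖ ≤ B + |c| := by
      rw [ballApprox, norm_smul, Real.norm_eq_abs]
      refine (mul_le_of_le_one_left (norm_nonneg _) abs_cutoffAlong_le_one).trans ?_
      refine (norm_sub_le _ _).trans (add_le_add ?_ h1)
      rw [norm_smul, Real.norm_eq_abs]
      exact (mul_le_of_le_one_left (norm_nonneg _) abs_cutoffAlong_le_one).trans hx
    refine (norm_sub_le _ _).trans ?_
    linarith
  · filter_upwards [ae_restrict_of_ae H.ae_regular, ae_restrict_mem measurableSet_ball]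
      with x hx hx1
    have h1 := (tendsto_cutoffAlong_ballFun hx1).smul
      (((tendsto_cutoffAlong_singFun hN hx).smul_const (radialMap n a b l₁ l₂ x)).sub_const (c • x))
    have h2 := h1.const_sub (radialMap n a b l₁ l₂ x - c • x)
    simpa [ballApprox] using h2

/-- Dominated convergence: the gradient of the interior cutoff times `u` is controlled by the same
`L^p` weight as `Du`, and the boundary layer is bounded uniformly in `k`. -/
lemma tendsto_eLpNorm_sub_jacobian_ballApprox (H : Admissible n a b l₁ l₂) (hb : b < 1)
    (hN : 0 < N)
    (hN2 : ∀ x : EuclideanSpace ℝ (Fin n), (1 + b ^ 2) / 2 ≤ ‖x‖ ^ 2 → 2 ≤ singFun N a b x)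
    (hc : c = sqProfile n a b l₁ l₂ 1) {p : ℝ} (hp : 1 ≤ p)
    (hpn : p < (n : ℝ) / ((n : ℝ) - 1)) (i j : Fin n) :
    Tendsto (fun k => eLpNorm (fun x =>
      (gradField n a b l₁ l₂ x - c • (1 : Matrix (Fin n) (Fin n) ℝ)) i j
      - jacobian (ballApprox n N a b l₁ l₂ c k) x i j) (ENNReal.ofReal p)
      (volume.restrict (ball 0 1))) atTop (𝓝 0) := by
  have hb2 : b ^ 2 < 1 := by nlinarith [H.pos']
  obtain ⟨C, hC0, hC⟩ := exists_abs_mul_deriv_cutoff_le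
  obtain ⟨D, hD⟩ := exists_boundary_layer_le H (s₀ := (1 + b ^ 2) / 2) (by linarith)
    (by linarith) hN2 hc
  obtain ⟨C₁, hC₁0, hC₁⟩ := exists_abs_gradField_le H 1
  obtain ⟨C₂, hC₂0, hC₂⟩ := exists_abs_radialMap_mul_singularWeight_le H 1
  have : IsFiniteMeasure (volume.restrict (ball (0 : EuclideanSpace ℝ (Fin n)) 1)) :=
    ⟨by simpa using measure_ball_lt_top⟩
  set δ := (c • (1 : Matrix (Fin n) (Fin n) ℝ)) i j
  have hpos := fun x => singFun_pos_iff (n := n) (a := a) (b := b) hN (x := x)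
  refine tendsto_eLpNorm_zero_of_dominated hp
    (g := fun x => (2 * C₁ + 4 * C * C₂) * (‖x‖⁻¹ + weight n a b ‖x‖) + (2 * |δ| + D))
    (((memLp_weight H.two_le hp hpn a b 1).const_mul _).add (memLp_const _)) ?_ ?_ ?_
  · intro k
    exact (((measurable_gradField i j).sub_const δ).sub (continuous_jacobian
      ((isTest_ballApprox H hN c k).1.of_le (by simp)) i j).measurable).aestronglyMeasurable
  · intro k
    filter_upwards [ae_restrict_of_ae H.ae_regular, hC₁, hC₂, hD k] with x hx h1 h2 h3
    rw [jacobian_ballApprox H hN hx, Matrix.sub_apply]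
    have e1 := h1 i j
    rw [Real.norm_eq_abs] at e1
    have e2 := h3 i j
    set γ := gradField n a b l₁ l₂ x i j
    set d := ‖x‖⁻¹ + weight n a b ‖x‖
    have e3 : |fderiv ℝ (cutoffAlong (singFun N a b) k) x (EuclideanSpace.single j 1)
        * radialMap n a b l₁ l₂ x i| ≤ 4 * C * C₂ * d := by
      have f1 := abs_fderiv_cutoffAlong_le (k := k) hC (contDiff_singFun (m := 1) N a b)
        ((hpos x).2 hx).ne' (EuclideanSpace.single j 1)
      have f2 := abs_fderiv_singFun_div_le hN H.pos.le H.pos'.le hx j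
      have f3 := abs_apply_le_norm (radialMap n a b l₁ l₂ x) i
      have f4 := singularWeight_nonneg (a := a) (b := b) (norm_nonneg x)
      rw [abs_mul]
      calc _ ≤ C * (4 * singularWeight a b ‖x‖) * ‖radialMap n a b l₁ l₂ x‖ :=
            mul_le_mul (f1.trans (mul_le_mul_of_nonneg_left f2 hC0)) f3 (abs_nonneg _)
              (by positivity)
        _ = 4 * C * (‖radialMap n a b l₁ l₂ x‖ * singularWeight a b ‖x‖) := by ring
        _ ≤ 4 * C * (C₂ * d) := by gcongr
        _ = _ := by ring
    have e4 : |cutoffAlong (singFun N a b) k x * γ| ≤ |γ| := by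
      rw [abs_mul]
      exact mul_le_of_le_one_left (abs_nonneg _) abs_cutoffAlong_le_one
    set A := cutoffAlong (singFun N a b) k x * γ
    set A' := fderiv ℝ (cutoffAlong (singFun N a b) k) x (EuclideanSpace.single j 1)
        * radialMap n a b l₁ l₂ x i
    set A'' := fderiv ℝ (cutoffAlong ballFun k) x (EuclideanSpace.single j 1)
          * (cutoffAlong (singFun N a b) k x * radialMap n a b l₁ l₂ x i - c * x i)
    have e5 : |cutoffAlong ballFun k x * (A + A' - δ)| ≤ |A| + |A'| + |δ| := by
      rw [abs_mul]
      refine (mul_le_of_le_one_left (abs_nonneg _) abs_cutoffAlong_le_one).trans ?_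
      exact (abs_sub _ _).trans (add_le_add (abs_add_le _ _) le_rfl)
    calc |γ - δ - (cutoffAlong ballFun k x * (A + A' - δ) + A'')|
        ≤ |γ| + |δ| + (|A| + |A'| + |δ| + |A''|) :=
          (abs_sub _ _).trans (add_le_add (abs_sub _ _)
            ((abs_add_le _ _).trans (add_le_add e5 le_rfl)))
      _ ≤ _ := by
          linarith
  · filter_upwards [ae_restrict_of_ae H.ae_regular, ae_restrict_mem measurableSet_ball]
      with x hx hx1
    simp only [jacobian_ballApprox H hN hx]
    have t1 := tendsto_cutoffAlong_ballFun hx1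
    have t2 := tendsto_cutoffAlong_singFun hN hx
    have t3 := tendsto_fderiv_cutoffAlong (contDiff_ballFun (n := n) (m := 0)).continuous
      (ballFun_pos hx1) (EuclideanSpace.single j 1)
    have t4 := tendsto_fderiv_cutoffAlong (contDiff_singFun (n := n) (m := 0) N a b).continuous
      ((hpos x).2 hx) (EuclideanSpace.single j 1)
    have t5 := (t1.mul (((t2.mul_const (gradField n a b l₁ l₂ x i j)).add
      (t4.mul_const (radialMap n a b l₁ l₂ x i))).sub_const δ)).add
      (t3.mul ((t2.mul_const (radialMap n a b l₁ l₂ x i)).sub_const (c * x i)))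
    have t6 := t5.const_sub ((gradField n a b l₁ l₂ x - c • (1 : Matrix (Fin n) (Fin n) ℝ)) i j)
    have e : (gradField n a b l₁ l₂ x - c • (1 : Matrix (Fin n) (Fin n) ℝ)) i j
        - (1 * (1 * gradField n a b l₁ l₂ x i j + 0 * radialMap n a b l₁ l₂ x i - δ)
          + 0 * (1 * radialMap n a b l₁ l₂ x i - c * x i)) = 0 := by
      rw [Matrix.sub_apply]
      ring
    rw [e] at t6
    exact t6

theorem memW1pZero_radialMap_sub (H : Admissible n a b l₁ l₂) (hb : b < 1) {p : ℝ} (hp : 1 ≤ p)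
    (hpn : p < (n : ℝ) / ((n : ℝ) - 1)) :
    MemW1pZero (ENNReal.ofReal p) (ball 0 1)
      (fun x => radialMap n a b l₁ l₂ x - realRoot n (l₂ * (1 - b ^ n)) • x) := by
  have : IsFiniteMeasure (volume.restrict (ball (0 : EuclideanSpace ℝ (Fin n)) 1)) :=
    ⟨by simpa using measure_ball_lt_top⟩
  rw [← sqProfile_one H hb]
  set c := sqProfile n a b l₁ l₂ 1 with hc
  -- The threshold is the midpoint of `b²` and `1`.
  obtain ⟨N, hN, hN2⟩ := exists_singFun_ge H (s₀ := (1 + b ^ 2) / 2) (by nlinarith [H.pos'])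
  refine ⟨fun x => gradField n a b l₁ l₂ x - c • (1 : Matrix (Fin n) (Fin n) ℝ),
    ((hasWeakJacobian_radialMap H).sub (hasWeakJacobian_smul c)).restrict, ?_, fun i j => ?_,
    ballApprox n N a b l₁ l₂ c, isTest_ballApprox H hN c,
    tendsto_eLpNorm_sub_ballApprox H hN c hp,
    tendsto_eLpNorm_sub_jacobian_ballApprox H hb hN hN2 hc hp hpn⟩
  · refine (memLp_radialMap H _ 1).sub ?_
    refine MemLp.of_bound (measurable_id.const_smul c).aestronglyMeasurable |c| ?_
    filter_upwards [ae_restrict_mem measurableSet_ball] with x hx1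
    change ‖c • x‖ ≤ |c|
    rw [norm_smul, Real.norm_eq_abs]
    exact mul_le_of_le_one_right (abs_nonneg _) (mem_ball_zero_iff.1 hx1).le
  · exact (memLp_gradField H hp hpn 1 i j).sub (memLp_const _)

lemma continuousAt_radialMap_of_mem_sphere (H : Admissible n a b l₁ l₂) (hb : b < 1)
    {x : EuclideanSpace ℝ (Fin n)} (hx : x ∈ sphere 0 1) :
    ContinuousAt (radialMap n a b l₁ l₂) x ∧
      radialMap n a b l₁ l₂ x = realRoot n (l₂ * (1 - b ^ n)) • x := by
  have hx1 : ‖x‖ = 1 := mem_sphere_zero_iff_norm.1 hx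
  have hb2 : b ^ 2 < 1 := by nlinarith [H.pos']
  constructor
  · refine (contDiffAt_radialMap H (regular_of_lt H ?_)).continuousAt
    rw [hx1]
    simpa using hb2
  · rw [radialMap_eq, hx1, one_pow, sqProfile_one H hb]

/-! ### The Jacobian determinant is not constant -/

theorem not_exists_det_ae_eq (H : Admissible n a b l₁ l₂) (hb : b < 1) (hl : l₁ ≠ l₂)
    {G : EuclideanSpace ℝ (Fin n) → Matrix (Fin n) (Fin n) ℝ}
    (hG : HasWeakJacobian (ball 0 1) (radialMap n a b l₁ l₂) G) :
    ¬ ∃ c : ℝ, ∀ᵐ x ∂(volume.restrict (ball (0 : EuclideanSpace ℝ (Fin n)) 1)),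
      (G x).det = c := by
  rintro ⟨c, hc⟩
  have hb0 := H.pos'
  have h1 : ∀ᵐ x ∂(volume.restrict (ball (0 : EuclideanSpace ℝ (Fin n)) 1)),
      level a b l₁ l₂ (‖x‖ ^ 2) = c := by
    filter_upwards [hc, hG.ae_eq isOpen_ball (hasWeakJacobian_radialMap H).restrict,
      ae_restrict_of_ae H.ae_regular] with x h1 h2 h3
    rw [← det_gradField H h3, ← h2, h1]
  rw [ae_restrict_iff' measurableSet_ball] at h1
  -- A set of full measure is dense, so it meets both the ball `|x| < a`, where the level is `l₁`,
  -- and the shell `b < |x| < 1`, where it is `l₂`.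
  have hdense := Measure.dense_of_ae h1
  have key : ∀ U : Set (EuclideanSpace ℝ (Fin n)), IsOpen U → U.Nonempty → U ⊆ ball 0 1 →
      ∃ x ∈ U, level a b l₁ l₂ (‖x‖ ^ 2) = c := by
    intro U hU hne hsub
    obtain ⟨x, hx, hxU⟩ := hdense.exists_mem_open hU hne
    exact ⟨x, hxU, hx (hsub hxU)⟩
  obtain ⟨x, hx, hxc⟩ := key (ball 0 a) isOpen_ball (nonempty_ball.2 H.pos)
    (ball_subset_ball (H.le.trans hb.le))
  have hxa : ‖x‖ ^ 2 < a ^ 2 :=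
    pow_lt_pow_left₀ (mem_ball_zero_iff.1 hx) (norm_nonneg x) two_ne_zero
  have hne : {y : EuclideanSpace ℝ (Fin n) | b < ‖y‖ ∧ ‖y‖ < 1}.Nonempty := by
    have hn : 0 < n := by
      have := H.two_le
      omega
    refine ⟨EuclideanSpace.single ⟨0, hn⟩ ((b + 1) / 2), ?_⟩
    have : ‖(EuclideanSpace.single (⟨0, hn⟩ : Fin n) ((b + 1) / 2) : EuclideanSpace ℝ (Fin n))‖
        = (b + 1) / 2 := by
      rw [PiLp.norm_single, Real.norm_eq_abs, abs_of_pos (by linarith)]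
    change b < ‖_‖ ∧ ‖_‖ < 1
    rw [this]
    constructor <;> linarith
  obtain ⟨y, hy, hyc⟩ := key _ ((isOpen_lt continuous_const continuous_norm).inter
    (isOpen_lt continuous_norm continuous_const)) hne (fun y hy => mem_ball_zero_iff.2 hy.2)
  have hyb : b ^ 2 < ‖y‖ ^ 2 := pow_lt_pow_left₀ hy.1 hb0.le two_ne_zero
  simp only [level, hxa, if_true] at hxc
  simp only [level, not_lt.2 hyb.le, not_lt.2 (H.sq_le.trans hyb.le), if_false] at hyc
  exact hl (hxc.trans hyc.symm)

/-- For `l₂ = 0` the profile vanishes beyond `b < 1`, so the claim for `u χ_B` is the weak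
formulation of `u` on the whole space. -/
lemma indicator_ball_radialMap (H : Admissible n a b l₁ 0) (hb : b < 1) :
    (ball (0 : EuclideanSpace ℝ (Fin n)) 1).indicator (radialMap n a b l₁ 0)
      = radialMap n a b l₁ 0 := by
  refine indicator_eq_self.2 fun x hx => ?_
  by_contra h1
  apply hx
  have h2 : 1 ≤ ‖x‖ := not_lt.1 fun h' => h1 (mem_ball_zero_iff.2 h')
  have h3 : ¬ ‖x‖ ≤ b := by linarith
  have h4 : ¬ ‖x‖ ≤ a := by linarith [H.le]
  simp [radialMap, profile, h3, h4, realRoot_zero H.ne_zero]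

end RadialDet

end

theorem mainTheorem4 (n : ℕ) (hn : 2 ≤ n) (h : ℝ → ℝ) (hh : Continuous h)
    (a b l₁ l₂ : ℝ) (ha : 0 < a) (hab : a ≤ b) (hb : b < 1) (hl : l₁ ≠ l₂)
    -- for even `n` the quantities under the `n`-th roots have to be nonnegative
    (heven : Even n → l₁ ≤ 0 ∧ 0 ≤ l₂) :
    -- `u ∈ W^{1,p}(B)` for all `1 ≤ p < n/(n-1)`
    (∀ p : ℝ, 1 ≤ p → p < (n : ℝ) / ((n : ℝ) - 1) →
      RadialDet.MemW1p (ENNReal.ofReal p) (Metric.ball (0 : EuclideanSpace ℝ (Fin n)) 1)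
        (RadialDet.radialMap n a b l₁ l₂)) ∧
    -- `u` is a weak solution in `B`
    RadialDet.IsWeakSolution h (Metric.ball (0 : EuclideanSpace ℝ (Fin n)) 1)
      (RadialDet.radialMap n a b l₁ l₂) ∧
    -- the Dirichlet condition, in the sense of `W^{1,p}_0(B)` ...
    (∀ p : ℝ, 1 ≤ p → p < (n : ℝ) / ((n : ℝ) - 1) →
      RadialDet.MemW1pZero (ENNReal.ofReal p) (Metric.ball (0 : EuclideanSpace ℝ (Fin n)) 1)
        (fun x => RadialDet.radialMap n a b l₁ l₂ x
          - RadialDet.realRoot n (l₂ * (1 - b ^ n)) • x)) ∧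
    -- ... and pointwise, `u` being continuous up to the boundary
    (∀ x ∈ Metric.sphere (0 : EuclideanSpace ℝ (Fin n)) 1,
      ContinuousWithinAt (RadialDet.radialMap n a b l₁ l₂) (Metric.closedBall 0 1) x ∧
      RadialDet.radialMap n a b l₁ l₂ x = RadialDet.realRoot n (l₂ * (1 - b ^ n)) • x) ∧
    -- `det Du` is not (a.e. equal to) a constant on `B`
    (∀ G, RadialDet.HasWeakJacobian (Metric.ball (0 : EuclideanSpace ℝ (Fin n)) 1)
        (RadialDet.radialMap n a b l₁ l₂) G →
      ¬ ∃ c : ℝ, ∀ᵐ x ∂(volume.restrict (Metric.ball (0 : EuclideanSpace ℝ (Fin n)) 1)),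
        (G x).det = c) ∧
    -- for `l₂ = 0`, `u χ_B` is a weak solution on `ℝⁿ`, and the identity on `B` holds for all
    -- `C¹` maps, compactly supported or not
    (l₂ = 0 →
      RadialDet.IsWeakSolution h Set.univ
        ((Metric.ball (0 : EuclideanSpace ℝ (Fin n)) 1).indicator
          (RadialDet.radialMap n a b l₁ l₂)) ∧
      ∀ G, RadialDet.HasWeakJacobian (Metric.ball (0 : EuclideanSpace ℝ (Fin n)) 1)
          (RadialDet.radialMap n a b l₁ l₂) G →
        ∀ ζ : EuclideanSpace ℝ (Fin n) → EuclideanSpace ℝ (Fin n), ContDiff ℝ 1 ζ →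
          IntegrableOn (fun x => h (G x).det *
            RadialDet.frob (RadialDet.cof (G x)) (RadialDet.jacobian ζ x))
            (Metric.ball (0 : EuclideanSpace ℝ (Fin n)) 1) ∧
          ∫ x in Metric.ball (0 : EuclideanSpace ℝ (Fin n)) 1, h (G x).det *
            RadialDet.frob (RadialDet.cof (G x)) (RadialDet.jacobian ζ x) = 0) := by
  have H : RadialDet.Admissible n a b l₁ l₂ := ⟨hn, ha, hab, heven⟩
  refine ⟨fun p hp hpn => RadialDet.memW1p_radialMap H hp hpn,
    RadialDet.isWeakSolution_radialMap H hh _,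
    fun p hp hpn => RadialDet.memW1pZero_radialMap_sub H hb hp hpn,
    fun x hx => ?_, fun G hG => RadialDet.not_exists_det_ae_eq H hb hl hG, ?_⟩
  · obtain ⟨h1, h2⟩ := RadialDet.continuousAt_radialMap_of_mem_sphere H hb hx
    exact ⟨h1.continuousWithinAt, h2⟩
  · rintro rfl
    refine ⟨?_, fun G hG ζ hζ => RadialDet.integral_ball_frob H hb hh hG hζ⟩
    rw [RadialDet.indicator_ball_radialMap H hb]
    exact RadialDet.isWeakSolution_radialMap H hh _
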